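/- Let $\mathbb{K}$ be a field, and write $\otimes=\otimes_{\mathbb K}$. For $\mathbb{K}$-algebras $A$ and $B$ (associative, unital) and a complex $R$ of $A\otimes B^{\mathrm{op}}$-modules with bounded cohomology, say that $R$ is a **dualizing complex over $(A,B)$** if $A$ is left noetherian, $B$ is right noetherian, and 1. $R$ has finite injective dimension over $A$ and over $B^{\mathrm{op}}$; 2. the cohomology modules of $R$ are finitely generated over $A$ and over $B^{\mathrm{op}}$; 3. the canonical morphisms $B\to \mathrm{RHom}_A(R,R)$ and $A\to\mathrm{RHom}_{B^{\mathrm{op}}}(R,R)$ are isomorphisms in the derived categories of $B$-bimodules and of $A$-bimodules respectively. If $A=B$, put $A^{\mathrm e}=A\otimes A^{\mathrm{op}}$. A dualizing complex $R$ over $A$ (i.e. over $(A,A)$) is **rigid** if there is an isomorphism $R\cong \mathrm{RHom}_{A^{\mathrm e}}(A,R\otimes R)$ in $\mathsf{D}(\mathsf{Mod}\,A^{\mathrm e})$, where $\mathrm{RHom}_{A^{\mathrm e}}$ is taken with respect to the outside $A^{\mathrm e}$-action $(a\otimes b)(x\otimes y)=ax\otimes yb$ on $R\otimes R$, and the right-hand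 side is an object of $\mathsf{D}(\mathsf{Mod}\,A^{\mathrm e})$ through the inside action $(c\otimes d)(x\otimes y)=xd\otimes cy$. **Theorem 3.1.** Let $R$ be a dualizing complex over $(A,B)$, and let $C=\mathrm{End}_{\mathsf{D}(\mathsf{Mod}\,A\otimes B^{\mathrm{op}})}(R)$; recall that the actions of the centers on $R$ induce isomorphisms $\mathrm{Z}(A)\cong C\cong \mathrm{Z}(B)$. Let $S\subset C$ be a multiplicatively closed set (containing $1$), and let $S_A\subset\mathrm{Z}(A)$ and $S_B\subset\mathrm{Z}(B)$ be the preimages of $S$. Let $A_S=S_A^{-1}\mathrm{Z}(A)\otimes_{\mathrm{Z}(A)}A$ and $B_S=S_B^{-1}\mathrm{Z}(B)\otimes_{\mathrm{Z}(B)}B$ be the corresponding central localizations. Then: 1. The complex $R_S:=A_S\otimes_A R\otimes_B B_S$ is a dualizing complex over $(A_S,B_S)$. 2. If $A=B$, $R$ is a rigid dualizing complex over $A$, and $A^{\mathrm e}$ is noetherian, then $S_A=S_B$ (so that $A_S=B_S$), and $R_S=A_S\otimes_A R\otimes_A A_S$ is a rigid dualizing complex over $A_S$. -/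

import Mathlib

open CategoryTheory
open scoped TensorProduct

universe u v

-- Morphisms of derived categories are computed in Mathlib's standard localization.
attribute [local instance] HasDerivedCategory.standard

noncomputable section

namespace YekutieliZhang

/-! ### Complexes of modules over noncommutative rings -/

section Modules

variable {E F G : Type u} [Ring E] [Ring F] [Ring G]

/-- Restriction of scalars of a complex of modules along a ring homomorphism `i : E → G`. -/
abbrev restrict (i : E →+* G) (M : CochainComplex (ModuleCat.{u} G) ℤ) :
    CochainComplex (ModuleCat.{u} E) ℤ :=
  ((ModuleCat.restrictScalars.{u} i).mapHomologicalComplex (ComplexShape.up ℤ)).obj M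

/-- `M` lies in the bounded derived category: its cohomology vanishes outside a finite range. -/
def HasBoundedCohomology (M : CochainComplex (ModuleCat.{u} E) ℤ) : Prop :=
  ∃ a b : ℤ, ∀ q : ℤ, (q < a ∨ b < q) → Limits.IsZero (M.homology q)

/-- `ι : M ⟶ I` is an injective resolution: a quasi-isomorphism to a bounded below complex of
injective modules. -/
structure IsInjectiveResolution {M I : CochainComplex (ModuleCat.{u} E) ℤ} (ι : M ⟶ I) : Prop where
  quasiIso : QuasiIso ι
  injective : ∀ q : ℤ, Injective (I.X q)
  boundedBelow : ∃ a : ℤ, ∀ q : ℤ, q < a → Limits.IsZero (I.X q)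

/-- `M` has finite injective dimension: it has a bounded injective resolution. -/
def HasFiniteInjectiveDimension (M : CochainComplex (ModuleCat.{u} E) ℤ) : Prop :=
  ∃ (I : CochainComplex (ModuleCat.{u} E) ℤ) (ι : M ⟶ I), IsInjectiveResolution ι ∧
    ∃ b : ℤ, ∀ q : ℤ, b < q → Limits.IsZero (I.X q)

/-- All cohomology modules of `M` are finitely generated. -/
def HasFiniteCohomology (M : CochainComplex (ModuleCat.{u} E) ℤ) : Prop :=
  ∀ q : ℤ, Module.Finite E (M.homology q)

/-- If `i : E → G` and `j : F → G` have commuting images, then on every `G`-module `M` the elements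
of `F` act by `E`-linear maps, naturally in `M`. -/
def commAct (i : E →+* G) (j : F →+* G) (h : ∀ e f, Commute (i e) (j f)) (f : F) :
    ModuleCat.restrictScalars.{u} i ⟶ ModuleCat.restrictScalars.{u} i where
  app M := ModuleCat.ofHom (X := (ModuleCat.restrictScalars i).obj M)
    (Y := (ModuleCat.restrictScalars i).obj M)
    { toFun := fun m => (j f • (show M from m) : M)
      map_add' := fun x y => smul_add (j f) (show M from x) (show M from y)
      map_smul' := fun e x => by
        change j f • (i e • (show M from x)) = i e • (j f • (show M from x))
        rw [smul_smul, smul_smul, (h e f).eq] }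
  naturality M N g := by
    ext m
    exact (g.hom.map_smul (j f) m).symm

/-- The action of `f : F` on the complex of `E`-modules underlying a complex of `G`-modules. -/
def commActComplex (i : E →+* G) (j : F →+* G) (h : ∀ e f, Commute (i e) (j f)) (f : F)
    (M : CochainComplex (ModuleCat.{u} G) ℤ) : restrict i M ⟶ restrict i M :=
  (NatTrans.mapHomologicalComplex (commAct i j h f) (ComplexShape.up ℤ)).app M

/-- For `ι : M ⟶ I` in complexes of `G`-modules, the map of complexes of abelian groups
`F → Hom_E(M, I)` (with `F` placed in degree `0`), sending `f` to `m ↦ ι (f m)`. -/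
def homothety (i : E →+* G) (j : F →+* G) (h : ∀ e f, Commute (i e) (j f))
    {M I : CochainComplex (ModuleCat.{u} G) ℤ} (ι : M ⟶ I) :
    (HomologicalComplex.single AddCommGrpCat.{u} (ComplexShape.up ℤ) 0).obj (AddCommGrpCat.of F) ⟶
      CochainComplex.HomComplex (restrict i M) (restrict i I) :=
  HomologicalComplex.mkHomFromSingle
    (AddCommGrpCat.ofHom (AddMonoidHom.mk'
      (fun f => (CochainComplex.HomComplex.Cochain.ofHom (commActComplex i j h f M ≫
        ((ModuleCat.restrictScalars.{u} i).mapHomologicalComplex (ComplexShape.up ℤ)).map ι) :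
          CochainComplex.HomComplex.Cochain (restrict i M) (restrict i I) 0))
      (fun f f' => by
        rw [← CochainComplex.HomComplex.Cochain.ofHom_add, ← Preadditive.add_comp]
        congr 2
        ext q m
        exact (congrArg (· • (show M.X q from m)) (j.map_add f f')).trans (add_smul _ _ _))))
    (fun q _ => by
      ext f
      exact CochainComplex.HomComplex.δ_ofHom (commActComplex i j h f M ≫
        ((ModuleCat.restrictScalars.{u} i).mapHomologicalComplex (ComplexShape.up ℤ)).map ι))

/-- The canonical morphism `F → RHom_E(M, M)` is an isomorphism, where `RHom_E(M, M)` is computed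
as `Hom_E(M, I)` with `M → I` an injective resolution over `G`. (The bimodule structure plays
no role for being an isomorphism in the derived category.) This is used when `G` is flat
over `E`, so that the terms of `I` are injective over `E`. -/
def HomothetyIsIso (i : E →+* G) (j : F →+* G) (h : ∀ e f, Commute (i e) (j f))
    (M : CochainComplex (ModuleCat.{u} G) ℤ) : Prop :=
  ∃ (I : CochainComplex (ModuleCat.{u} G) ℤ) (ι : M ⟶ I), IsInjectiveResolution ι ∧
    QuasiIso (homothety i j h ι)

/-- The action of the center of `G` on a complex of `G`-modules. -/
def centralAction (M : CochainComplex (ModuleCat.{u} G) ℤ) : Subring.center G →* End M where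
  toFun z :=
    { f := fun q => ModuleCat.ofHom
        { toFun := fun m => (z : G) • m
          map_add' := smul_add _
          map_smul' := fun g m => by
            simp only [RingHom.id_apply, smul_smul]
            rw [Subring.mem_center_iff.1 z.2 g] }
      comm' := fun p q _ => by
        ext m
        exact (M.d p q).hom.map_smul (z : G) m }
  map_one' := HomologicalComplex.hom_ext _ _ fun q => by
    ext m
    exact one_smul G m
  map_mul' z w := HomologicalComplex.hom_ext _ _ fun q => by
    ext m
    exact mul_smul (z : G) (w : G) m

/-- The relations `x φ(e) ⊗ m = x ⊗ e m`. -/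
def baseChangeRel (φ : E →+* F) (M : Type u) [AddCommGroup M] [Module E M] :
    Submodule F (F ⊗[ℤ] M) :=
  Submodule.span F {t | ∃ (x : F) (e : E) (m : M), t = (x * φ e) ⊗ₜ[ℤ] m - x ⊗ₜ[ℤ] (e • m)}

/-- The tensor product `F ⊗_E M` over the (noncommutative) ring `E`, as a left `F`-module. -/
abbrev BaseChange (φ : E →+* F) (M : Type u) [AddCommGroup M] [Module E M] : Type u :=
  (F ⊗[ℤ] M) ⧸ baseChangeRel φ M

/-- Functoriality of `F ⊗_E M` in `M`. -/
def baseChangeMap (φ : E →+* F) {M N : Type u} [AddCommGroup M] [Module E M]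
    [AddCommGroup N] [Module E N] (g : M →ₗ[E] N) : BaseChange φ M →ₗ[F] BaseChange φ N :=
  (baseChangeRel φ M).mapQ (baseChangeRel φ N)
    (TensorProduct.AlgebraTensorModule.lTensor F F (g.restrictScalars ℤ)) (by
      rw [baseChangeRel, Submodule.span_le]
      rintro _ ⟨x, e, m, rfl⟩
      exact Submodule.subset_span ⟨x, e, g m, by simp⟩)

lemma baseChange_hom_ext (φ : E →+* F) {M : Type u} [AddCommGroup M] [Module E M]
    {P : ModuleCat.{u} F} {f g : ModuleCat.of F (BaseChange φ M) ⟶ P}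
    (h : ∀ (x : F) (m : M), f.hom ((baseChangeRel φ M).mkQ (x ⊗ₜ m)) =
      g.hom ((baseChangeRel φ M).mkQ (x ⊗ₜ m))) : f = g := by
  apply ModuleCat.hom_ext
  apply Submodule.linearMap_qext
  apply LinearMap.ext
  intro t
  induction t with
  | zero => rw [map_zero, map_zero]
  | tmul x m => exact h x m
  | add a b ha hb => rw [map_add, map_add, ha, hb]

/-- The functor `M ↦ F ⊗_E M`. -/
def baseChange (φ : E →+* F) : ModuleCat.{u} E ⥤ ModuleCat.{u} F where
  obj M := ModuleCat.of F (BaseChange φ M)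
  map g := ModuleCat.ofHom (baseChangeMap φ g.hom)
  map_id _ := baseChange_hom_ext φ fun _ _ => rfl
  map_comp _ _ := baseChange_hom_ext φ fun _ _ => rfl

instance (φ : E →+* F) : (baseChange φ).Additive where
  map_add {_ N f g} := baseChange_hom_ext φ fun x m =>
    congrArg (baseChangeRel φ N).mkQ (TensorProduct.tmul_add x (f.hom m) (g.hom m))

end Modules

section Tensor

variable (K : Type v) [Field K]
variable {E F : Type u} [Ring E] [Algebra K E] [Ring F] [Algebra K F]

open scoped ModuleCat

/-- The action of `E ⊗ F` on `M ⊗ N`, `(e ⊗ f)(m ⊗ n) = e m ⊗ f n`. -/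
def extTensorAction (M : ModuleCat.{u} E) (N : ModuleCat.{u} F) :
    E ⊗[K] F →ₐ[K] Module.End K (M ⊗[K] N) :=
  Module.endTensorEndAlgHom.comp
    (Algebra.TensorProduct.map (Algebra.lsmul K K M) (Algebra.lsmul K K N))

/-- The `E ⊗ F`-module `M ⊗ N`. -/
def extTensorObj (M : ModuleCat.{u} E) (N : ModuleCat.{u} F) : ModuleCat.{u} (E ⊗[K] F) :=
  letI : Module (E ⊗[K] F) (M ⊗[K] N) := Module.compHom _ (extTensorAction K M N).toRingHom
  ModuleCat.of (E ⊗[K] F) (M ⊗[K] N)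

lemma extTensorAction_map {M M' : ModuleCat.{u} E} {N N' : ModuleCat.{u} F}
    (f : M ⟶ M') (g : N ⟶ N') (r : E ⊗[K] F) (t : M ⊗[K] N) :
    TensorProduct.map (f.hom.restrictScalars K) (g.hom.restrictScalars K)
        (extTensorAction K M N r t) =
      extTensorAction K M' N' r
        (TensorProduct.map (f.hom.restrictScalars K) (g.hom.restrictScalars K) t) := by
  induction r with
  | zero => simp
  | add a b ha hb => simp only [map_add, LinearMap.add_apply, ha, hb]
  | tmul e x =>
    induction t with
    | zero => simp
    | add a b ha hb => simp only [map_add, ha, hb]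
    | tmul m n => simp [extTensorAction, Module.endTensorEndAlgHom_apply]

/-- The `E ⊗ F`-linear map `f ⊗ g`. -/
def extTensorMap {M M' : ModuleCat.{u} E} {N N' : ModuleCat.{u} F}
    (f : M ⟶ M') (g : N ⟶ N') : extTensorObj K M N ⟶ extTensorObj K M' N' :=
  ModuleCat.ofHom (X := extTensorObj K M N) (Y := extTensorObj K M' N')
    { toFun := fun t =>
        TensorProduct.map (f.hom.restrictScalars K) (g.hom.restrictScalars K)
          (show M ⊗[K] N from t)
      map_add' := fun x y => map_add (TensorProduct.map (f.hom.restrictScalars K)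
        (g.hom.restrictScalars K)) (show M ⊗[K] N from x) (show M ⊗[K] N from y)
      map_smul' := fun r t => extTensorAction_map K f g r t }

lemma extTensor_hom_ext {M : ModuleCat.{u} E} {N : ModuleCat.{u} F} {P : ModuleCat.{u} (E ⊗[K] F)}
    {f g : extTensorObj K M N ⟶ P}
    (h : ∀ (m : M) (n : N), f.hom (show M ⊗[K] N from m ⊗ₜ n) = g.hom (show M ⊗[K] N from m ⊗ₜ n)) :
    f = g := by
  apply ModuleCat.hom_ext
  apply LinearMap.ext
  intro t
  change M ⊗[K] N at t
  induction t with
  | zero => exact (f.hom.map_zero).trans (g.hom.map_zero).symm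
  | tmul m n => exact h m n
  | add a b ha hb =>
    exact (LinearMap.map_add f.hom (show extTensorObj K M N from a) b).trans
      ((congrArg₂ (fun x y => x + y) ha hb).trans
        (LinearMap.map_add g.hom (show extTensorObj K M N from a) b).symm)

variable (E F) in
/-- The bifunctor `(M, N) ↦ M ⊗ N` from `E`-modules and `F`-modules to `E ⊗ F`-modules. -/
def extTensor : ModuleCat.{u} E ⥤ ModuleCat.{u} F ⥤ ModuleCat.{u} (E ⊗[K] F) where
  obj M :=
    { obj := fun N => extTensorObj K M N
      map := fun g => extTensorMap K (𝟙 M) g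
      map_id := fun _ => extTensor_hom_ext K fun _ _ => rfl
      map_comp := fun _ _ => extTensor_hom_ext K fun _ _ => rfl }
  map f :=
    { app := fun N => extTensorMap K f (𝟙 N)
      naturality := fun _ _ _ => extTensor_hom_ext K fun _ _ => rfl }
  map_id _ := by
    ext1; ext1 N
    exact extTensor_hom_ext K fun _ _ => rfl
  map_comp _ _ := by
    ext1; ext1 N
    exact extTensor_hom_ext K fun _ _ => rfl

instance : (extTensor K E F).PreservesZeroMorphisms where
  map_zero M M' := by
    ext1; ext1
    exact extTensor_hom_ext K fun _ n => TensorProduct.zero_tmul M' n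

instance (M : ModuleCat.{u} E) : ((extTensor K E F).obj M).PreservesZeroMorphisms where
  map_zero N N' := extTensor_hom_ext K fun m _ => TensorProduct.tmul_zero N' m

/-- The total complex of the tensor product over `K` of two complexes. -/
def tensorComplex (M : CochainComplex (ModuleCat.{u} E) ℤ)
    (N : CochainComplex (ModuleCat.{u} F) ℤ) : CochainComplex (ModuleCat.{u} (E ⊗[K] F)) ℤ :=
  HomologicalComplex.mapBifunctor M N (extTensor K E F) (ComplexShape.up ℤ)

variable (F) in
/-- For an `E`-module `M`, the functor `Hom_E(M, -)` from `E ⊗ F`-modules to `F`-modules; the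
`F`-module structure is `(f g)(m) = (1 ⊗ f) g(m)`. -/
def homFunctor (M : ModuleCat.{u} E) : ModuleCat.{u} (E ⊗[K] F) ⥤ ModuleCat.{u} F :=
  let i : E →+* E ⊗[K] F := (Algebra.TensorProduct.includeLeft : E →ₐ[K] E ⊗[K] F).toRingHom
  let j : F →+* E ⊗[K] F := (Algebra.TensorProduct.includeRight : F →ₐ[K] E ⊗[K] F).toRingHom
  have h : ∀ e f, Commute (i e) (j f) := fun e f => by
    change (e ⊗ₜ[K] (1 : F)) * ((1 : E) ⊗ₜ[K] f) = ((1 : E) ⊗ₜ[K] f) * (e ⊗ₜ[K] (1 : F))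
    rw [Algebra.TensorProduct.tmul_mul_tmul, Algebra.TensorProduct.tmul_mul_tmul]
    simp only [mul_one, one_mul]
  letI inst : ∀ N : ModuleCat.{u} (E ⊗[K] F),
      Module F (M ⟶ (ModuleCat.restrictScalars.{u} i).obj N) := fun N =>
    { smul := fun f g => g ≫ (commAct i j h f).app N
      one_smul := fun g => by
        ext m
        change (j 1 • (show N from g.hom m) : N) = _
        rw [map_one, one_smul]
      mul_smul := fun f f' g => by
        ext m
        change (j (f * f') • (show N from g.hom m) : N) = j f • (j f' • (show N from g.hom m))
        rw [map_mul, mul_smul]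
      smul_zero := fun f => Limits.zero_comp
      smul_add := fun f g g' => Preadditive.add_comp _ _ _ _ _ _
      add_smul := fun f f' g => by
        ext m
        change (j (f + f') • (show N from g.hom m) : N) =
          j f • (show N from g.hom m) + j f' • (show N from g.hom m)
        rw [map_add, add_smul]
      zero_smul := fun g => by
        ext m
        change (j 0 • (show N from g.hom m) : N) = _
        rw [map_zero, zero_smul]; rfl }
  { obj := fun N => ModuleCat.of F (M ⟶ (ModuleCat.restrictScalars.{u} i).obj N)
    map := fun {N N'} φ => ModuleCat.ofHom
      { toFun := fun g => g ≫ (ModuleCat.restrictScalars.{u} i).map φ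
        map_add' := fun g g' => Preadditive.add_comp _ _ _ _ _ _
        map_smul' := fun f g => by
          change (g ≫ (commAct i j h f).app N) ≫ (ModuleCat.restrictScalars.{u} i).map φ =
            (g ≫ (ModuleCat.restrictScalars.{u} i).map φ) ≫ (commAct i j h f).app N'
          rw [Category.assoc, Category.assoc, NatTrans.naturality] }
    map_id := fun N => rfl
    map_comp := fun φ ψ => rfl }

instance (M : ModuleCat.{u} E) : (homFunctor K F M).Additive where
  map_add := rfl

end Tensor

/-! ### Dualizing complexes -/

section Dualizing

variable (K : Type v) [Field K]

/-- Complexes of `A`-`B`-bimodules on which `K` acts centrally, i.e. of left modules over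
`A ⊗ Bᵒᵖ`. -/
abbrev BimodComplex (A B : Type u) [Ring A] [Algebra K A] [Ring B] [Algebra K B] :=
  CochainComplex (ModuleCat.{u} (A ⊗[K] Bᵐᵒᵖ)) ℤ

variable (A B : Type u) [Ring A] [Algebra K A] [Ring B] [Algebra K B]

/-- The ring homomorphism `A → A ⊗ Bᵒᵖ`. -/
abbrev inl : A →+* A ⊗[K] Bᵐᵒᵖ :=
  (Algebra.TensorProduct.includeLeft : A →ₐ[K] A ⊗[K] Bᵐᵒᵖ).toRingHom

/-- The ring homomorphism `Bᵒᵖ → A ⊗ Bᵒᵖ`. -/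
abbrev inr : Bᵐᵒᵖ →+* A ⊗[K] Bᵐᵒᵖ :=
  (Algebra.TensorProduct.includeRight : Bᵐᵒᵖ →ₐ[K] A ⊗[K] Bᵐᵒᵖ).toRingHom

lemma inl_commute_inr (a : A) (b : Bᵐᵒᵖ) : Commute (inl K A B a) (inr K A B b) := by
  change (a ⊗ₜ[K] (1 : Bᵐᵒᵖ)) * ((1 : A) ⊗ₜ[K] b) = ((1 : A) ⊗ₜ[K] b) * (a ⊗ₜ[K] (1 : Bᵐᵒᵖ))
  simp

variable {A B}

/-- `R` is a dualizing complex over `(A, B)`. -/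
structure IsDualizingComplex (R : BimodComplex K A B) : Prop where
  isNoetherian_left : IsNoetherianRing A
  isNoetherian_right : IsNoetherianRing Bᵐᵒᵖ
  bounded : HasBoundedCohomology R
  injDim_left : HasFiniteInjectiveDimension (restrict (inl K A B) R)
  injDim_right : HasFiniteInjectiveDimension (restrict (inr K A B) R)
  finite_left : HasFiniteCohomology (restrict (inl K A B) R)
  finite_right : HasFiniteCohomology (restrict (inr K A B) R)
  /-- `B → RHom_A(R, R)` is an isomorphism (`Bᵐᵒᵖ` and `B` agree as abelian groups). -/
  homothety_right : HomothetyIsIso (inl K A B) (inr K A B) (inl_commute_inr K A B) R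
  /-- `A → RHom_{Bᵒᵖ}(R, R)` is an isomorphism. -/
  homothety_left : HomothetyIsIso (inr K A B) (inl K A B)
    (fun b a => (inl_commute_inr K A B a b).symm) R

variable (A) in
/-- The enveloping algebra `Aᵉ = A ⊗ Aᵒᵖ`. -/
abbrev Env : Type u := A ⊗[K] Aᵐᵒᵖ

variable (A) in
/-- `A` as a module over its enveloping algebra, `(a ⊗ b) x = a x b`. -/
def diagonal : ModuleCat.{u} (Env K A) :=
  letI : Module (Env K A) A := instModuleTensorProductMop K A
  ModuleCat.of (Env K A) A

variable (A) in
/-- The homomorphism `Aᵉ ⊗ Aᵉ → Aᵉ ⊗ Aᵉ`,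
`(a ⊗ b) ⊗ (c ⊗ d) ↦ (a ⊗ d) ⊗ (c ⊗ b)`. -/
def outsideInside : Env K A ⊗[K] Env K A →ₐ[K] Env K A ⊗[K] Env K A :=
  ((Algebra.TensorProduct.tensorTensorTensorComm K K K K A A Aᵐᵒᵖ Aᵐᵒᵖ).toAlgHom.comp
    (Algebra.TensorProduct.map (AlgHom.id K (A ⊗[K] A))
      (Algebra.TensorProduct.comm K Aᵐᵒᵖ Aᵐᵒᵖ).toAlgHom)).comp
    (Algebra.TensorProduct.tensorTensorTensorComm K K K K A Aᵐᵒᵖ A Aᵐᵒᵖ).toAlgHom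

lemma outsideInside_tmul (a c : A) (b d : Aᵐᵒᵖ) :
    outsideInside K A ((a ⊗ₜ b) ⊗ₜ (c ⊗ₜ d)) = (a ⊗ₜ d) ⊗ₜ (c ⊗ₜ b) := by
  simp [outsideInside]

/-- The complex `R ⊗ R` over `Aᵉ ⊗ Aᵉ`, where the first factor acts by the outside and the
second one by the inside structure:
`((a ⊗ b) ⊗ (c ⊗ d)) (x ⊗ y) = (a x d) ⊗ (c y b)`. -/
def selfTensor (R : BimodComplex K A A) :
    CochainComplex (ModuleCat.{u} (Env K A ⊗[K] Env K A)) ℤ :=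
  restrict (outsideInside K A).toRingHom (tensorComplex K R R)

/-- `R` is a rigid dualizing complex over `A`: it is dualizing, and there is an isomorphism
`R ≅ RHom_{Aᵉ}(A, R ⊗ R)` in the derived category of `Aᵉ`-modules; the right hand side is
`Hom_{Aᵉ}(A, J)` (outside structure) for an injective resolution `R ⊗ R → J` over `Aᵉ ⊗ Aᵉ`. -/
structure IsRigidDualizingComplex (R : BimodComplex K A A) : Prop extends
    IsDualizingComplex K R where
  rigid : ∃ (J : CochainComplex (ModuleCat.{u} (Env K A ⊗[K] Env K A)) ℤ)
    (ι : selfTensor K R ⟶ J), IsInjectiveResolution ι ∧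
    Nonempty (DerivedCategory.Q.obj R ≅ DerivedCategory.Q.obj
      (((homFunctor K (Env K A) (diagonal K A)).mapHomologicalComplex (ComplexShape.up ℤ)).obj J))

end Dualizing

/-! ### Central localization -/

section Localization

variable (K : Type v) [Field K]
variable {A B : Type u} [Ring A] [Algebra K A] [Ring B] [Algebra K B]

/-- `A` as an algebra over its center. -/
instance centerAlgebra : Algebra (Subalgebra.center K A) A where
  algebraMap := (Subalgebra.center K A).subtype
  commutes' r x := (Subalgebra.mem_center_iff.1 r.2 x).symm
  smul_def' _ _ := rfl

/-- The localization `A_S = S⁻¹Z(A) ⊗_{Z(A)} A` at a multiplicative subset of the center. -/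
abbrev CentralLoc (S : Submonoid (Subalgebra.center K A)) : Type u :=
  Localization S ⊗[Subalgebra.center K A] A

/-- The homomorphism `A → A_S`. -/
def toCentralLoc (S : Submonoid (Subalgebra.center K A)) : A →ₐ[K] CentralLoc K S :=
  (Algebra.TensorProduct.includeRight :
    A →ₐ[Subalgebra.center K A] CentralLoc K S).restrictScalars K

/-- The complex `A_S ⊗_A R ⊗_B B_T`, written as `(A_S ⊗ B_Tᵒᵖ) ⊗_{A ⊗ Bᵒᵖ} R`. (No derived functors
are needed since `A_S` and `B_T` are flat.) -/
def localize (S : Submonoid (Subalgebra.center K A)) (T : Submonoid (Subalgebra.center K B))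
    (R : BimodComplex K A B) : BimodComplex K (CentralLoc K S) (CentralLoc K T) :=
  ((baseChange (Algebra.TensorProduct.map (toCentralLoc K S)
    (AlgHom.op (toCentralLoc K T))).toRingHom).mapHomologicalComplex (ComplexShape.up ℤ)).obj R

variable (A B) in
/-- The map `Z(A) → Z(A ⊗ Bᵒᵖ)`, `a ↦ a ⊗ 1`. -/
def centerInl : Subalgebra.center K A →* Subring.center (A ⊗[K] Bᵐᵒᵖ) where
  toFun a := ⟨(a : A) ⊗ₜ 1, Subring.mem_center_iff.2 fun g => by
    induction g with
    | zero => simp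
    | add x y hx hy => rw [add_mul, mul_add, hx, hy]
    | tmul x y => simp [Subalgebra.mem_center_iff.1 a.2 x]⟩
  map_one' := rfl
  map_mul' a a' := Subtype.ext (by simp)

variable (A B) in
/-- The map `Z(B) → Z(A ⊗ Bᵒᵖ)`, `b ↦ 1 ⊗ b`. -/
def centerInr : Subalgebra.center K B →* Subring.center (A ⊗[K] Bᵐᵒᵖ) where
  toFun b := ⟨(1 : A) ⊗ₜ MulOpposite.op (b : B), Subring.mem_center_iff.2 fun g => by
    induction g with
    | zero => simp
    | add x y hx hy => rw [add_mul, mul_add, hx, hy]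
    | tmul x y =>
      have h : y * MulOpposite.op (b : B) = MulOpposite.op (b : B) * y :=
        MulOpposite.unop_injective (Subalgebra.mem_center_iff.1 b.2 y.unop).symm
      simp [h]⟩
  map_one' := rfl
  map_mul' b b' := Subtype.ext (by
    have h : (b : B) * (b' : B) = b' * b := Subalgebra.mem_center_iff.1 b'.2 b
    simp [h])

/-- The endomorphism ring `C` of `R` in the derived category of bimodules. -/
abbrev DerivedEnd (R : BimodComplex K A B) := End (DerivedCategory.Q.obj R)

/-- The action of `Z(A)` on `R`, as a map `Z(A) → C`. -/
def leftCenter (R : BimodComplex K A B) : Subalgebra.center K A →* DerivedEnd K R :=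
  ((Functor.mapEnd R DerivedCategory.Q).comp (centralAction R)).comp (centerInl K A B)

/-- The action of `Z(B)` on `R`, as a map `Z(B) → C`. -/
def rightCenter (R : BimodComplex K A B) : Subalgebra.center K B →* DerivedEnd K R :=
  ((Functor.mapEnd R DerivedCategory.Q).comp (centralAction R)).comp (centerInr K A B)

/-- For `S ⊆ C`, the multiplicative subset of `Z(A)` corresponding to `S`. -/
def leftSubset {R : BimodComplex K A B} (S : Submonoid (DerivedEnd K R)) :
    Submonoid (Subalgebra.center K A) :=
  S.comap (leftCenter K R)

/-- For `S ⊆ C`, the multiplicative subset of `Z(B)` corresponding to `S`. -/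
def rightSubset {R : BimodComplex K A B} (S : Submonoid (DerivedEnd K R)) :
    Submonoid (Subalgebra.center K B) :=
  S.comap (rightCenter K R)

end Localization

end YekutieliZhang

end

/-! Write `E = A`, `F = Bᵒᵖ`, `G = A ⊗ Bᵒᵖ`. Central localization is an exact base change which
turns maps with torsion kernel and cokernel into isomorphisms
(`IsCentralLocalization.quasiIso_baseChange`). Proving that localized objects agree therefore
amounts to producing maps that are isomorphisms up to torsion on cohomology (`IsTorsionIso`).

The first main point is that, in the derived category of bimodules, `Z(A)` and `Z(B)` act on `R`
through each other (`HomothetyIsIso.exists_central`). An element of `Z(A)` acts over `A` as some `f`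
in `F`, by the homothety isomorphism; faithfulness makes `f` central. The homotopy obtained is only
`A`-linear. It is made bilinear by `RightBasis.isCoboundary_of_restrict`, which uses that `G` is
free over `E` and that `R` has no negative self-extensions over `A`. Hence the corresponding subsets
`S_A` and `S_B` act in the same way on the cohomology of `R`, and the two-sided localization `R_S`
is already the one-sided localization on either side.

From this, finite generation is immediate, and finite injective dimension follows because
localization over a noetherian ring preserves injectives
(`IsCentralLocalization.injective_baseChange`). For the homothety condition, adjunction gives
`RHom_{A_S}(R_S, R_S) = RHom_A(R, R_S)`, and this has to be the `S_B`-localization of `RHom_A(R,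
R)`. It is, because `R` has finitely generated, bounded above cohomology over a noetherian ring: by
dévissage through shifted free modules, every class with values in a complex with torsion cohomology
is torsion (`exists_δ_eq_torsion`). Applied to a mapping cone, this gives
`IsTorsionHom.exists_cocycle` and `IsTorsionHom.exists_δ_eq`, which feed
`IsHomothetyIso.of_isTorsionHom`.

In the rigid case, the left and right actions of a central element on `R` agree, since both can be
moved through `RHom_{Aᵉ}(A, R ⊗ R)` (`IsRigidDualizingComplex.leftCenter_eq_rightCenter`). Then `S_A
= S_B`, and the outside action of `S` on the cohomology of `R ⊗ R` is expressible by the inside one.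
So `R ⊗ R → R_S ⊗ R_S` is a localization for the inside action alone, and it commutes with
`RHom_{Aᵉ}(A, -)` by the same dévissage, `A` being a cyclic module over the noetherian ring `Aᵉ`.
Finally `A` can be replaced by `A_S`, by `existsUnique_diagonal_hom`. -/

noncomputable section

namespace YekutieliZhang

/-! ### Base change and central localization of modules -/

section BaseChange

variable {E F : Type u} [Ring E] [Ring F] (φ : E →+* F)

/-- The class of `x ⊗ m` in `F ⊗_E M`. -/
def bcMk {M : Type u} [AddCommGroup M] [Module E M] (x : F) (m : M) : BaseChange φ M :=
  (baseChangeRel φ M).mkQ (x ⊗ₜ m)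

section

variable {M : Type u} [AddCommGroup M] [Module E M]

lemma bcMk_smul (y x : F) (m : M) : y • bcMk φ x m = bcMk φ (y * x) m := rfl

lemma bcMk_mul (x : F) (e : E) (m : M) : bcMk φ (x * φ e) m = bcMk φ x (e • m) := by
  rw [← sub_eq_zero]
  exact (Submodule.Quotient.mk_eq_zero _).2 (Submodule.subset_span ⟨x, e, m, rfl⟩)

lemma bcMk_add_left (x y : F) (m : M) : bcMk φ (x + y) m = bcMk φ x m + bcMk φ y m := by
  simp [bcMk, TensorProduct.add_tmul]

lemma bcMk_add_right (x : F) (m n : M) : bcMk φ x (m + n) = bcMk φ x m + bcMk φ x n := by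
  simp [bcMk, TensorProduct.tmul_add]

lemma bcMk_smul_one (e : E) (m : M) : φ e • bcMk φ 1 m = bcMk φ 1 (e • m) := by
  rw [bcMk_smul, mul_one, ← bcMk_mul, one_mul]

lemma bcMk_zero_right (x : F) : bcMk φ x (0 : M) = 0 := by
  simp [bcMk]

lemma bc_induction {P : BaseChange φ M → Prop} (t : BaseChange φ M)
    (zero : P 0) (mk : ∀ x m, P (bcMk φ x m)) (add : ∀ a b, P a → P b → P (a + b)) : P t := by
  obtain ⟨t, rfl⟩ := Submodule.mkQ_surjective _ t
  induction t with
  | zero => simpa using zero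
  | tmul x m => exact mk x m
  | add a b ha hb => rw [map_add]; exact add _ _ ha hb

/-- Maps out of `F ⊗_E M` into an additive group. -/
def bcLiftAdd {P : Type*} [AddCommGroup P] (f : F →+ M →+ P)
    (hf : ∀ x e m, f (x * φ e) m = f x (e • m)) : BaseChange φ M →+ P :=
  QuotientAddGroup.lift (baseChangeRel φ M).toAddSubgroup
    (TensorProduct.liftAddHom f (fun r x m => by
      rw [map_zsmul, map_zsmul, AddMonoidHom.zsmul_apply])) (by
      intro t ht
      -- The relations form an `F`-span while the map is only additive, so vanishing is proved for
      -- all multiples `y • t` at once; this makes the induction pass through scalars.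
      have key : ∀ y : F, TensorProduct.liftAddHom f (fun r x m => by
          rw [map_zsmul, map_zsmul, AddMonoidHom.zsmul_apply]) (y • t) = 0 := by
        replace ht : t ∈ baseChangeRel φ M := ht
        rw [baseChangeRel] at ht
        induction ht using Submodule.span_induction with
        | mem t ht =>
          intro y
          obtain ⟨x, e, m, rfl⟩ := ht
          simp [smul_sub, TensorProduct.smul_tmul', ← mul_assoc, hf]
        | zero => simp
        | add a b _ _ ha hb => intro y; rw [smul_add, map_add, ha, hb, add_zero]
        | smul z a _ ha => intro y; rw [smul_smul]; exact ha _
      simpa using key 1)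

@[simp]
lemma bcLiftAdd_mk {P : Type*} [AddCommGroup P] (f : F →+ M →+ P)
    (hf : ∀ x e m, f (x * φ e) m = f x (e • m)) (x : F) (m : M) :
    bcLiftAdd φ f hf (bcMk φ x m) = f x m := rfl

/-- The `F`-linear map `F ⊗_E M → N` defined by a `φ`-semilinear map `M → N`. -/
def bcLift {N : Type*} [AddCommGroup N] [Module F N] (f : M →+ N)
    (hf : ∀ e m, f (e • m) = φ e • f m) : BaseChange φ M →ₗ[F] N :=
  { bcLiftAdd φ (AddMonoidHom.mk' (fun x => AddMonoidHom.mk' (fun n : M => x • f n)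
        (fun a b => by rw [map_add, smul_add]))
          (fun x y => AddMonoidHom.ext fun n => add_smul x y (f n)))
        (fun x e m => by simp [hf, mul_smul]) with
    map_smul' := fun y t => by
      simp only [RingHom.id_apply]
      induction t using bc_induction with
      | zero => simp
      | mk x m => exact mul_smul y x (f m)
      | add a b ha hb =>
        refine (congrArg _ (smul_add y a b)).trans ?_
        refine (map_add (bcLiftAdd φ _ _) _ _).trans ((congrArg₂ _ ha hb).trans ?_)
        exact ((congrArg (y • ·) (map_add (bcLiftAdd φ _ _) a b)).trans (smul_add y _ _)).symm }

end

/-- The unit `M → F ⊗_E M`. -/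
def bcUnit (M : ModuleCat.{u} E) :
    M ⟶ (ModuleCat.restrictScalars.{u} φ).obj ((baseChange φ).obj M) :=
  ModuleCat.ofHom (Y := (ModuleCat.restrictScalars.{u} φ).obj ((baseChange φ).obj M))
    { toFun := fun m => bcMk φ 1 m
      map_add' := fun m n => bcMk_add_right φ 1 m n
      map_smul' := fun e m => by
        change _ = φ e • bcMk φ 1 m
        rw [bcMk_smul, ← bcMk_mul, one_mul, mul_one] }

/-- The counit `F ⊗_E N → N`. -/
def bcCounit (N : ModuleCat.{u} F) :
    (baseChange φ).obj ((ModuleCat.restrictScalars.{u} φ).obj N) ⟶ N :=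
  ModuleCat.ofHom (X := (baseChange φ).obj ((ModuleCat.restrictScalars.{u} φ).obj N))
    (bcLift φ (M := (ModuleCat.restrictScalars.{u} φ).obj N) (N := N) (AddMonoidHom.id N)
      fun _ _ => rfl)

/-- Base change is left adjoint to restriction of scalars. -/
def bcAdj : baseChange φ ⊣ ModuleCat.restrictScalars.{u} φ :=
  Adjunction.mkOfUnitCounit
    { unit := { app := bcUnit φ, naturality := fun _ _ _ => rfl }
      counit :=
        { app := bcCounit φ
          naturality := fun _ N g => baseChange_hom_ext φ fun x m => (g.hom.map_smul x _).symm }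
      left_triangle := by
        ext1; ext1 M
        refine baseChange_hom_ext φ fun x m => ?_
        change bcMk φ (x * 1) m = bcMk φ x m
        rw [mul_one]
      right_triangle := by
        ext1; ext1 N
        ext n
        exact one_smul F (show N from n) }

instance : (baseChange φ).IsLeftAdjoint := (bcAdj φ).isLeftAdjoint

lemma restrictScalars_map_exact {E : Type*} {F : Type*} [Ring E] [Ring F] (φ : E →+* F)
    (S : ShortComplex (ModuleCat.{u} F)) (h : S.Exact) :
    (S.map (ModuleCat.restrictScalars.{u} φ)).Exact := by
  rw [ShortComplex.ShortExact.moduleCat_exact_iff_function_exact] at h ⊢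
  exact h

instance {E : Type*} {F : Type*} [Ring E] [Ring F] (φ : E →+* F) :
    (ModuleCat.restrictScalars.{u} φ).PreservesHomology :=
  ((Functor.exact_tfae (ModuleCat.restrictScalars.{u} φ)).out 1 2).mp
    (restrictScalars_map_exact φ)

instance {E : Type*} {F : Type*} [Ring E] [Ring F] (φ : E →+* F) :
    Limits.PreservesFiniteLimits (ModuleCat.restrictScalars.{u} φ) :=
  Functor.preservesFiniteLimits_of_preservesHomology _

instance {E : Type*} {F : Type*} [Ring E] [Ring F] (φ : E →+* F) :
    Limits.PreservesFiniteColimits (ModuleCat.restrictScalars.{u} φ) :=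
  Functor.preservesFiniteColimits_of_preservesHomology _

/-- `F` is flat over `E`: base change preserves monomorphisms. -/
class IsFlatHom : Prop where
  preservesMono : (baseChange φ).PreservesMonomorphisms

attribute [instance] IsFlatHom.preservesMono

instance [IsFlatHom φ] : (baseChange φ).PreservesHomology := by
  refine ((Functor.exact_tfae (baseChange φ)).out 0 2).mp fun S hS => ?_
  have := hS.mono_f
  have h := (Functor.preservesFiniteColimits_iff_forall_exact_map_and_epi (baseChange φ)).1
    inferInstance S hS
  exact { exact := h.1, mono_f := inferInstanceAs (Mono ((baseChange φ).map S.f)), epi_g := h.2 }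

instance [IsFlatHom φ] : Limits.PreservesFiniteLimits (baseChange φ) :=
  Functor.preservesFiniteLimits_of_preservesHomology _

/-- Restriction of scalars along a flat homomorphism preserves injectives. -/
lemma restrictScalars_injective [IsFlatHom φ] (N : ModuleCat.{u} F) [Injective N] :
    Injective ((ModuleCat.restrictScalars.{u} φ).obj N) :=
  (bcAdj φ).map_injective N inferInstance

end BaseChange

/-! ### Central localizations and torsion of modules -/

section CentralLocalization

variable {E F : Type u} [Ring E] [Ring F]

/-- `φ : E → F` is the localization at the multiplicative subset `S` of the center of `E`. -/
structure IsCentralLocalization (S : Submonoid (Subring.center E)) (φ : E →+* F) : Prop where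
  isUnit : ∀ s ∈ S, IsUnit (φ s)
  surj : ∀ x : F, ∃ s ∈ S, ∃ e : E, φ s * x = φ e
  ker : ∀ e : E, φ e = 0 → ∃ s ∈ S, (s : E) * e = 0

/-- The kernel and the cokernel of `f` are `S`-torsion. -/
structure IsTorsionIso (S : Submonoid (Subring.center E)) {M N : Type*} [AddCommGroup M]
    [Module E M] [AddCommGroup N] [Module E N] (f : M →ₗ[E] N) : Prop where
  ker : ∀ m, f m = 0 → ∃ s ∈ S, (s : E) • m = 0
  coker : ∀ n, ∃ s ∈ S, ∃ m, f m = (s : E) • n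

lemma center_comm (s : Subring.center E) (e : E) : e * s = s * e :=
  Subring.mem_center_iff.1 s.2 e

lemma center_smul_comm (s : Subring.center E) (e : E) {M : Type*} [AddCommGroup M] [Module E M]
    (m : M) : e • (s : E) • m = (s : E) • e • m := by
  rw [smul_smul, smul_smul, center_comm]

variable {S : Submonoid (Subring.center E)} {φ : E →+* F}

namespace IsCentralLocalization

variable (hφ : IsCentralLocalization S φ)
include hφ

/-- Elements of `S` become central in all of `F`, not just among the image of `E`: multiply by a
denominator of `x`, compare in `E`, and cancel the unit. -/
lemma comm (s : Subring.center E) (x : F) : x * φ s = φ s * x := by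
  obtain ⟨t, ht, e, he⟩ := hφ.surj x
  apply (hφ.isUnit t ht).mul_left_cancel
  rw [← mul_assoc, he, ← mul_assoc, ← map_mul, ← map_mul, center_comm s e, center_comm s (t : E),
    map_mul, map_mul, mul_assoc, he]

section

variable {M : Type u} [AddCommGroup M] [Module E M]

/-- The target `S⁻¹M` is the localization over the commutative center. This is the independence of
the value of `x ⊗ m` from the fraction chosen for `x`. -/
lemma localizedModule_mk_eq {x : F} {s t : S} {e e' : E} (h : φ (s : Subring.center E) * x = φ e)
    (h' : φ (t : Subring.center E) * x = φ e') (m : M) :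
    LocalizedModule.mk (e • m) s = LocalizedModule.mk (e' • m) t := by
  rw [LocalizedModule.mk_eq]
  have : φ ((t : Subring.center E) * e - (s : Subring.center E) * e') = 0 := by
    rw [map_sub, map_mul, map_mul, ← h, ← h', ← mul_assoc, ← mul_assoc, ← map_mul, ← map_mul,
      center_comm (t : Subring.center E) ((s : Subring.center E) : E), sub_self]
  obtain ⟨r, hr, hr'⟩ := hφ.ker _ this
  refine ⟨⟨r, hr⟩, ?_⟩
  rw [mul_sub, sub_eq_zero] at hr'
  have := congrArg (· • m) hr'
  simpa only [mul_smul] using! this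

/-- The pairing `F × M → S⁻¹M`. -/
lemma exists_pairing : ∃ Φ : F → M → LocalizedModule S M, ∀ (x : F) (s : S) (e : E),
    φ (s : Subring.center E) * x = φ e → ∀ m, Φ x m = LocalizedModule.mk (e • m) s := by
  choose s hs e he using hφ.surj
  exact ⟨fun x m => LocalizedModule.mk (e x • m) ⟨s x, hs x⟩, fun x t e' h m =>
    hφ.localizedModule_mk_eq (s := ⟨s x, hs x⟩) (he x) h m⟩

/-- Zero elements of the quotient `F ⊗_E M` are not visible directly. The pairing induces a map to
`S⁻¹M` sending `1 ⊗ m` to `m / 1`, and there the vanishing of a fraction is known. -/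
lemma bcMk_one_eq_zero {m : M} (hm : bcMk φ 1 m = 0) : ∃ s ∈ S, (s : E) • m = 0 := by
  obtain ⟨Φ, hΦ⟩ := hφ.exists_pairing (M := M)
  have hrep : ∀ x : F, ∃ (s : S) (e : E), φ (s : Subring.center E) * x = φ e := fun x => by
    obtain ⟨s, hs, e, he⟩ := hφ.surj x
    exact ⟨⟨s, hs⟩, e, he⟩
  let Φ' : F →+ M →+ LocalizedModule S M :=
    AddMonoidHom.mk' (fun x => AddMonoidHom.mk' (Φ x) (fun m n => by
        obtain ⟨s, e, he⟩ := hrep x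
        rw [hΦ x s e he, hΦ x s e he, hΦ x s e he, LocalizedModule.mk_add_mk, ← smul_add, ← smul_add,
          LocalizedModule.mk_cancel_common_left]))
      (fun x y => AddMonoidHom.ext fun m => by
        obtain ⟨s, e, he⟩ := hrep x
        obtain ⟨t, e', he'⟩ := hrep y
        simp only [AddMonoidHom.mk'_apply, AddMonoidHom.add_apply]
        rw [hΦ x s e he, hΦ y t e' he', LocalizedModule.mk_add_mk,
          hΦ (x + y) (s * t) ((t : Subring.center E) * e + (s : Subring.center E) * e')]
        · congr 1
          rw [add_smul, mul_smul, mul_smul]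
          rfl
        · simp only [Submonoid.coe_mul, Subring.coe_mul, map_mul, map_add, mul_add, ← he, ← he']
          congr 1
          · rw [← map_mul, center_comm (t : Subring.center E), map_mul, mul_assoc]
          · rw [mul_assoc])
  have h := congrArg (bcLiftAdd φ Φ' (fun x e m => by
    obtain ⟨s, e', he⟩ := hrep x
    change Φ (x * φ e) m = Φ x (e • m)
    rw [hΦ x s e' he, hΦ (x * φ e) s (e' * e) (by rw [← mul_assoc, he, map_mul]), mul_smul])) hm
  rw [map_zero, bcLiftAdd_mk] at h
  change Φ 1 m = 0 at h
  rw [hΦ 1 1 1 (by simp), ← LocalizedModule.zero_mk 1, LocalizedModule.mk_eq] at h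
  obtain ⟨c, hc⟩ := h
  exact ⟨c, c.2, by simpa using! hc⟩

/-- Common denominators: every element of `F ⊗_E M` is `s⁻¹(1 ⊗ m)`. Together with the kernel of `m
↦ 1 ⊗ m`, this describes the module completely. -/
lemma exists_smul_eq_bcMk_one (t : BaseChange φ M) :
    ∃ s ∈ S, ∃ m : M, φ s • t = bcMk φ 1 m := by
  induction t using bc_induction with
  | zero => exact ⟨1, one_mem _, 0, by simp [bcMk_zero_right]⟩
  | mk x m =>
    obtain ⟨s, hs, e, he⟩ := hφ.surj x
    refine ⟨s, hs, e • m, ?_⟩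
    rw [bcMk_smul, he, ← bcMk_mul, one_mul]
  | add a b ha hb =>
    obtain ⟨s, hs, m, hm⟩ := ha
    obtain ⟨t, ht, n, hn⟩ := hb
    refine ⟨s * t, mul_mem hs ht, (t : E) • m + (s : E) • n, ?_⟩
    rw [bcMk_add_right, ← bcMk_smul_one, ← bcMk_smul_one, ← hm, ← hn, smul_add, smul_smul,
      smul_smul, Subring.coe_mul, map_mul, hφ.comm s (φ t)]

variable {N : Type u} [AddCommGroup N] [Module E N]

lemma injective_baseChangeMap (f : M →ₗ[E] N) (hf : ∀ m, f m = 0 → ∃ s ∈ S, (s : E) • m = 0) :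
    Function.Injective (baseChangeMap φ f) := by
  refine (injective_iff_map_eq_zero _).2 fun t ht => ?_
  obtain ⟨s, hs, m, hm⟩ := hφ.exists_smul_eq_bcMk_one t
  have h1 : bcMk φ 1 (f m) = 0 := by
    change baseChangeMap φ f (bcMk φ 1 m) = 0
    rw [← hm, map_smul, ht, smul_zero]
  obtain ⟨r, hr, hr'⟩ := hφ.bcMk_one_eq_zero h1
  rw [← map_smul] at hr'
  obtain ⟨q, hq, hq'⟩ := hf _ hr'
  have h2 : φ (q * r) • bcMk φ 1 m = 0 := by
    rw [bcMk_smul_one, mul_smul, hq', bcMk_zero_right]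
  rw [← hm, smul_smul, map_mul] at h2
  exact (((hφ.isUnit q hq).mul (hφ.isUnit r hr)).mul (hφ.isUnit s hs)).smul_eq_zero.1 h2

lemma surjective_baseChangeMap (f : M →ₗ[E] N) (hf : ∀ n, ∃ s ∈ S, ∃ m, f m = (s : E) • n) :
    Function.Surjective (baseChangeMap φ f) := by
  intro t
  obtain ⟨s, hs, n, hn⟩ := hφ.exists_smul_eq_bcMk_one t
  obtain ⟨r, hr, m, hm⟩ := hf n
  obtain ⟨w, hw⟩ := (hφ.isUnit r hr).mul (hφ.isUnit s hs)
  refine ⟨(↑w⁻¹ : F) • bcMk φ 1 m, ?_⟩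
  have h : baseChangeMap φ f (bcMk φ 1 m) = (w : F) • t := by
    change bcMk φ 1 (f m) = _
    rw [hm, ← bcMk_smul_one, ← hn, smul_smul, hw]
  rw [map_smul, h, smul_smul, Units.inv_mul, one_smul]

end

/-- The unit `M → F ⊗_E M` has torsion kernel and cokernel. -/
lemma isTorsionIso_bcUnit (M : ModuleCat.{u} E) : IsTorsionIso S (bcUnit φ M).hom where
  ker _ hm := hφ.bcMk_one_eq_zero hm
  coker t := by
    obtain ⟨s, hs, m, hm⟩ := hφ.exists_smul_eq_bcMk_one t
    exact ⟨s, hs, m, hm.symm⟩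

/-- Base change turns maps with torsion kernel and cokernel into isomorphisms. -/
lemma isIso_baseChange_map {M N : ModuleCat.{u} E} (f : M ⟶ N) (hf : IsTorsionIso S f.hom) :
    IsIso ((baseChange φ).map f) :=
  (ConcreteCategory.isIso_iff_bijective _).2
    ⟨hφ.injective_baseChangeMap f.hom hf.ker, hφ.surjective_baseChangeMap f.hom hf.coker⟩

lemma isFlatHom : IsFlatHom φ where
  preservesMono := ⟨fun {M N} f hf => by
    rw [ModuleCat.mono_iff_injective] at hf ⊢
    refine hφ.injective_baseChangeMap f.hom fun m hm => ⟨1, one_mem _, ?_⟩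
    exact (one_smul E m).trans (hf (hm.trans (map_zero f.hom).symm))⟩

/-- For an `F`-module `N`, the counit `F ⊗_E N → N` is an isomorphism. -/
lemma isIso_bcCounit (N : ModuleCat.{u} F) : IsIso (bcCounit φ N) := by
  have h1 : IsTorsionIso S (bcUnit φ ((ModuleCat.restrictScalars.{u} φ).obj N)).hom :=
    hφ.isTorsionIso_bcUnit _
  have h2 := (bcAdj φ).right_triangle_components N
  have hc : ∀ n : N, (bcCounit φ N).hom
    (bcMk φ (M := (ModuleCat.restrictScalars.{u} φ).obj N) 1 n) = n := fun n => one_smul F n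
  refine (ConcreteCategory.isIso_iff_bijective _).2 ⟨?_, fun n => ⟨_, hc n⟩⟩
  refine (injective_iff_map_eq_zero (bcCounit φ N).hom).2 fun t ht => ?_
  -- Up to the unit `φ s`, the element `t` is `1 ⊗ m`, which the counit sends to `m`; so `m = 0` as
  -- soon as `t` is in the kernel.
  obtain ⟨s, hs, m, hm⟩ := hφ.exists_smul_eq_bcMk_one
    (M := (ModuleCat.restrictScalars.{u} φ).obj N) t
  have h3 : (show N from m) = 0 := by
    rw [← hc m]
    erw [← hm]
    exact ((bcCounit φ N).hom.map_smul _ _).trans (by rw [ht, smul_zero])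
  have h4 : φ s • t = 0 := hm.trans ((congrArg _ h3).trans (bcMk_zero_right φ 1))
  exact (hφ.isUnit s hs).smul_eq_zero.1 h4

end IsCentralLocalization

end CentralLocalization

/-! ### Cohomology of complexes of modules -/

section Cycles

variable {E : Type u} [Ring E] (M : CochainComplex (ModuleCat.{u} E) ℤ)
variable {N : CochainComplex (ModuleCat.{u} E) ℤ}

lemma d_iCycles (q r : ℤ) (c : M.cycles q) : (M.d q r).hom ((M.iCycles q).hom c) = 0 := by
  rw [← ModuleCat.comp_apply, HomologicalComplex.iCycles_d]
  rfl

lemma exists_iCycles_eq {q r : ℤ} (hr : q + 1 = r) (x : M.X q) (hx : (M.d q r).hom x = 0) :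
    ∃ c : M.cycles q, (M.iCycles q).hom c = x :=
  (ShortComplex.moduleCat_exact_iff _).1 (ShortComplex.exact_of_f_is_kernel
    (ShortComplex.mk (M.iCycles q) (M.d q r) (M.iCycles_d q r))
    (M.cyclesIsKernel q r (by simp [hr]))) x hx

lemma iCycles_injective (q : ℤ) : Function.Injective (M.iCycles q).hom :=
  (ModuleCat.mono_iff_injective _).1 inferInstance

lemma homologyπ_surjective (q : ℤ) : Function.Surjective (M.homologyπ q).hom :=
  (ModuleCat.epi_iff_surjective _).1 inferInstance

lemma homologyπ_eq_zero_iff {p q : ℤ} (hp : p + 1 = q) (c : M.cycles q) :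
    (M.homologyπ q).hom c = 0 ↔ ∃ w : M.X p, (M.d p q).hom w = (M.iCycles q).hom c := by
  constructor
  · intro hc
    obtain ⟨w, hw⟩ := (ShortComplex.moduleCat_exact_iff _).1 (ShortComplex.exact_of_g_is_cokernel
      (ShortComplex.mk (M.toCycles p q) (M.homologyπ q) (by simp))
      (M.homologyIsCokernel p q (by simp [← hp]))) c hc
    refine ⟨w, ?_⟩
    rw [← M.toCycles_i p q, ModuleCat.comp_apply]
    exact congrArg _ hw
  · rintro ⟨w, hw⟩
    rw [← M.toCycles_i p q, ModuleCat.comp_apply] at hw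
    rw [← iCycles_injective M q hw, ← ModuleCat.comp_apply]
    simp

lemma homologyMap_homologyπ (f : M ⟶ N) (q : ℤ) (c : M.cycles q) :
    (HomologicalComplex.homologyMap f q).hom ((M.homologyπ q).hom c) =
      (N.homologyπ q).hom ((HomologicalComplex.cyclesMap f q).hom c) := by
  rw [← ModuleCat.comp_apply, HomologicalComplex.homologyπ_naturality, ModuleCat.comp_apply]

lemma iCycles_cyclesMap (f : M ⟶ N) (q : ℤ) (c : M.cycles q) :
    (N.iCycles q).hom ((HomologicalComplex.cyclesMap f q).hom c) =
      (f.f q).hom ((M.iCycles q).hom c) := by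
  rw [← ModuleCat.comp_apply, HomologicalComplex.cyclesMap_i, ModuleCat.comp_apply]

variable {M}

lemma d_f_apply (f : M ⟶ N) (p q : ℤ) (x : M.X p) :
    (N.d p q).hom ((f.f p).hom x) = (f.f q).hom ((M.d p q).hom x) := by
  rw [← ModuleCat.comp_apply, f.comm, ModuleCat.comp_apply]

lemma d_d_apply (p q r : ℤ) (x : M.X p) : (M.d q r).hom ((M.d p q).hom x) = 0 := by
  rw [← ModuleCat.comp_apply, M.d_comp_d]
  rfl

variable {S : Submonoid (Subring.center E)}

/-- With its cokernel analogue and the converse `isTorsionIso_homologyMap`, this expresses torsion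
on cohomology by elements of the complexes. The element form survives a change of the ring, since
restriction of scalars leaves elements and differentials unchanged. -/
lemma IsTorsionIso.exists_boundary {f : M ⟶ N} {p q r : ℤ} (hp : p + 1 = q) (hr : q + 1 = r)
    (hf : IsTorsionIso S (HomologicalComplex.homologyMap f q).hom) (x : M.X q)
    (hx : (M.d q r).hom x = 0) (w : N.X p) (hw : (N.d p q).hom w = (f.f q).hom x) :
    ∃ s ∈ S, ∃ v : M.X p, (M.d p q).hom v = (s : E) • x := by
  obtain ⟨c, rfl⟩ := exists_iCycles_eq M hr x hx
  obtain ⟨s, hs, h⟩ := hf.ker ((M.homologyπ q).hom c) (by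
    rw [homologyMap_homologyπ, homologyπ_eq_zero_iff N hp, iCycles_cyclesMap]
    exact ⟨w, hw⟩)
  rw [← map_smul, homologyπ_eq_zero_iff M hp, map_smul] at h
  exact ⟨s, hs, h⟩

lemma IsTorsionIso.exists_cycle {f : M ⟶ N} {p q r : ℤ} (hp : p + 1 = q) (hr : q + 1 = r)
    (hf : IsTorsionIso S (HomologicalComplex.homologyMap f q).hom) (y : N.X q)
    (hy : (N.d q r).hom y = 0) :
    ∃ s ∈ S, ∃ x : M.X q, (M.d q r).hom x = 0 ∧ ∃ w : N.X p,
      (N.d p q).hom w = (f.f q).hom x - (s : E) • y := by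
  obtain ⟨c, rfl⟩ := exists_iCycles_eq N hr y hy
  obtain ⟨s, hs, m, hm⟩ := hf.coker ((N.homologyπ q).hom c)
  obtain ⟨m, rfl⟩ := homologyπ_surjective M q m
  rw [homologyMap_homologyπ, ← map_smul, ← sub_eq_zero, ← map_sub,
    homologyπ_eq_zero_iff N hp, map_sub, iCycles_cyclesMap, map_smul] at hm
  exact ⟨s, hs, _, d_iCycles M q r m, hm⟩

lemma isTorsionIso_homologyMap {f : M ⟶ N} {p q r : ℤ} (hp : p + 1 = q) (hr : q + 1 = r)
    (h₁ : ∀ (x : M.X q) (w : N.X p), (M.d q r).hom x = 0 → (N.d p q).hom w = (f.f q).hom x →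
      ∃ s ∈ S, ∃ v : M.X p, (M.d p q).hom v = (s : E) • x)
    (h₂ : ∀ y : N.X q, (N.d q r).hom y = 0 → ∃ s ∈ S, ∃ x : M.X q, (M.d q r).hom x = 0 ∧
      ∃ w : N.X p, (N.d p q).hom w = (f.f q).hom x - (s : E) • y) :
    IsTorsionIso S (HomologicalComplex.homologyMap f q).hom where
  ker m hm := by
    obtain ⟨c, rfl⟩ := homologyπ_surjective M q m
    rw [homologyMap_homologyπ, homologyπ_eq_zero_iff N hp, iCycles_cyclesMap] at hm
    obtain ⟨w, hw⟩ := hm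
    obtain ⟨s, hs, h⟩ := h₁ _ w (d_iCycles M q r c) hw
    refine ⟨s, hs, ?_⟩
    rwa [← map_smul, homologyπ_eq_zero_iff M hp, map_smul]
  coker n := by
    obtain ⟨c, rfl⟩ := homologyπ_surjective N q n
    obtain ⟨s, hs, x, hx, h⟩ := h₂ _ (d_iCycles N q r c)
    obtain ⟨m, rfl⟩ := exists_iCycles_eq M hr x hx
    refine ⟨s, hs, (M.homologyπ q).hom m, ?_⟩
    rwa [homologyMap_homologyπ, ← map_smul, ← sub_eq_zero, ← map_sub,
      homologyπ_eq_zero_iff N hp, map_sub, iCycles_cyclesMap, map_smul]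

end Cycles

/-! ### Formal properties of maps with torsion kernel and cokernel -/

section TorsionIso

variable {E : Type u} [Ring E] {S : Submonoid (Subring.center E)}

lemma IsTorsionIso.of_iso {M N M' N' : ModuleCat.{u} E} {f : M ⟶ N} {g : M' ⟶ N'} (a : M ⟶ M')
    (b : N ⟶ N') [IsIso a] [IsIso b] (h : f ≫ b = a ≫ g) (hf : IsTorsionIso S f.hom) :
    IsTorsionIso S g.hom := by
  have ha := (ConcreteCategory.isIso_iff_bijective a).1 inferInstance
  have hb := (ConcreteCategory.isIso_iff_bijective b).1 inferInstance
  have h' : ∀ m, b.hom (f.hom m) = g.hom (a.hom m) := fun m => congrArg (fun k => k.hom m) h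
  constructor
  · intro m hm
    obtain ⟨m, rfl⟩ := ha.2 m
    change g.hom (a.hom m) = 0 at hm
    obtain ⟨s, hs, h⟩ := hf.ker m (hb.1 (show b.hom _ = b.hom _ by rw [h', hm, map_zero]))
    exact ⟨s, hs, (a.hom.map_smul _ _).symm.trans (by rw [h, map_zero])⟩
  · intro n
    obtain ⟨n, rfl⟩ := hb.2 n
    obtain ⟨s, hs, m, hm⟩ := hf.coker n
    refine ⟨s, hs, a.hom m, ?_⟩
    rw [← h', hm]
    exact b.hom.map_smul _ _

lemma IsTorsionIso.of_bijective {M N : Type*} [AddCommGroup M] [Module E M] [AddCommGroup N]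
    [Module E N] (f : M →ₗ[E] N) (hf : Function.Bijective f) : IsTorsionIso S f where
  ker m hm := ⟨1, one_mem _, by rw [hf.1 (hm.trans (map_zero f).symm), smul_zero]⟩
  coker n := by
    obtain ⟨m, rfl⟩ := hf.2 n
    exact ⟨1, one_mem _, m, (one_smul E _).symm⟩

lemma IsTorsionIso.comp {M N P : Type*} [AddCommGroup M] [Module E M] [AddCommGroup N]
    [Module E N] [AddCommGroup P] [Module E P] {f : M →ₗ[E] N} {g : N →ₗ[E] P}
    (hf : IsTorsionIso S f) (hg : IsTorsionIso S g) : IsTorsionIso S (g ∘ₗ f) where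
  ker m hm := by
    obtain ⟨s, hs, h⟩ := hg.ker (f m) hm
    rw [← map_smul] at h
    obtain ⟨t, ht, h'⟩ := hf.ker _ h
    exact ⟨t * s, mul_mem ht hs, by rwa [Subring.coe_mul, mul_smul]⟩
  coker n := by
    obtain ⟨s, hs, m, hm⟩ := hg.coker n
    obtain ⟨t, ht, m', hm'⟩ := hf.coker m
    exact ⟨t * s, mul_mem ht hs, m', by
      rw [LinearMap.comp_apply, hm', map_smul, hm, Subring.coe_mul, mul_smul]⟩

/-- Torsion with respect to `S` may be tested on a smaller set `T`, if every element of `S` acts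
on the source as an element of `T`, and the elements of `S` act injectively on the target. -/
lemma IsTorsionIso.of_exchange {T : Submonoid (Subring.center E)} {M N : Type*} [AddCommGroup M]
    [Module E M] [AddCommGroup N] [Module E N] {f : M →ₗ[E] N} (hf : IsTorsionIso S f)
    (hinj : ∀ s ∈ S, ∀ n : N, (s : E) • n = 0 → n = 0)
    (h : ∀ s ∈ S, ∃ t ∈ T, ∀ m : M, (s : E) • m = (t : E) • m) : IsTorsionIso T f where
  ker m hm := by
    obtain ⟨s, hs, hm'⟩ := hf.ker m hm
    obtain ⟨t, ht, h'⟩ := h s hs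
    exact ⟨t, ht, by rw [← h', hm']⟩
  coker n := by
    obtain ⟨s, hs, m, hm⟩ := hf.coker n
    obtain ⟨t, ht, h'⟩ := h s hs
    refine ⟨t, ht, m, ?_⟩
    -- The exchange is known only on the source: `s` and `t` agree on `m`, hence on `f m = s n`.
    -- Thus `s` kills `s n - t n`, and `s` acts injectively on the target.
    rw [hm, ← sub_eq_zero]
    refine hinj s hs _ ?_
    rw [smul_sub, ← hm, ← map_smul, h', map_smul, hm, center_smul_comm s (t : E), sub_self]

end TorsionIso

/-! ### Localization of complexes -/

section BaseChangeComplex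

variable {E F : Type u} [Ring E] [Ring F] (φ : E →+* F)

/-- Base change of complexes. -/
abbrev bcComplex (M : CochainComplex (ModuleCat.{u} E) ℤ) : CochainComplex (ModuleCat.{u} F) ℤ :=
  ((baseChange φ).mapHomologicalComplex (ComplexShape.up ℤ)).obj M

/-- The unit `M → F ⊗_E M` for complexes. -/
def bcUnitComplex (M : CochainComplex (ModuleCat.{u} E) ℤ) : M ⟶ restrict φ (bcComplex φ M) where
  f q := bcUnit φ (M.X q)
  comm' p q _ := ((bcAdj φ).unit.naturality (M.d p q)).symm

/-- The counit `F ⊗_E N → N` for complexes. -/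
def bcCounitComplex (N : CochainComplex (ModuleCat.{u} F) ℤ) : bcComplex φ (restrict φ N) ⟶ N where
  f q := bcCounit φ (N.X q)
  comm' p q _ := ((bcAdj φ).counit.naturality (N.d p q)).symm

variable {S : Submonoid (Subring.center E)} {φ}

/-- Localization is exact, so on cohomology the unit of `M` is identified with the unit of the
module `H^q(M)`. -/
lemma IsCentralLocalization.isTorsionIso_homologyMap_bcUnitComplex
    (hφ : IsCentralLocalization S φ) (M : CochainComplex (ModuleCat.{u} E) ℤ) (q : ℤ) :
    IsTorsionIso S (HomologicalComplex.homologyMap (bcUnitComplex φ M) q).hom := by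
  have := hφ.isFlatHom
  have hp : (baseChange φ ⋙ ModuleCat.restrictScalars.{u} φ).PreservesHomology := inferInstance
  have h := NatTrans.app_homology (bcAdj φ).unit (M.sc q)
  exact IsTorsionIso.of_iso ((M.sc q).mapHomologyIso (𝟭 (ModuleCat.{u} E))).inv
    ((M.sc q).mapHomologyIso (baseChange φ ⋙ ModuleCat.restrictScalars.{u} φ)).inv
    (f := (bcAdj φ).unit.app (M.sc q).homology)
    (g := ShortComplex.homologyMap ((M.sc q).mapNatTrans (bcAdj φ).unit))
    (by rw [h]; simp only [Category.assoc, Iso.hom_inv_id, Category.comp_id])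
    (hφ.isTorsionIso_bcUnit _)

lemma IsCentralLocalization.isIso_bcCounitComplex
    (hφ : IsCentralLocalization S φ) (N : CochainComplex (ModuleCat.{u} F) ℤ) :
    IsIso (bcCounitComplex φ N) := by
  have : ∀ q, IsIso ((bcCounitComplex φ N).f q) := fun q => hφ.isIso_bcCounit (N.X q)
  exact HomologicalComplex.Hom.isIso_of_components _

/-- A morphism of complexes with torsion kernel and cokernel on cohomology becomes a
quasi-isomorphism after localization. -/
lemma IsCentralLocalization.quasiIso_baseChange (hφ : IsCentralLocalization S φ)
    {M N : CochainComplex (ModuleCat.{u} E) ℤ} (f : M ⟶ N)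
    (hf : ∀ q, IsTorsionIso S (HomologicalComplex.homologyMap f q).hom) :
    QuasiIso (((baseChange φ).mapHomologicalComplex (ComplexShape.up ℤ)).map f) := by
  have := hφ.isFlatHom
  refine ⟨fun q => ?_⟩
  rw [quasiIsoAt_iff_isIso_homologyMap]
  have := hφ.isIso_baseChange_map _ (hf q)
  have h := ShortComplex.mapHomologyIso_hom_naturality
    ((HomologicalComplex.shortComplexFunctor _ _ q).map f) (baseChange φ)
  have h' : IsIso ((baseChange φ).map (ShortComplex.homologyMap
    ((HomologicalComplex.shortComplexFunctor _ (ComplexShape.up ℤ) q).map f))) := this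
  rw [← Iso.eq_comp_inv] at h
  have h'' := h ▸ (inferInstance : IsIso ((((M.sc q).mapHomologyIso (baseChange φ)).hom ≫
    (baseChange φ).map (ShortComplex.homologyMap
    ((HomologicalComplex.shortComplexFunctor _ (ComplexShape.up ℤ) q).map f))) ≫
    ((N.sc q).mapHomologyIso (baseChange φ)).inv))
  exact h''

end BaseChangeComplex

/-! ### Cocycles with values in K-injective complexes -/

section Cocycles

open CochainComplex CochainComplex.HomComplex

variable {C : Type*} [Category* C] [Abelian C]

lemma acyclic_mappingCone {K L : CochainComplex C ℤ} (f : K ⟶ L) [QuasiIso f] :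
    (mappingCone f).Acyclic := by
  let := HasDerivedCategory.standard C
  intro n
  have hT := DerivedCategory.mappingCone_triangle_distinguished f
  have h₂ := CochainComplex.homologyMap_exact₂_of_distTriang _ hT n
  have h₃ := CochainComplex.homologyMap_exact₃_of_distTriang _ hT n (n + 1) rfl
  have h₁ := CochainComplex.homologyMap_exact₁_of_distTriang _ hT n (n + 1) rfl
  have e₁ : Epi (HomologicalComplex.homologyMap f n) := inferInstance
  have e₂ : Mono (HomologicalComplex.homologyMap f (n + 1)) := inferInstance
  rw [HomologicalComplex.exactAt_iff_isZero_homology]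
  refine h₃.isZero_of_both_zeros ?_ ?_
  · dsimp
    have := homologyMap_comp_eq_zero_of_distTriang _ hT n
    exact (cancel_epi (HomologicalComplex.homologyMap f n)).1 (this.trans Limits.comp_zero.symm)
  · have := homologyδOfTriangle_homologyMap _ hT n (n + 1) rfl
    exact (cancel_mono (HomologicalComplex.homologyMap f (n + 1))).1
      (this.trans Limits.zero_comp.symm)

/-- A cocycle with values in a K-injective complex is a coboundary if it is one after composition
with a quasi-isomorphism. -/
lemma exists_δ_eq_of_quasiIso {K K' L : CochainComplex C ℤ} [L.IsKInjective] (v : K ⟶ K')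
    [QuasiIso v] {m n : ℤ} (hm : m + 1 = n) (z : Cocycle K' L n) (w : Cochain K L m)
    (hw : δ m n w = (Cochain.ofHom v).comp z.1 (zero_add n)) :
    ∃ w' : Cochain K' L m, δ m n w' = z.1 := by
  -- The pair `(w, z)` is a cocycle on the mapping cone of `v`, up to the sign required by
  -- `descCocycle`. The cone is acyclic, so the cocycle bounds; restricting the bound along `inr`
  -- bounds `z`.
  obtain ⟨γ, hγ⟩ := IsKInjective.eq_δ_of_cocycle
    (mappingCone.descCocycle v (n.negOnePow • w) z hm (by rw [δ_units_smul, hw]))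
    (acyclic_mappingCone v) m hm
  refine ⟨(Cochain.ofHom (mappingCone.inr v)).comp γ (zero_add m), ?_⟩
  rw [δ_ofHom_comp, hγ, mappingCone.descCocycle_coe, mappingCone.inr_descCochain]

/-- Any morphism to a K-injective complex extends along a quasi-isomorphism, up to homotopy. -/
lemma exists_lift_of_quasiIso {K K' L : CochainComplex C ℤ} [L.IsKInjective] (v : K ⟶ K')
    [QuasiIso v] (f : K ⟶ L) : ∃ g : K' ⟶ L, Nonempty (Homotopy (v ≫ g) f) := by
  let := HasDerivedCategory.standard C
  have h : IsIso (DerivedCategory.Qh.map ((HomotopyCategory.quotient _ _).map v)) := by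
    rw [← isIso_comp_right_iff _ ((DerivedCategory.quotientCompQhIso C).hom.app K'),
      DerivedCategory.quotientCompQhIso_hom_naturality]
    infer_instance
  obtain ⟨g, hg⟩ := (IsKInjective.Qh_map_bijective _ L).2
    (inv (DerivedCategory.Qh.map ((HomotopyCategory.quotient _ _).map v)) ≫
      DerivedCategory.Qh.map ((HomotopyCategory.quotient _ _).map f))
  obtain ⟨g, rfl⟩ := (HomotopyCategory.quotient _ _).map_surjective g
  refine ⟨g, ⟨HomotopyCategory.homotopyOfEq _ _ ?_⟩⟩
  apply (IsKInjective.Qh_map_bijective _ L).1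
  rw [Functor.map_comp, Functor.map_comp, hg, IsIso.hom_inv_id_assoc]

/-- Morphisms to a K-injective complex which agree in the derived category are homotopic. -/
lemma homotopy_of_Q_map_eq [HasDerivedCategory C] {K L : CochainComplex C ℤ} [L.IsKInjective]
    (f g : K ⟶ L) (h : DerivedCategory.Q.map f = DerivedCategory.Q.map g) :
    Nonempty (Homotopy f g) := by
  refine ⟨HomotopyCategory.homotopyOfEq _ _ ((IsKInjective.Qh_map_bijective _ L).1 ?_)⟩
  rw [← cancel_mono ((DerivedCategory.quotientCompQhIso C).hom.app L),
    DerivedCategory.quotientCompQhIso_hom_naturality,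
    DerivedCategory.quotientCompQhIso_hom_naturality, h]

/-- Cocycles vanish for degree reasons. -/
lemma exists_δ_eq_of_isLE {M I : CochainComplex C ℤ} [I.IsKInjective] (a b : ℤ) [M.IsLE b]
    [I.IsStrictlyGE a] {m n : ℤ} (hm : m + 1 = n) (h : b + n < a) (z : Cocycle M I n) :
    ∃ w : Cochain M I m, δ m n w = z.1 := by
  -- After truncating `M` above `b`, every component goes from a degree at most `b` to a degree
  -- below `a`, so the cocycle is zero and the zero cochain bounds it.
  refine exists_δ_eq_of_quasiIso (M.ιTruncLE b) hm z 0 ?_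
  rw [δ_zero]
  ext p q hpq
  by_cases hp : b < p
  · exact ((M.truncLE b).isZero_of_isStrictlyLE b p hp).eq_of_src _ _
  · exact (I.isZero_of_isStrictlyGE a q (by lia)).eq_of_tgt _ _

end Cocycles

/-! ### Dévissage: maps from complexes with noetherian cohomology to torsion complexes -/

section Torsion

open CochainComplex CochainComplex.HomComplex

variable {E : Type u} [Ring E]

lemma isNoetherian_homology {M : CochainComplex (ModuleCat.{u} E) ℤ} (q : ℤ)
    [IsNoetherian E (M.X q)] : IsNoetherian E (M.homology q) := by
  have := isNoetherian_of_injective _ (iCycles_injective M q)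
  exact isNoetherian_of_surjective _ (LinearMap.range_eq_top.2 (homologyπ_surjective M q))

/-- There is a map from a shifted free module which is surjective on the top cohomology. -/
lemma exists_surjective_homologyMap_single {M : CochainComplex (ModuleCat.{u} E) ℤ} (c : ℤ)
    [Module.Finite E (M.homology c)] :
    ∃ (k : ℕ) (φ : (singleFunctor (ModuleCat.{u} E) c).obj (ModuleCat.of E (Fin k → E)) ⟶ M),
      Function.Surjective (HomologicalComplex.homologyMap φ c).hom := by
  obtain ⟨k, f, hf⟩ := Module.Finite.exists_fin' E (M.homology c)
  obtain ⟨g, hg⟩ := Module.projective_lifting_property (M.homologyπ c).hom f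
    (homologyπ_surjective M c)
  let g' : ModuleCat.of E (Fin k → E) ⟶ M.cycles c := ModuleCat.ofHom g
  let φ' := Cocycle.fromSingleMk (K := M) (g' ≫ M.iCycles c) (add_zero c) (c + 1) rfl (by simp)
  refine ⟨k, φ'.homOf, fun y => ?_⟩
  obtain ⟨a, rfl⟩ := hf y
  let e := HomologicalComplex.singleObjXSelf (.up ℤ) c (ModuleCat.of E (Fin k → E))
  let P := (singleFunctor (ModuleCat.{u} E) c).obj (ModuleCat.of E (Fin k → E))
  have h : P.d c (c + 1) = 0 := (HomologicalComplex.isZero_single_obj_X (ComplexShape.up ℤ) c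
      (ModuleCat.of E (Fin k → E)) (c + 1) (by simp)).eq_of_tgt _ _
  obtain ⟨x, hx⟩ := exists_iCycles_eq P (rfl : c + 1 = c + 1) (e.inv.hom a)
    (congrArg (fun k => k.hom (e.inv.hom a)) h)
  refine ⟨(P.homologyπ c).hom x, ?_⟩
  rw [homologyMap_homologyπ, ← hg]
  refine congrArg (M.homologyπ c).hom (iCycles_injective M c ?_)
  rw [iCycles_cyclesMap, hx]
  have h : φ'.homOf.f c = e.hom ≫ g' ≫ M.iCycles c := Cochain.fromSingleMk_v _ (add_zero c)
  have h' : e.inv ≫ φ'.homOf.f c = g' ≫ M.iCycles c := by rw [h]; exact e.inv_hom_id_assoc _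
  exact congrArg (fun k => k.hom a) h'

/-- A cocycle on a free module of rank `k` in one degree is a family of `k` cocycles of `V`. The
product of the `k` annihilators works for all of them, as commutativity allows any chosen factor to
be applied first. -/
lemma exists_δ_eq_single_torsion {V : CochainComplex (ModuleCat.{u} E) ℤ} {Λ : Type*}
    [CommMonoid Λ] (ρ : Λ →* End V)
    (hρ : ∀ (p q r : ℤ) (_ : p + 1 = q) (_ : q + 1 = r) (x : V.X q), (V.d q r).hom x = 0 →
      ∃ (l : Λ) (w : V.X p), (V.d p q).hom w = ((ρ l).f q).hom x)
    (k : ℕ) (c : ℤ) {m n : ℤ} (hm : m + 1 = n)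
    (z : Cocycle ((singleFunctor (ModuleCat.{u} E) c).obj (ModuleCat.of E (Fin k → E))) V n) :
    ∃ (l : Λ) (w : Cochain _ V m), δ m n w = z.1.comp (Cochain.ofHom (ρ l)) (add_zero n) := by
  obtain ⟨g, hg, rfl⟩ := Cocycle.fromSingleMk_surjective z (c + n) rfl (c + n + 1) (by lia)
  have hd : ∀ i, (V.d (c + n) (c + n + 1)).hom (g.hom (Pi.single i 1)) = 0 := fun i =>
    congrArg (fun f => f.hom (Pi.single i 1)) hg
  choose l w hw using fun i => hρ (c + m) (c + n) (c + n + 1) (by lia) rfl _ (hd i)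
  have hl : ∀ i, ∃ w' : V.X (c + m), (V.d (c + m) (c + n)).hom w' =
      ((ρ (∏ i, l i)).f (c + n)).hom (g.hom (Pi.single i 1)) := by
    intro i
    refine ⟨((ρ (∏ j ∈ Finset.univ.erase i, l j)).f (c + m)).hom (w i), ?_⟩
    rw [d_f_apply, hw, ← ModuleCat.comp_apply, ← HomologicalComplex.comp_f,
      ← Finset.prod_erase_mul _ _ (Finset.mem_univ i), map_mul]
    rfl
  choose w' hw' using hl
  refine ⟨∏ i, l i, Cochain.fromSingleMk
    (ModuleCat.ofHom ((Pi.basisFun E (Fin k)).constr ℕ w')) rfl, ?_⟩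
  rw [Cochain.δ_fromSingleMk _ _ _ _ (rfl : c + n = c + n)]
  change _ = (Cochain.fromSingleMk g rfl).comp _ _
  rw [← Cochain.fromSingleMk_postcomp]
  congr 1
  ext1
  refine (Pi.basisFun E (Fin k)).ext fun i => ?_
  change (V.d _ _).hom ((Pi.basisFun E (Fin k)).constr ℕ w' (Pi.basisFun E (Fin k) i)) =
    ((ρ (∏ i, l i)).f (c + n)).hom (g.hom (Pi.basisFun E (Fin k) i))
  rw [Module.Basis.constr_basis, hw', Pi.basisFun_apply]

lemma isNoetherian_of_exact {S : ShortComplex (ModuleCat.{u} E)} (h : S.Exact)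
    (h₁ : IsNoetherian E S.X₁) (h₃ : IsNoetherian E S.X₃) : IsNoetherian E S.X₂ :=
  isNoetherian_of_range_eq_ker _ _ h.moduleCat_range_eq_ker

/-- The cone of a map from a shifted free module which is onto the top cohomology. -/
lemma exists_mappingCone_isLE [IsNoetherianRing E] (M : CochainComplex (ModuleCat.{u} E) ℤ) (c : ℤ)
    [M.IsLE c] (hM : ∀ q, IsNoetherian E (M.homology q)) :
    ∃ (k : ℕ) (φ : (singleFunctor (ModuleCat.{u} E) c).obj (ModuleCat.of E (Fin k → E)) ⟶ M),
      (mappingCone φ).IsLE (c - 1) ∧ ∀ q, IsNoetherian E ((mappingCone φ).homology q) := by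
  obtain ⟨k, φ, hφ⟩ := exists_surjective_homologyMap_single (M := M) c
  refine ⟨k, φ, ?_, ?_⟩
  · rw [isLE_iff]
    intro q hq
    rw [HomologicalComplex.exactAt_iff_isZero_homology]
    have hT := DerivedCategory.mappingCone_triangle_distinguished φ
    refine (CochainComplex.homologyMap_exact₃_of_distTriang _ hT q (q + 1) rfl).isZero_of_both_zeros
      ?_ ?_
    · by_cases hqc : q = c
      · subst hqc
        have := (ModuleCat.epi_iff_surjective _).2 hφ
        exact (cancel_epi (HomologicalComplex.homologyMap φ q)).1
          ((homologyMap_comp_eq_zero_of_distTriang _ hT q).trans Limits.comp_zero.symm)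
      · exact (M.isZero_of_isLE c q (by lia)).eq_of_src _ _
    · exact (HomologicalComplex.isZero_single_obj_homology _ _ _ _ (by lia)).eq_of_tgt _ _
  · intro q
    have hT := DerivedCategory.mappingCone_triangle_distinguished φ
    have h := CochainComplex.homologyMap_exact₃_of_distTriang _ hT q (q + 1) rfl
    have h₁ : IsNoetherian E (((singleFunctor (ModuleCat.{u} E) c).obj
        (ModuleCat.of E (Fin k → E))).homology (q + 1)) := by
      have : IsNoetherian E (((singleFunctor (ModuleCat.{u} E) c).obj
          (ModuleCat.of E (Fin k → E))).X (q + 1)) := by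
        by_cases hq : q + 1 = c
        · subst hq
          have : IsNoetherian E (Fin k → E) := inferInstance
          exact isNoetherian_of_linearEquiv (HomologicalComplex.singleObjXSelf (.up ℤ) (q + 1)
            (ModuleCat.of E (Fin k → E))).symm.toLinearEquiv
        · have := ModuleCat.subsingleton_of_isZero (HomologicalComplex.isZero_single_obj_X
            (ComplexShape.up ℤ) c (ModuleCat.of E (Fin k → E)) (q + 1) hq)
          have : Finite (((singleFunctor (ModuleCat.{u} E) c).obj
            (ModuleCat.of E (Fin k → E))).X (q + 1)) := @Finite.of_subsingleton _ this
          exact isNoetherian_of_finite _ _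
      exact isNoetherian_homology _
    exact isNoetherian_of_exact h (hM q) h₁

/-- A bounded below complex of injectives on whose cohomology a monoid acts in a torsion way:
every cocycle on a complex with noetherian cohomology is annihilated by the monoid. -/
lemma exists_δ_eq_torsion [IsNoetherianRing E] {V : CochainComplex (ModuleCat.{u} E) ℤ} (a : ℤ)
    [V.IsStrictlyGE a] (hV : ∀ q, Injective (V.X q)) {Λ : Type*} [CommMonoid Λ] (ρ : Λ →* End V)
    (hρ : ∀ (p q r : ℤ) (_ : p + 1 = q) (_ : q + 1 = r) (x : V.X q), (V.d q r).hom x = 0 →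
      ∃ (l : Λ) (w : V.X p), (V.d p q).hom w = ((ρ l).f q).hom x)
    (M : CochainComplex (ModuleCat.{u} E) ℤ) (c : ℤ) [M.IsLE c]
    (hM : ∀ q, IsNoetherian E (M.homology q)) {m n : ℤ} (hm : m + 1 = n) (z : Cocycle M V n) :
    ∃ (l : Λ) (w : Cochain M V m), δ m n w = z.1.comp (Cochain.ofHom (ρ l)) (add_zero n) := by
  have := isKInjective_of_injective V a
  -- Induction on the gap between the top degree `c + n` reached by the cocycle and the lowest
  -- degree `a` of `V`. With no overlap the cocycle bounds for degree reasons; otherwise passing to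
  -- a cone lowers `c` by one.
  obtain ⟨N, hN⟩ : ∃ N : ℕ, c + n < a + N := ⟨(c + n - a).toNat + 1, by lia⟩
  induction N generalizing M c with
  | zero =>
    obtain ⟨w, hw⟩ := exists_δ_eq_of_isLE a c hm (by lia) z
    exact ⟨1, w, by rw [hw, map_one]; exact (Cochain.comp_id _).symm⟩
  | succ N ih =>
    obtain ⟨k, φ, h₁, h₂⟩ := exists_mappingCone_isLE M c hM
    obtain ⟨l, α, hα⟩ := exists_δ_eq_single_torsion ρ hρ k c hm (z.precomp φ)
    have hα' : δ m n (n.negOnePow • α) =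
        n.negOnePow • (Cochain.ofHom φ).comp (z.postcomp (ρ l)).1 (zero_add n) := by
      rw [δ_units_smul, hα, Cocycle.precomp_coe, Cocycle.postcomp_coe,
        Cochain.comp_assoc_of_third_is_zero_cochain]
    -- On the free module, `z` followed by `l` is bounded by `α`, so `z` followed by `l` extends to
    -- the cone of `φ`. The induction hypothesis kills the extension with a further `l'`, and
    -- restriction along `inr` returns to `M`.
    obtain ⟨l', w, hw⟩ := ih (mappingCone φ) (c - 1) h₂
      (mappingCone.descCocycle φ (n.negOnePow • α) (z.postcomp (ρ l)) hm hα') (by lia)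
    refine ⟨l' * l, (Cochain.ofHom (mappingCone.inr φ)).comp w (zero_add m), ?_⟩
    rw [δ_ofHom_comp, hw, mappingCone.descCocycle_coe,
      ← Cochain.comp_assoc_of_first_is_zero_cochain, mappingCone.inr_descCochain, map_mul]
    change (z.1.comp (Cochain.ofHom (ρ l)) (add_zero n)).comp (Cochain.ofHom (ρ l')) _ = _
    rw [Cochain.comp_assoc_of_second_is_zero_cochain, ← Cochain.ofHom_comp]
    rfl

end Torsion

/-! ### Torsion morphisms between complexes of injectives -/

section TorsionCone

open CochainComplex CochainComplex.HomComplex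

section

variable {C : Type*} [Category* C] [Abelian C]

lemma injective_mappingCone_X {I I' : CochainComplex C ℤ} (κ : I ⟶ I')
    (hI : ∀ q, Injective (I.X q)) (hI' : ∀ q, Injective (I'.X q)) (q : ℤ) :
    Injective ((mappingCone κ).X q) := by
  have := hI (q + 1)
  have := hI' q
  exact Injective.of_iso (HomologicalComplex.homotopyCofiber.XIsoBiprod κ q (q + 1) rfl).symm
    inferInstance

lemma isStrictlyGE_mappingCone {I I' : CochainComplex C ℤ} (κ : I ⟶ I') (a : ℤ)
    [I.IsStrictlyGE a] [I'.IsStrictlyGE a] : (mappingCone κ).IsStrictlyGE (a - 1) := by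
  rw [isStrictlyGE_iff]
  intro q hq
  rw [mappingCone.isZero_X_iff]
  exact ⟨I.isZero_of_isStrictlyGE a _ (by lia), I'.isZero_of_isStrictlyGE a _ (by lia)⟩

variable {I I' : CochainComplex C ℤ} (κ : I ⟶ I') {Λ : Type*} [Monoid Λ] (ρ : Λ →* End I)
  (ρ' : Λ →* End I')

/-- Compatible actions of a monoid on two complexes give an action on the mapping cone. -/
def mappingConeAction (h : ∀ l, ρ l ≫ κ = κ ≫ ρ' l) : Λ →* End (mappingCone κ) where
  toFun l := mappingCone.map κ κ (ρ l) (ρ' l) (h l).symm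
  map_one' := by
    refine Eq.trans ?_ (mappingCone.map_id κ)
    congr 1
    · exact map_one ρ
    · exact map_one ρ'
  map_mul' l l' := by
    refine Eq.trans ?_ (mappingCone.map_comp κ κ κ (ρ l') (ρ' l') (h l').symm (ρ l) (ρ' l)
      (h l).symm)
    congr 1
    · exact map_mul ρ l l'
    · exact map_mul ρ' l l'

lemma inr_mappingConeAction (h : ∀ l, ρ l ≫ κ = κ ≫ ρ' l) (l : Λ) :
    mappingCone.inr κ ≫ mappingConeAction κ ρ ρ' h l = ρ' l ≫ mappingCone.inr κ := by
  simp [mappingConeAction, mappingCone.map]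

lemma mappingConeAction_fst (h : ∀ l, ρ l ≫ κ = κ ≫ ρ' l) (l : Λ) :
    (Cochain.ofHom (mappingConeAction κ ρ ρ' h l)).comp (mappingCone.fst κ).1 (zero_add 1) =
      (mappingCone.fst κ).1.comp (Cochain.ofHom (ρ l)) (add_zero 1) := by
  rw [mappingCone.ext_cochain_from_iff κ 0 1 (zero_add 1)]
  constructor
  · rw [← Cochain.comp_assoc_of_second_is_zero_cochain]
    simp [mappingConeAction, mappingCone.map]
  · rw [← Cochain.comp_assoc_of_second_is_zero_cochain]
    simp [mappingConeAction, mappingCone.map]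

end

variable {E : Type u} [Ring E] {I I' : CochainComplex (ModuleCat.{u} E) ℤ} (κ : I ⟶ I')
  {Λ : Type*} [CommMonoid Λ] (ρ : Λ →* End I) (ρ' : Λ →* End I')

/-- The morphism `κ` induces maps on cohomology whose kernel and cokernel are torsion with respect
to the given actions of the monoid `Λ`. -/
structure IsTorsionHom : Prop where
  comm : ∀ l, ρ l ≫ κ = κ ≫ ρ' l
  ker : ∀ (p q r : ℤ) (_ : p + 1 = q) (_ : q + 1 = r) (x : I.X q) (w : I'.X p),
    (I.d q r).hom x = 0 → (I'.d p q).hom w = (κ.f q).hom x →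
      ∃ (l : Λ) (v : I.X p), (I.d p q).hom v = ((ρ l).f q).hom x
  coker : ∀ (p q r : ℤ) (_ : p + 1 = q) (_ : q + 1 = r) (y : I'.X q), (I'.d q r).hom y = 0 →
    ∃ (l : Λ) (x : I.X q), (I.d q r).hom x = 0 ∧ ∃ w : I'.X p,
      (I'.d p q).hom w = (κ.f q).hom x - ((ρ' l).f q).hom y

variable {κ ρ ρ'}

namespace IsTorsionHom

/-- The long exact sequence of the cone, on elements. A cocycle of the cone is a pair with `κ x₁ + d
x₂ = 0`. The kernel condition writes `l₁ x₁ = d v`; then `l₁ x₂ + κ v` is a cocycle of `I'`, to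
which the cokernel condition applies. -/
lemma exists_d_eq_mappingConeAction (h : IsTorsionHom κ ρ ρ') (p q r : ℤ) (hp : p + 1 = q)
    (hr : q + 1 = r) (x : (mappingCone κ).X q) (hx : ((mappingCone κ).d q r).hom x = 0) :
    ∃ (l : Λ) (w : (mappingCone κ).X p),
      ((mappingCone κ).d p q).hom w = ((mappingConeAction κ ρ ρ' h.comm l).f q).hom x := by
  obtain ⟨x₁, hx₁⟩ : ∃ y, y = ((mappingCone.fst κ).1.v q r hr).hom x := ⟨_, rfl⟩
  obtain ⟨x₂, hx₂⟩ : ∃ y, y = ((mappingCone.snd κ).v q q (add_zero q)).hom x := ⟨_, rfl⟩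
  have hx' : x = ((mappingCone.inl κ).v r q (by lia)).hom x₁ +
      ((mappingCone.inr κ).f q).hom x₂ := by
    have h := congrArg (fun f => f.hom x) (mappingCone.id_X κ q r hr)
    rw [hx₁, hx₂]
    exact h.symm
  have hd₁ : (I.d r (r + 1)).hom x₁ = 0 := by
    have h := congrArg (fun f => f.hom x) (mappingCone.d_fst_v κ q r (r + 1) hr rfl)
    have h' : ((mappingCone.fst κ).1.v r (r + 1) rfl).hom (((mappingCone κ).d q r).hom x) =
      - (I.d r (r + 1)).hom (((mappingCone.fst κ).1.v q r hr).hom x) := h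
    rw [hx, map_zero, zero_eq_neg] at h'
    rw [hx₁, h']
  have hd₂ : (κ.f r).hom x₁ + (I'.d q r).hom x₂ = 0 := by
    have h := congrArg (fun f => f.hom x) (mappingCone.d_snd_v κ q r hr)
    have h' : ((mappingCone.snd κ).v r r (add_zero r)).hom (((mappingCone κ).d q r).hom x) =
      (κ.f r).hom (((mappingCone.fst κ).1.v q r hr).hom x) + (I'.d q r).hom
        (((mappingCone.snd κ).v q q (add_zero q)).hom x) := h
    rw [hx, map_zero] at h'
    rw [hx₁, hx₂, h']
  obtain ⟨l₁, v, hv⟩ := h.ker q r (r + 1) hr rfl x₁ (-x₂) hd₁ (by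
    rw [map_neg, eq_comm, ← add_eq_zero_iff_eq_neg, hd₂])
  have hκ : ∀ (l : Λ) (i : ℤ) (y : I.X i),
      (κ.f i).hom (((ρ l).f i).hom y) = ((ρ' l).f i).hom ((κ.f i).hom y) := fun l i y =>
    congrArg (fun f => (f.f i).hom y) (h.comm l)
  obtain ⟨l₂, x', hx'0, w, hw⟩ := h.coker p q r hp hr
    (((ρ' l₁).f q).hom x₂ + (κ.f q).hom v) (by
      rw [map_add, d_f_apply, d_f_apply, hv, hκ, ← map_add, add_comm, hd₂, map_zero])
  have hρ : ∀ (y : I.X r), ((ρ (l₂ * l₁)).f r).hom y = ((ρ l₂).f r).hom (((ρ l₁).f r).hom y) :=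
    fun y => by rw [map_mul]; rfl
  have hρ' : ∀ (y : I'.X q), ((ρ' (l₂ * l₁)).f q).hom y =
    ((ρ' l₂).f q).hom (((ρ' l₁).f q).hom y) := fun y => by rw [map_mul]; rfl
  have hinl : ∀ (l : Λ) (y : I.X r), ((mappingConeAction κ ρ ρ' h.comm l).f q).hom
      (((mappingCone.inl κ).v r q (by lia)).hom y) =
      ((mappingCone.inl κ).v r q (by lia)).hom (((ρ l).f r).hom y) := fun l y =>
    congrArg (fun f => f.hom y) (show (mappingCone.inl κ).v r q (by lia) ≫
      (mappingConeAction κ ρ ρ' h.comm l).f q = (ρ l).f r ≫ (mappingCone.inl κ).v r q (by lia) by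
        simp [mappingConeAction, mappingCone.map])
  have hinr : ∀ (l : Λ) (y : I'.X q), ((mappingConeAction κ ρ ρ' h.comm l).f q).hom
      (((mappingCone.inr κ).f q).hom y) = ((mappingCone.inr κ).f q).hom (((ρ' l).f q).hom y) :=
    fun l y => congrArg (fun f => (f.f q).hom y) (inr_mappingConeAction κ ρ ρ' h.comm l)
  have hdl : ∀ y : I.X q, ((mappingCone κ).d p q).hom (((mappingCone.inl κ).v q p (by lia)).hom y) =
      ((mappingCone.inr κ).f q).hom ((κ.f q).hom y) -
        ((mappingCone.inl κ).v r q (by lia)).hom ((I.d q r).hom y) := fun y =>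
    congrArg (fun f => f.hom y) (mappingCone.inl_v_d κ q p r (by lia) (by lia))
  -- The boundary of this element has first component `d (l₂ v) = l₂ l₁ x₁`. In the second component
  -- the terms `κ x'` and `κ (l₂ v)` cancel and `l₂ l₁ x₂` remains.
  refine ⟨l₂ * l₁, ((mappingCone.inl κ).v q p (by lia)).hom (x' - ((ρ l₂).f q).hom v) -
    ((mappingCone.inr κ).f p).hom w, ?_⟩
  rw [map_sub ((mappingCone κ).d p q).hom, hdl, d_f_apply, hw, hx',
    map_add ((mappingConeAction κ ρ ρ' h.comm (l₂ * l₁)).f q).hom, hinl, hinr, hρ, hρ',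
    ← hv, map_sub (κ.f q).hom, map_sub (I.d q r).hom, hx'0, d_f_apply, hκ, zero_sub, map_neg,
    map_sub, map_sub, map_add, map_add]
  abel

variable [IsNoetherianRing E] (h : IsTorsionHom κ ρ ρ') (a : ℤ) [I.IsStrictlyGE a]
  [I'.IsStrictlyGE a] (hI : ∀ q, Injective (I.X q)) (hI' : ∀ q, Injective (I'.X q))
  {M : CochainComplex (ModuleCat.{u} E) ℤ} (c : ℤ) [M.IsLE c]
  (hM : ∀ q, IsNoetherian E (M.homology q)) {m n : ℤ} (hm : m + 1 = n)

include h a hI hI' c hM hm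

/-- Torsion of the cokernel of `Ext(M, I) → Ext(M, I')`. The image of `z` in the cone becomes a
coboundary `δ w` after applying some `l`; the first component of `w` is the required cocycle `z'`
and the second is the homotopy. -/
lemma exists_cocycle (z : Cocycle M I' n) :
    ∃ (l : Λ) (z' : Cocycle M I n) (w : Cochain M I' m),
      δ m n w = z.1.comp (Cochain.ofHom (ρ' l)) (add_zero n) -
        z'.1.comp (Cochain.ofHom κ) (add_zero n) := by
  have := isStrictlyGE_mappingCone κ a
  obtain ⟨l, w, hw⟩ := exists_δ_eq_torsion (a - 1) (injective_mappingCone_X κ hI hI')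
    (mappingConeAction κ ρ ρ' h.comm) (h.exists_d_eq_mappingConeAction) M c hM hm
    (z.postcomp (mappingCone.inr κ))
  rw [Cocycle.postcomp_coe, Cochain.comp_assoc_of_second_is_zero_cochain, ← Cochain.ofHom_comp,
    inr_mappingConeAction] at hw
  have hf : δ n (n + 1) (w.comp (mappingCone.fst κ).1 hm) = 0 := by
    rw [δ_comp _ _ hm n 2 _ rfl hm rfl, hw, Cocycle.δ_eq_zero, Cochain.comp_zero, zero_add,
      Cochain.comp_assoc_of_second_is_zero_cochain]
    simp
  have hs : δ m n (w.comp (mappingCone.snd κ) (add_zero m)) =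
      z.1.comp (Cochain.ofHom (ρ' l)) (add_zero n) -
        (w.comp (mappingCone.fst κ).1 hm).comp (Cochain.ofHom κ) (add_zero n) := by
    rw [δ_comp_zero_cochain _ _ _ hm, hw, mappingCone.δ_snd,
      Cochain.comp_assoc_of_second_is_zero_cochain, Cochain.comp_neg,
      Cochain.comp_assoc_of_third_is_zero_cochain, Cochain.ofHom_comp,
      Cochain.comp_assoc_of_second_is_zero_cochain, mappingCone.inr_snd, Cochain.comp_id]
    abel
  exact ⟨l, Cocycle.mk _ (n + 1) rfl hf, _, hs⟩

/-- Torsion of the kernel of `Ext(M, I) → Ext(M, I')`: the pair `(-z, w)` is a cocycle with values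
in the cone, and the first component of a bound for a multiple of it bounds a multiple of `z`. -/
lemma exists_δ_eq (z : Cocycle M I n) (w : Cochain M I' m)
    (hw : δ m n w = z.1.comp (Cochain.ofHom κ) (add_zero n)) :
    ∃ (l : Λ) (w' : Cochain M I m), δ m n w' = z.1.comp (Cochain.ofHom (ρ l)) (add_zero n) := by
  have := isStrictlyGE_mappingCone κ a
  -- Since `fst` has degree one, the pair is a cocycle of degree `m` and its bound `v` has degree `m
  -- - 1`. The cone starts one degree below `I` and `I'`, whence `a - 1`.
  obtain ⟨l, v, hv⟩ := exists_δ_eq_torsion (a - 1) (injective_mappingCone_X κ hI hI')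
    (mappingConeAction κ ρ ρ' h.comm) (h.exists_d_eq_mappingConeAction) M c hM
    (sub_add_cancel m 1) (mappingCone.liftCocycle κ (-z) w hm (by simp [hw]))
  refine ⟨l, v.comp (mappingCone.fst κ).1 (sub_add_cancel m 1), ?_⟩
  rw [δ_comp _ _ (sub_add_cancel m 1) m 2 _ hm (sub_add_cancel m 1) rfl, hv, Cocycle.δ_eq_zero,
    Cochain.comp_zero, zero_add, Cochain.comp_assoc_of_second_is_zero_cochain,
    mappingConeAction_fst, ← Cochain.comp_assoc_of_third_is_zero_cochain]
  simp

end IsTorsionHom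

end TorsionCone

/-! ### Coboundaries -/

section Coboundary

open CochainComplex CochainComplex.HomComplex

variable {C : Type*} [Category* C] [Preadditive C]
variable {D : Type*} [Category* D] [Preadditive D]
variable {K L M : CochainComplex C ℤ} {n : ℤ}

/-- A cochain is a coboundary. -/
def IsCoboundary (x : Cochain K L n) : Prop := ∃ w : Cochain K L (n - 1), δ (n - 1) n w = x

namespace IsCoboundary

lemma of_δ {m : ℤ} (hm : m + 1 = n) {x : Cochain K L n} (w : Cochain K L m) (h : δ m n w = x) :
    IsCoboundary x := by
  obtain rfl : m = n - 1 := by lia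
  exact ⟨w, h⟩

lemma exists_δ {m : ℤ} (hm : m + 1 = n) {x : Cochain K L n} (h : IsCoboundary x) :
    ∃ w : Cochain K L m, δ m n w = x := by
  obtain rfl : m = n - 1 := by lia
  exact h

lemma add {x y : Cochain K L n} (hx : IsCoboundary x) (hy : IsCoboundary y) :
    IsCoboundary (x + y) := by
  obtain ⟨w, rfl⟩ := hx
  obtain ⟨w', rfl⟩ := hy
  exact ⟨w + w', δ_add _ _ _ _⟩

lemma neg {x : Cochain K L n} (hx : IsCoboundary x) : IsCoboundary (-x) := by
  obtain ⟨w, rfl⟩ := hx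
  exact ⟨-w, δ_neg _ _ _⟩

lemma sub_comm {x y : Cochain K L n} (h : IsCoboundary (x - y)) : IsCoboundary (y - x) := by
  rw [← neg_sub]
  exact h.neg

lemma sub_trans {x y z : Cochain K L n} (h : IsCoboundary (x - y)) (h' : IsCoboundary (y - z)) :
    IsCoboundary (x - z) := by
  rw [← sub_add_sub_cancel x y z]
  exact h.add h'

lemma of_sub {x y : Cochain K L n} (h : IsCoboundary (x - y)) (hy : IsCoboundary y) :
    IsCoboundary x := by
  rw [← sub_add_cancel x y]
  exact h.add hy

lemma comp_ofHom {x : Cochain K L n} (h : IsCoboundary x) (f : L ⟶ M) :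
    IsCoboundary (x.comp (Cochain.ofHom f) (add_zero n)) := by
  obtain ⟨w, rfl⟩ := h
  exact ⟨w.comp (Cochain.ofHom f) (add_zero _), δ_comp_ofHom _ _ _⟩

lemma ofHom_comp {x : Cochain L M n} (h : IsCoboundary x) (f : K ⟶ L) :
    IsCoboundary ((Cochain.ofHom f).comp x (zero_add n)) := by
  obtain ⟨w, rfl⟩ := h
  exact ⟨(Cochain.ofHom f).comp w (zero_add _), δ_ofHom_comp _ _ _⟩

lemma map {x : Cochain K L n} (h : IsCoboundary x) (Φ : C ⥤ D) [Φ.Additive] :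
    IsCoboundary (x.map Φ) := by
  obtain ⟨w, rfl⟩ := h
  exact ⟨w.map Φ, δ_map _ _ _ _⟩

lemma of_homotopy {f g : K ⟶ L} (h : Homotopy f g) :
    IsCoboundary (Cochain.ofHom f - Cochain.ofHom g) := by
  obtain ⟨w, hw⟩ := Cochain.equivHomotopy _ _ h
  exact of_δ (neg_add_cancel 1) w (by rw [hw, add_sub_cancel_right])

/-- It matters that `z` is a cocycle: otherwise the differential of `z` composed with the homotopy
has a further term. -/
lemma of_homotopy_comp_left {f g : L ⟶ M} (h : Homotopy f g) (z : Cocycle K L n) :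
    IsCoboundary (z.1.comp (Cochain.ofHom f) (add_zero n) -
      z.1.comp (Cochain.ofHom g) (add_zero n)) := by
  obtain ⟨w, hw⟩ := Cochain.equivHomotopy _ _ h
  refine of_δ (by lia) (z.1.comp w (rfl : n + (-1) = n + -1)) ?_
  rw [δ_comp z.1 w rfl (n + 1) 0 n (by lia) rfl (by lia), Cocycle.δ_eq_zero, Cochain.zero_comp,
    smul_zero, add_zero, hw, Cochain.comp_add, add_sub_cancel_right]

lemma homotopy {f g : K ⟶ L} (h : IsCoboundary (Cochain.ofHom f - Cochain.ofHom g)) :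
    Nonempty (Homotopy f g) := by
  obtain ⟨w, hw⟩ := h.exists_δ (neg_add_cancel 1)
  exact ⟨(Cochain.equivHomotopy f g).symm ⟨w, by rw [hw, sub_add_cancel]⟩⟩

lemma of_quasiIso {C : Type*} [Category* C] [Abelian C] {K K' L : CochainComplex C ℤ}
    [L.IsKInjective] (v : K ⟶ K') [QuasiIso v] {n : ℤ} (z : Cocycle K' L n)
    (h : IsCoboundary ((Cochain.ofHom v).comp z.1 (zero_add n))) : IsCoboundary z.1 := by
  obtain ⟨w, hw⟩ := h
  exact exists_δ_eq_of_quasiIso v (sub_add_cancel n 1) z w hw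

end IsCoboundary

end Coboundary

/-! ### Injective resolutions and their uniqueness -/

section Resolutions

open CochainComplex CochainComplex.HomComplex

variable {E : Type u} [Ring E]

namespace IsInjectiveResolution

variable {M I : CochainComplex (ModuleCat.{u} E) ℤ} {ι : M ⟶ I}

lemma exists_isStrictlyGE (h : IsInjectiveResolution ι) : ∃ a : ℤ, I.IsStrictlyGE a := by
  obtain ⟨a, ha⟩ := h.boundedBelow
  exact ⟨a, (isStrictlyGE_iff _ _).2 fun q hq => ha q hq⟩

lemma isKInjective (h : IsInjectiveResolution ι) : I.IsKInjective := by
  obtain ⟨a, ha⟩ := h.exists_isStrictlyGE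
  have := h.injective
  exact isKInjective_of_injective I a

end IsInjectiveResolution

/-- The complex is only cohomologically bounded below, so it is first replaced by its truncation, to
which it maps by a quasi-isomorphism. -/
lemma exists_isInjectiveResolution (M : CochainComplex (ModuleCat.{u} E) ℤ) (a : ℤ)
    (ha : ∀ q < a, Limits.IsZero (M.homology q)) :
    ∃ (I : CochainComplex (ModuleCat.{u} E) ℤ) (ι : M ⟶ I), IsInjectiveResolution ι := by
  have hM : M.IsGE a := by
    rw [isGE_iff]
    intro q hq
    exact (HomologicalComplex.exactAt_iff_isZero_homology _ _).2 (ha q hq)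
  obtain ⟨I, i, hi, hI, hI'⟩ :=
    CochainComplex.Plus.modelCategoryQuillen.exists_quasiIso_injective (M.truncGE a) a
  exact ⟨I, M.πTruncGE a ≫ i, inferInstance, hI, a, fun q hq => I.isZero_of_isStrictlyGE a q hq⟩

/-- Two injective resolutions are homotopy equivalent. -/
lemma exists_homotopyEquiv_of_isInjectiveResolution {M I J : CochainComplex (ModuleCat.{u} E) ℤ}
    {ι : M ⟶ I} {ι' : M ⟶ J} (h : IsInjectiveResolution ι) (h' : IsInjectiveResolution ι') :
    ∃ (κ : I ⟶ J) (κ' : J ⟶ I), Nonempty (Homotopy (ι ≫ κ) ι') ∧ Nonempty (Homotopy (ι' ≫ κ') ι) ∧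
      Nonempty (Homotopy (κ ≫ κ') (𝟙 I)) ∧ Nonempty (Homotopy (κ' ≫ κ) (𝟙 J)) := by
  have := h.isKInjective
  have := h'.isKInjective
  have := h.quasiIso
  have := h'.quasiIso
  obtain ⟨κ, ⟨hκ⟩⟩ := exists_lift_of_quasiIso ι ι'
  obtain ⟨κ', ⟨hκ'⟩⟩ := exists_lift_of_quasiIso ι' ι
  -- Stated for two arbitrary targets in order to be applied in both directions: `κ ≫ κ' - 𝟙` is
  -- null-homotopic after composition with the quasi-isomorphism `ι`, hence is so itself because `I`
  -- is K-injective.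
  have key : ∀ {I J : CochainComplex (ModuleCat.{u} E) ℤ} [I.IsKInjective] (ι : M ⟶ I) (ι' : M ⟶ J)
      [QuasiIso ι] (κ : I ⟶ J) (κ' : J ⟶ I), Homotopy (ι ≫ κ) ι' → Homotopy (ι' ≫ κ') ι →
      Nonempty (Homotopy (κ ≫ κ') (𝟙 I)) := by
    intro I J _ ι ι' _ κ κ' hκ hκ'
    apply IsCoboundary.homotopy
    rw [← Cochain.ofHom_sub]
    refine IsCoboundary.of_quasiIso ι (Cocycle.ofHom (κ ≫ κ' - 𝟙 I)) ?_
    rw [Cocycle.ofHom_coe, ← Cochain.ofHom_comp, Preadditive.comp_sub, Cochain.ofHom_sub,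
      Category.comp_id]
    exact IsCoboundary.of_homotopy (((Homotopy.ofEq (Category.assoc _ _ _).symm).trans
      (hκ.compRight κ')).trans hκ')
  exact ⟨κ, κ', ⟨hκ⟩, ⟨hκ'⟩, key ι ι' κ κ' hκ hκ', key ι' ι κ' κ hκ' hκ⟩

end Resolutions

/-! ### Homothety morphisms in terms of cocycles -/

section AbelianGroups

variable (K : CochainComplex AddCommGrpCat.{u} ℤ)

lemma addCommGrp_exists_iCycles_eq {q r : ℤ} (hr : q + 1 = r) (x : K.X q)
    (hx : (K.d q r).hom x = 0) : ∃ c : K.cycles q, (K.iCycles q).hom c = x :=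
  (ShortComplex.ab_exact_iff _).1 (ShortComplex.exact_of_f_is_kernel
    (ShortComplex.mk (K.iCycles q) (K.d q r) (K.iCycles_d q r))
    (K.cyclesIsKernel q r (by simp [hr]))) x hx

lemma addCommGrp_d_iCycles (q r : ℤ) (c : K.cycles q) :
    (K.d q r).hom ((K.iCycles q).hom c) = 0 :=
  congrArg (fun f => f.hom c) (K.iCycles_d q r)

lemma addCommGrp_iCycles_injective (q : ℤ) : Function.Injective (K.iCycles q).hom :=
  (AddCommGrpCat.mono_iff_injective _).1 inferInstance

lemma addCommGrp_homologyπ_surjective (q : ℤ) : Function.Surjective (K.homologyπ q).hom :=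
  (AddCommGrpCat.epi_iff_surjective _).1 inferInstance

lemma addCommGrp_homologyπ_eq_zero_iff {p q : ℤ} (hp : p + 1 = q) (c : K.cycles q) :
    (K.homologyπ q).hom c = 0 ↔ ∃ w : K.X p, (K.d p q).hom w = (K.iCycles q).hom c := by
  have hi : ∀ w, (K.d p q).hom w = (K.iCycles q).hom ((K.toCycles p q).hom w) := fun w =>
    congrArg (fun f => f.hom w) (K.toCycles_i p q).symm
  constructor
  · intro hc
    obtain ⟨w, hw⟩ := (ShortComplex.ab_exact_iff _).1 (ShortComplex.exact_of_g_is_cokernel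
      (ShortComplex.mk (K.toCycles p q) (K.homologyπ q) (by simp))
      (K.homologyIsCokernel p q (by simp [← hp]))) c hc
    exact ⟨w, (hi w).trans (congrArg _ hw)⟩
  · rintro ⟨w, hw⟩
    rw [hi] at hw
    rw [← addCommGrp_iCycles_injective K q hw]
    exact congrArg (fun f => f.hom w) (show K.toCycles p q ≫ K.homologyπ q = 0 by simp)

lemma addCommGrp_exactAt_iff {p q r : ℤ} (hp : p + 1 = q) (hr : q + 1 = r) :
    K.ExactAt q ↔ ∀ x : K.X q, (K.d q r).hom x = 0 → ∃ w : K.X p, (K.d p q).hom w = x := by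
  rw [K.exactAt_iff' p q r (by simp [← hp]) (by simp [← hr]), ShortComplex.ab_exact_iff]
  rfl

/-- Translates the quasi-isomorphism in the definition of the homothety condition into statements on
cocycles: exactness outside degree zero, and surjectivity and injectivity in degree zero. -/
lemma quasiIso_mkHomFromSingle_iff {X : AddCommGrpCat.{u}} (φ : X ⟶ K.X 0)
    (hφ : ∀ k : ℤ, (ComplexShape.up ℤ).Rel 0 k → φ ≫ K.d 0 k = 0) :
    QuasiIso (HomologicalComplex.mkHomFromSingle φ hφ) ↔
      (∀ n ≠ 0, ∀ x : K.X n, (K.d n (n + 1)).hom x = 0 → ∃ w, (K.d (n - 1) n).hom w = x) ∧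
      (∀ x : K.X 0, (K.d 0 1).hom x = 0 → ∃ f w, (K.d (-1) 0).hom w = x - φ.hom f) ∧
      (∀ f w, (K.d (-1) 0).hom w = φ.hom f → f = 0) := by
  set P := (HomologicalComplex.single AddCommGrpCat.{u} (ComplexShape.up ℤ) 0).obj X
  set ψ : P ⟶ K := HomologicalComplex.mkHomFromSingle φ hφ
  let e : P.X 0 ≅ X := HomologicalComplex.singleObjXSelf (.up ℤ) 0 X
  have hψ : ∀ f : X, (ψ.f 0).hom (e.inv.hom f) = φ.hom f := fun f => by
    have h : e.inv ≫ ψ.f 0 = φ := by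
      rw [show ψ.f 0 = e.hom ≫ φ from HomologicalComplex.mkHomFromSingle_f φ hφ]
      exact e.inv_hom_id_assoc φ
    exact congrArg (fun k => k.hom f) h
  have hd : ∀ p q : ℤ, P.d p q = 0 := fun p q => rfl
  have he : ∀ x : P.X 0, e.inv.hom (e.hom.hom x) = x := fun x =>
    congrArg (fun k => k.hom x) e.hom_inv_id
  have he' : ∀ x : X, e.hom.hom (e.inv.hom x) = x := fun x =>
    congrArg (fun k => k.hom x) e.inv_hom_id
  have hc : ∀ f : X, ∃ c : P.cycles 0, (P.iCycles 0).hom c = e.inv.hom f := fun f =>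
    addCommGrp_exists_iCycles_eq P (zero_add 1) _ (by rw [hd]; rfl)
  have hh : ∀ c : P.cycles 0, (HomologicalComplex.homologyMap ψ 0).hom ((P.homologyπ 0).hom c) =
      (K.homologyπ 0).hom ((HomologicalComplex.cyclesMap ψ 0).hom c) := fun c =>
    congrArg (fun f => f.hom c) (HomologicalComplex.homologyπ_naturality ψ 0)
  have hi : ∀ c : P.cycles 0, (K.iCycles 0).hom ((HomologicalComplex.cyclesMap ψ 0).hom c) =
      (ψ.f 0).hom ((P.iCycles 0).hom c) := fun c =>
    congrArg (fun f => f.hom c) (HomologicalComplex.cyclesMap_i ψ 0)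
  have h0 : QuasiIsoAt ψ 0 ↔
      (∀ x : K.X 0, (K.d 0 1).hom x = 0 → ∃ f w, (K.d (-1) 0).hom w = x - φ.hom f) ∧
      (∀ f w, (K.d (-1) 0).hom w = φ.hom f → f = 0) := by
    rw [quasiIsoAt_iff_isIso_homologyMap, ConcreteCategory.isIso_iff_bijective]
    constructor
    · rintro ⟨h₁, h₂⟩
      constructor
      · intro x hx
        obtain ⟨c, rfl⟩ := addCommGrp_exists_iCycles_eq K (zero_add 1) x hx
        obtain ⟨y, hy⟩ := h₂ ((K.homologyπ 0).hom c)
        obtain ⟨b, rfl⟩ := addCommGrp_homologyπ_surjective P 0 y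
        have hy' : (K.homologyπ 0).hom (c - (HomologicalComplex.cyclesMap ψ 0).hom b) = 0 := by
          rw [map_sub, ← hh, sub_eq_zero]
          exact hy.symm
        obtain ⟨w, hw⟩ := (addCommGrp_homologyπ_eq_zero_iff K (neg_add_cancel 1) _).1 hy'
        refine ⟨e.hom.hom ((P.iCycles 0).hom b), w, ?_⟩
        rw [hw, map_sub, hi, ← hψ, he]
      · intro f w hw
        obtain ⟨c, hc⟩ := hc f
        have h : (P.homologyπ 0).hom c = 0 := h₁ (by
          refine (hh c).trans (Eq.trans ?_ (map_zero _).symm)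
          rw [addCommGrp_homologyπ_eq_zero_iff K (neg_add_cancel 1), hi, hc, hψ]
          exact ⟨w, hw⟩)
        obtain ⟨w', hw'⟩ := (addCommGrp_homologyπ_eq_zero_iff P (neg_add_cancel 1) _).1 h
        rw [hd, hc] at hw'
        have h' : e.inv.hom f = 0 := hw'.symm
        rw [← he' f, h', map_zero]
    · rintro ⟨h₁, h₂⟩
      constructor
      · refine (injective_iff_map_eq_zero (HomologicalComplex.homologyMap ψ 0).hom).2 fun y hy => ?_
        obtain ⟨b, rfl⟩ := addCommGrp_homologyπ_surjective P 0 y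
        rw [hh, addCommGrp_homologyπ_eq_zero_iff K (neg_add_cancel 1), hi,
          ← he ((P.iCycles 0).hom b), hψ] at hy
        obtain ⟨w, hw⟩ := hy
        have h := h₂ _ w hw
        have h' : (P.iCycles 0).hom b = 0 := by rw [← he ((P.iCycles 0).hom b), h, map_zero]
        rw [addCommGrp_iCycles_injective P 0 (h'.trans (map_zero _).symm), map_zero]
      · intro y
        obtain ⟨c, rfl⟩ := addCommGrp_homologyπ_surjective K 0 y
        obtain ⟨f, w, hw⟩ := h₁ _ (addCommGrp_d_iCycles K 0 1 c)
        obtain ⟨b, hb⟩ := hc f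
        refine ⟨(P.homologyπ 0).hom b, (hh b).trans ?_⟩
        rw [eq_comm, ← sub_eq_zero, ← map_sub,
          addCommGrp_homologyπ_eq_zero_iff K (neg_add_cancel 1), map_sub, hi, hb, hψ]
        exact ⟨w, hw⟩
  rw [← h0, quasiIso_iff]
  have hn : ∀ n ≠ 0, QuasiIsoAt ψ n ↔
      ∀ x : K.X n, (K.d n (n + 1)).hom x = 0 → ∃ w, (K.d (n - 1) n).hom w = x := fun n hn => by
    rw [← addCommGrp_exactAt_iff K (sub_add_cancel n 1) rfl]
    exact quasiIsoAt_iff_exactAt _ _ (HomologicalComplex.exactAt_single_obj _ _ _ _ hn)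
  constructor
  · intro h
    exact ⟨fun n hn' => (hn n hn').1 (h n), h 0⟩
  · rintro ⟨h₁, h₂⟩ n
    by_cases hn' : n = 0
    · subst hn'
      exact h₂
    · exact (hn n hn').2 (h₁ n hn')

end AbelianGroups

/-! ### The homothety condition and its independence of the resolution -/

section Homothety

open CochainComplex CochainComplex.HomComplex

variable {E F G : Type u} [Ring E] [Ring F] [Ring G]

/-- For a complex `X` of `E`-modules with an action of `F` and a morphism `ι : X ⟶ J`, with `J` a
K-injective resolution of `X`, this says that `F ⟶ RHom_E(X, X)` is an isomorphism. -/
structure IsHomothetyIso {X J : CochainComplex (ModuleCat.{u} E) ℤ} (ρ : F →+* End X)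
    (ι : X ⟶ J) : Prop where
  isCoboundary : ∀ n ≠ 0, ∀ z : Cocycle X J n, IsCoboundary z.1
  exists_isCoboundary_sub : ∀ z : Cocycle X J 0, ∃ f, IsCoboundary (z.1 - Cochain.ofHom (ρ f ≫ ι))
  eq_zero : ∀ f, IsCoboundary (Cochain.ofHom (ρ f ≫ ι)) → f = 0

lemma IsHomothetyIso.of_homotopyEquiv {X J J' : CochainComplex (ModuleCat.{u} E) ℤ}
    {ρ : F →+* End X} {ι : X ⟶ J} {ι' : X ⟶ J'} (h : IsHomothetyIso ρ ι) (κ : J ⟶ J') (κ' : J' ⟶ J)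
    (h₁ : Homotopy (ι ≫ κ) ι') (h₂ : Homotopy (ι' ≫ κ') ι) (h₃ : Homotopy (κ' ≫ κ) (𝟙 J')) :
    IsHomothetyIso ρ ι' := by
  have key : ∀ {n : ℤ} (z : Cocycle X J' n), IsCoboundary
      ((z.postcomp κ').1.comp (Cochain.ofHom κ) (add_zero n) - z.1) := fun {n} z => by
    have h := IsCoboundary.of_homotopy_comp_left h₃ z
    rwa [Cochain.comp_id, Cochain.ofHom_comp, ← Cochain.comp_assoc_of_third_is_zero_cochain] at h
  refine ⟨fun n hn z => ?_, fun z => ?_, fun f hf => ?_⟩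
  · exact (key z).sub_comm.of_sub ((h.isCoboundary n hn (z.postcomp κ')).comp_ofHom κ)
  · obtain ⟨f, hf⟩ := h.exists_isCoboundary_sub (z.postcomp κ')
    refine ⟨f, (key z).sub_comm.sub_trans ?_⟩
    have h₄ := hf.comp_ofHom κ
    rw [Cochain.sub_comp, ← Cochain.ofHom_comp] at h₄
    refine h₄.sub_trans ?_
    rw [Category.assoc]
    exact IsCoboundary.of_homotopy (h₁.compLeft (ρ f))
  · refine h.eq_zero f ?_
    have h₄ := hf.comp_ofHom κ'
    rw [← Cochain.ofHom_comp, Category.assoc] at h₄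
    exact (IsCoboundary.of_homotopy (h₂.compLeft (ρ f))).sub_comm.of_sub h₄

variable (i : E →+* G) (j : F →+* G) (h : ∀ e f, Commute (i e) (j f))

/-- `commActComplex` as a ring homomorphism. -/
def commActHom (M : CochainComplex (ModuleCat.{u} G) ℤ) : F →+* End (restrict i M) where
  toFun f := commActComplex i j h f M
  map_one' := by
    refine HomologicalComplex.hom_ext _ _ fun q => ?_
    ext m
    exact (congrArg (· • (show M.X q from m)) (map_one j)).trans (one_smul G (show M.X q from m))
  map_mul' f f' := by
    refine HomologicalComplex.hom_ext _ _ fun q => ?_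
    ext m
    exact (congrArg (· • (show M.X q from m)) (map_mul j f f')).trans
      (mul_smul (j f) (j f') (show M.X q from m))
  map_zero' := by
    refine HomologicalComplex.hom_ext _ _ fun q => ?_
    ext m
    exact (congrArg (· • (show M.X q from m)) (map_zero j)).trans (zero_smul G (show M.X q from m))
  map_add' f f' := by
    refine HomologicalComplex.hom_ext _ _ fun q => ?_
    ext m
    exact (congrArg (· • (show M.X q from m)) (map_add j f f')).trans
      (add_smul (j f) (j f') (show M.X q from m))

/-- Restriction of scalars on morphisms of complexes. -/
abbrev restrictMap {M N : CochainComplex (ModuleCat.{u} G) ℤ} (f : M ⟶ N) :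
    restrict i M ⟶ restrict i N :=
  ((ModuleCat.restrictScalars.{u} i).mapHomologicalComplex (ComplexShape.up ℤ)).map f

lemma commActHom_naturality {M N : CochainComplex (ModuleCat.{u} G) ℤ} (g : M ⟶ N) (f : F) :
    commActHom i j h M f ≫ restrictMap i g = restrictMap i g ≫ commActHom i j h N f :=
  ((NatTrans.mapHomologicalComplex (commAct i j h f) (ComplexShape.up ℤ)).naturality g).symm

lemma quasiIso_homothety_iff {M I : CochainComplex (ModuleCat.{u} G) ℤ} (ι : M ⟶ I) :
    QuasiIso (homothety i j h ι) ↔ IsHomothetyIso (commActHom i j h M) (restrictMap i ι) := by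
  refine (quasiIso_mkHomFromSingle_iff _ _ _).trans ?_
  constructor
  · rintro ⟨h₁, h₂, h₃⟩
    refine ⟨fun n hn z => h₁ n hn z.1 (z.δ_eq_zero (n + 1)), fun z => ?_, fun f hf => ?_⟩
    · obtain ⟨f, w, hw⟩ := h₂ z.1 (z.δ_eq_zero 1)
      exact ⟨f, IsCoboundary.of_δ (neg_add_cancel 1) w hw⟩
    · obtain ⟨w, hw⟩ := hf.exists_δ (neg_add_cancel 1)
      exact h₃ f w hw
  · intro h₁
    refine ⟨fun n hn x hx => h₁.isCoboundary n hn (Cocycle.mk x (n + 1) rfl hx), fun x hx => ?_,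
      fun f w hw => h₁.eq_zero f (IsCoboundary.of_δ (neg_add_cancel 1) w hw)⟩
    obtain ⟨f, hf⟩ := h₁.exists_isCoboundary_sub (Cocycle.mk x 1 rfl hx)
    obtain ⟨w, hw⟩ := hf.exists_δ (neg_add_cancel 1)
    exact ⟨f, w, hw⟩

/-- The definition asserts the existence of one good resolution; uniqueness up to homotopy makes
every resolution good. -/
lemma homothetyIsIso_iff {M I : CochainComplex (ModuleCat.{u} G) ℤ} {ι : M ⟶ I}
    (hι : IsInjectiveResolution ι) :
    HomothetyIsIso i j h M ↔ IsHomothetyIso (commActHom i j h M) (restrictMap i ι) := by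
  constructor
  · rintro ⟨J, ι', hι', h'⟩
    rw [quasiIso_homothety_iff] at h'
    obtain ⟨κ, κ', ⟨h₁⟩, ⟨h₂⟩, -, ⟨h₃⟩⟩ := exists_homotopyEquiv_of_isInjectiveResolution hι' hι
    refine h'.of_homotopyEquiv (restrictMap i κ) (restrictMap i κ') ?_ ?_ ?_
    · exact (Homotopy.ofEq (Functor.map_comp _ _ _).symm).trans (Functor.mapHomotopy _ h₁)
    · exact (Homotopy.ofEq (Functor.map_comp _ _ _).symm).trans (Functor.mapHomotopy _ h₂)
    · exact ((Homotopy.ofEq (Functor.map_comp _ _ _).symm).trans (Functor.mapHomotopy _ h₃)).trans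
        (Homotopy.ofEq (CategoryTheory.Functor.map_id _ _))
  · exact fun h' => ⟨I, ι, hι, (quasiIso_homothety_iff i j h ι).2 h'⟩

end Homothety

/-! ### Derived adjunction between base change and restriction -/

section Adjunction

open CochainComplex CochainComplex.HomComplex

variable {E E' : Type u} [Ring E] [Ring E'] (φ : E →+* E')
variable {X : CochainComplex (ModuleCat.{u} E) ℤ} {X' Y : CochainComplex (ModuleCat.{u} E') ℤ}

/-- The morphism `E' ⊗_E X → X'` adjoint to `u : X → X'`. -/
def bcDesc (u : X ⟶ restrict φ X') : bcComplex φ X ⟶ X' :=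
  ((baseChange φ).mapHomologicalComplex (ComplexShape.up ℤ)).map u ≫ bcCounitComplex φ X'

variable {φ}

lemma bcUnitComplex_bcDesc (u : X ⟶ restrict φ X') :
    bcUnitComplex φ X ≫ restrictMap φ (bcDesc φ u) = u := by
  ext1 q
  ext m
  exact one_smul E' (show X'.X q from (u.f q).hom m)

/-- The adjoint of a bounding cochain: apply base change to it and compose with the counit, whose
naturality identifies the result with a bound over `E'`. -/
lemma IsCoboundary.bcDesc_comp (u : X ⟶ restrict φ X') {n : ℤ} (z : Cochain X' Y n)
    (h : IsCoboundary ((Cochain.ofHom u).comp (z.map (ModuleCat.restrictScalars.{u} φ))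
      (zero_add n))) : IsCoboundary ((Cochain.ofHom (bcDesc φ u)).comp z (zero_add n)) := by
  have h' := (h.map (baseChange φ)).comp_ofHom (bcCounitComplex φ Y)
  refine (congrArg IsCoboundary (Cochain.ext _ _ fun p q hpq => ?_)).mpr h'
  simp only [bcDesc, Cochain.map_comp, Cochain.map_ofHom, Cochain.ofHom_comp,
    Cochain.zero_cochain_comp_v, Cochain.comp_zero_cochain_v, Cochain.ofHom_v, Cochain.map_v,
    Category.assoc]
  exact congrArg (fun k => (baseChange φ).map (u.f p) ≫ k)
    ((bcAdj φ).counit.naturality (z.v p q hpq)).symm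

/-- A cocycle on `X'` is a coboundary if its composition with `u : X → X'` is, provided that
`E' ⊗_E X → X'` is a quasi-isomorphism. -/
lemma IsCoboundary.of_restrict [Y.IsKInjective] (u : X ⟶ restrict φ X') [QuasiIso (bcDesc φ u)]
    {n : ℤ} (z : Cocycle X' Y n)
    (h : IsCoboundary ((Cochain.ofHom u).comp (z.1.map (ModuleCat.restrictScalars.{u} φ))
      (zero_add n))) : IsCoboundary z.1 :=
  IsCoboundary.of_quasiIso (bcDesc φ u) z (IsCoboundary.bcDesc_comp u z.1 h)

lemma IsCentralLocalization.quasiIso_bcDesc {S : Submonoid (Subring.center E)}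
    (hφ : IsCentralLocalization S φ) (u : X ⟶ restrict φ X')
    (hu : ∀ q, IsTorsionIso S (HomologicalComplex.homologyMap u q).hom) :
    QuasiIso (bcDesc φ u) := by
  have := hφ.quasiIso_baseChange u hu
  have := hφ.isIso_bcCounitComplex X'
  rw [bcDesc]
  infer_instance

end Adjunction

/-! ### Localization of the homothety isomorphism -/

section HomothetyLocalization

open CochainComplex CochainComplex.HomComplex

variable {E E' F F' : Type u} [Ring E] [Ring E'] [Ring F] [Ring F'] {φ : E →+* E'} {χ : F →+* F'}
variable {X J : CochainComplex (ModuleCat.{u} E) ℤ} {X' J' : CochainComplex (ModuleCat.{u} E') ℤ}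

/-- Homothety isomorphisms are inherited by localizations. -/
lemma IsHomothetyIso.of_isTorsionHom [IsNoetherianRing E] {T : Submonoid (Subring.center F)}
    (hχ : IsCentralLocalization T χ)
    {ρ : F →+* End X} {ι : X ⟶ J} (h : IsHomothetyIso ρ ι) {ρ' : F' →+* End X'} {ι' : X' ⟶ J'}
    {ρJ : F →+* End J} {ρJ' : F' →+* End J'} (hι : ∀ f, ρ f ≫ ι = ι ≫ ρJ f)
    (hι' : ∀ f, ρ' f ≫ ι' = ι' ≫ ρJ' f)
    {u : X ⟶ restrict φ X'} (hu : ∀ f, ρ f ≫ u = u ≫ restrictMap φ (ρ' (χ f)))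
    [QuasiIso (bcDesc φ u)] {κ : J ⟶ restrict φ J'} (hκ : Homotopy (ι ≫ κ) (u ≫ restrictMap φ ι'))
    {τ : T →* End J} {τ' : T →* End (restrict φ J')}
    (hτ : ∀ t, τ t = ρJ t) (hτ' : ∀ t, τ' t = restrictMap φ (ρJ' (χ t)))
    (htors : IsTorsionHom κ τ τ') (a : ℤ) [J.IsStrictlyGE a] [J'.IsStrictlyGE a]
    (hJ : ∀ q, Injective (J.X q)) (hJ' : ∀ q, Injective (J'.X q))
    (hJ'r : ∀ q, Injective ((restrict φ J').X q)) (c : ℤ) [X.IsLE c]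
    (hX : ∀ q, IsNoetherian E (X.homology q)) : IsHomothetyIso ρ' ι' := by
  have := isKInjective_of_injective J' a
  have : (restrict φ J').IsStrictlyGE a := by
    rw [isStrictlyGE_iff]
    exact fun q hq => (ModuleCat.restrictScalars.{u} φ).map_isZero
      (J'.isZero_of_isStrictlyGE a q hq)
  have hinv : ∀ t : T, ∃ s : F', s * χ t = 1 ∧ χ t * s = 1 := fun t => by
    obtain ⟨s, hs⟩ := hχ.isUnit t t.2
    exact ⟨(s⁻¹ : F'ˣ), by rw [← hs, Units.inv_mul], by rw [← hs, Units.mul_inv]⟩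
  -- The adjunction map `Hom_{E'}(X', J') → Hom_E(X, J')`. It detects coboundaries because `bcDesc φ
  -- u` is a quasi-isomorphism.
  let r (n : ℤ) (z : Cocycle X' J' n) : Cocycle X (restrict φ J') n :=
    Cocycle.mk ((Cochain.ofHom u).comp (z.1.map (ModuleCat.restrictScalars.{u} φ)) (zero_add n))
      (n + 1) rfl (by rw [δ_ofHom_comp, δ_map, Cocycle.δ_eq_zero, Cochain.map_zero,
        Cochain.comp_zero])
  have hr : ∀ (n : ℤ) (z : Cocycle X' J' n) (t : T), (r n z).1.comp (Cochain.ofHom (τ' t))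
      (add_zero n) = (r n (z.postcomp (ρJ' (χ t)))).1 := fun n z t => by
    simp only [r, hτ', Cocycle.mk_coe, Cocycle.postcomp_coe, Cochain.map_comp, Cochain.map_ofHom]
    exact Cochain.comp_assoc_of_third_is_zero_cochain ..
  -- Elements of `T` become invertible in `F'`, so a multiplication by `χ t` can be undone on
  -- cocycles over `E'`. Multiplication in `End` reverses the order of `≫`.
  have hcancel : ∀ (n : ℤ) (z : Cocycle X' J' n) (t : T) (s : F'), s * χ t = 1 →
      ((z.postcomp (ρJ' (χ t))).1.comp (Cochain.ofHom (ρJ' s)) (add_zero n)) = z.1 :=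
    fun n z t s hs => by
      rw [Cocycle.postcomp_coe, Cochain.comp_assoc_of_third_is_zero_cochain, ← Cochain.ofHom_comp,
        show ρJ' (χ t) ≫ ρJ' s = ρJ' (s * χ t) from (map_mul ρJ' _ _).symm, hs, map_one]
      exact Cochain.comp_id _
  have hιu : ∀ f : F, ρ f ≫ u ≫ restrictMap φ ι' = u ≫ restrictMap φ (ρ' (χ f) ≫ ι') := fun f => by
    rw [← Category.assoc, hu, Category.assoc, restrictMap, restrictMap, restrictMap,
      ← Functor.map_comp]
  refine ⟨fun n hn z => ?_, fun z => ?_, fun f hf => ?_⟩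
  -- In nonzero degree, a multiple of `z` comes from a cocycle with values in `J`, which bounds by
  -- hypothesis; the multiplier is then divided out.
  · obtain ⟨t, g, w, hw⟩ := htors.exists_cocycle a hJ hJ'r c hX (sub_add_cancel n 1) (r n z)
    have h₁ : IsCoboundary ((r n z).1.comp (Cochain.ofHom (τ' t)) (add_zero n)) :=
      IsCoboundary.of_sub ⟨w, hw⟩ ((h.isCoboundary n hn g).comp_ofHom κ)
    rw [hr] at h₁
    have h₂ := IsCoboundary.of_restrict u _ h₁
    obtain ⟨s, hs, -⟩ := hinv t
    rw [← hcancel n z t s hs]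
    exact h₂.comp_ofHom _
  -- In degree zero, the multiple of `z` by `t` comes from a cocycle of `J`, hence from some `f` in
  -- `F`. Thus `z` is the class of `χ(t)⁻¹ χ(f)`.
  · obtain ⟨t, g, w, hw⟩ := htors.exists_cocycle a hJ hJ'r c hX (neg_add_cancel 1) (r 0 z)
    obtain ⟨f, hf⟩ := h.exists_isCoboundary_sub g
    obtain ⟨s, hs, hs'⟩ := hinv t
    have h₁ := IsCoboundary.sub_trans (IsCoboundary.of_δ (neg_add_cancel 1) w hw)
      (by simpa only [Cochain.sub_comp] using hf.comp_ofHom κ)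
    rw [← Cochain.ofHom_comp, Category.assoc] at h₁
    have h₂ := h₁.sub_trans (IsCoboundary.of_homotopy (hκ.compLeft (ρ f)))
    rw [hr, hιu] at h₂
    have h₃ : IsCoboundary (z.postcomp (ρJ' (χ t)) - Cocycle.ofHom (ρ' (χ f) ≫ ι')).1 := by
      refine IsCoboundary.of_restrict u _ ?_
      convert h₂ using 1
      simp only [r, Cocycle.mk_coe, Cocycle.coe_sub, Cocycle.ofHom_coe, Cochain.map_sub,
        Cochain.comp_sub, Cochain.map_ofHom, ← Cochain.ofHom_comp]
    have h₄ := h₃.comp_ofHom (ρJ' s)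
    rw [Cocycle.coe_sub, Cochain.sub_comp, hcancel 0 z t s hs, Cocycle.ofHom_coe,
      ← Cochain.ofHom_comp, Category.assoc, ← hι', ← Category.assoc,
      show ρ' (χ f) ≫ ρ' s = ρ' (s * χ f) from (map_mul ρ' _ _).symm] at h₄
    exact ⟨_, h₄⟩
  -- Injectivity: with `χ(t) f = χ(f₀)`, the action of `f₀` on `X` becomes a coboundary in `J'`. By
  -- torsion of the kernel, some `s f₀` is already a coboundary in `J`, so `s f₀ = 0` and then
  -- `χ(f₀) = 0`.
  · obtain ⟨t, ht, f₀, hf₀⟩ := hχ.surj f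
    have h₁ : IsCoboundary (Cochain.ofHom (ρ' (χ f₀) ≫ ι')) := by
      have h₂ := hf.comp_ofHom (ρJ' (χ t))
      rwa [← Cochain.ofHom_comp, Category.assoc, ← hι', ← Category.assoc,
        show ρ' f ≫ ρ' (χ t) = ρ' (χ t * f) from (map_mul ρ' _ _).symm, hf₀] at h₂
    have h₂ : IsCoboundary (Cochain.ofHom ((ρ f₀ ≫ ι) ≫ κ)) := by
      have h₃ := (h₁.map (ModuleCat.restrictScalars.{u} φ)).ofHom_comp u
      rw [Cochain.map_ofHom, ← Cochain.ofHom_comp] at h₃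
      have h₄ := IsCoboundary.of_homotopy (hκ.compLeft (ρ f₀))
      rw [hιu, ← Category.assoc] at h₄
      exact h₄.of_sub h₃
    obtain ⟨w, hw⟩ := h₂.exists_δ (neg_add_cancel 1)
    obtain ⟨s, w', hw'⟩ := htors.exists_δ_eq a hJ hJ'r c hX (neg_add_cancel 1)
      (Cocycle.ofHom (ρ f₀ ≫ ι)) w (by rw [hw, Cocycle.ofHom_coe, ← Cochain.ofHom_comp])
    rw [Cocycle.ofHom_coe, ← Cochain.ofHom_comp, hτ, Category.assoc, ← hι, ← Category.assoc,
      show ρ f₀ ≫ ρ (s : Subring.center F) = ρ ((s : Subring.center F) * f₀) from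
        (map_mul ρ _ _).symm] at hw'
    have h₃ := h.eq_zero _ (IsCoboundary.of_δ (neg_add_cancel 1) w' hw')
    obtain ⟨s', hs', -⟩ := hinv s
    obtain ⟨t', ht', -⟩ := hinv ⟨t, ht⟩
    have h₄ : χ f₀ = 0 := by
      rw [← one_mul (χ f₀), ← hs', mul_assoc, ← map_mul, h₃, map_zero, mul_zero]
    rw [← one_mul f, ← ht', mul_assoc]
    change _ * (χ t * f) = 0
    rw [hf₀, h₄, mul_zero]

end HomothetyLocalization

/-! ### Finiteness conditions and localization -/

section CentralLocalizationFiniteness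

open CochainComplex CochainComplex.HomComplex

variable {E F : Type u} [Ring E] [Ring F] {S : Submonoid (Subring.center E)} {φ : E →+* F}

lemma exists_forall_of_monotone {ι : Type*} [Finite ι] (P : ι → Subring.center E → Prop)
    (hP : ∀ i s r, P i s → P i (r * s)) (h : ∀ i, ∃ s ∈ S, P i s) : ∃ s ∈ S, ∀ i, P i s := by
  classical
  have := Fintype.ofFinite ι
  choose s hs hs' using h
  refine ⟨∏ i, s i, prod_mem fun i _ => hs i, fun i => ?_⟩
  rw [← Finset.prod_erase_mul _ _ (Finset.mem_univ i)]
  exact hP i _ _ (hs' i)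

/-- Over a noetherian ring, central localizations of injective modules are injective. -/
lemma IsCentralLocalization.injective_baseChange (hφ : IsCentralLocalization S φ)
    [IsNoetherianRing E] (I : ModuleCat.{u} E) [Injective I] : Injective ((baseChange φ).obj I) := by
  have hI : Module.Injective E I := Module.injective_module_of_injective_object E I
  suffices h : Module.Injective F (BaseChange φ I) from
    Module.injective_object_of_injective_module F (BaseChange φ I)
  -- Baer's criterion. The contraction of the left ideal `L'` to `E` is presented by finitely many
  -- generators and relations, and `f` is compared with a map to `I` after clearing finitely many
  -- denominators.
  refine Module.Baer.injective fun L' f => ?_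
  have hL : ∃ (k : ℕ) (π : (Fin k → E) →ₗ[E] E), ∀ e, φ e ∈ L' ↔ ∃ a, π a = e := by
    let L : Ideal E := L'.comap φ
    obtain ⟨k, π, hπ⟩ := (Submodule.fg_iff_exists_fin_linearMap (N := L)).1
      (IsNoetherian.noetherian L)
    refine ⟨k, π, fun e => ?_⟩
    change e ∈ L ↔ e ∈ LinearMap.range π
    rw [hπ]
  obtain ⟨k, π, hπ⟩ := hL
  let fπ : (Fin k → E) → BaseChange φ I := fun a => f ⟨φ (π a), (hπ _).2 ⟨a, rfl⟩⟩
  have fπ_add : ∀ a b, fπ (a + b) = fπ a + fπ b := fun a b => by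
    rw [← map_add]
    exact congrArg f (Subtype.ext (by simp))
  have fπ_smul : ∀ (e : E) a, fπ (e • a) = φ e • fπ a := fun e a => by
    rw [← map_smul]
    exact congrArg f (Subtype.ext (by simp))
  -- A common denominator `s` for the values of `f` on the `k` generators: `s f` is represented by a
  -- map `μ` on the free module.
  obtain ⟨s, hs, hm⟩ := exists_forall_of_monotone (S := S)
    (fun i s => ∃ m : I, φ s • fπ (Pi.single i 1) = bcMk φ 1 m)
    (fun i s r ⟨m, hm⟩ => ⟨(r : E) • m, by
      rw [Subring.coe_mul, map_mul, mul_smul, hm, bcMk_smul_one]⟩)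
    (fun i => hφ.exists_smul_eq_bcMk_one _)
  choose m hm using hm
  let μ : (Fin k → E) →ₗ[E] I := (Pi.basisFun E (Fin k)).constr ℕ m
  have hμ : ∀ a, φ s • fπ a = bcMk φ 1 (μ a) := by
    let l₁ : (Fin k → E) →ₗ[E] (ModuleCat.restrictScalars φ).obj ((baseChange φ).obj I) :=
      (bcUnit φ I).hom ∘ₗ μ
    let l₂ : (Fin k → E) →ₗ[E] (ModuleCat.restrictScalars φ).obj ((baseChange φ).obj I) :=
      { toFun := fun a => φ s • fπ a
        map_add' := fun a b => by
          rw [fπ_add, smul_add]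
          rfl
        map_smul' := fun e a => by
          change _ = φ e • (φ s • fπ a : BaseChange φ I)
          rw [fπ_smul, smul_smul, smul_smul, hφ.comm] }
    intro a
    refine LinearMap.congr_fun (f := l₂) (g := l₁) ((Pi.basisFun E (Fin k)).ext fun i => ?_) a
    rw [Pi.basisFun_apply]
    refine (hm i).trans ?_
    change bcMk φ 1 (m i) = bcMk φ 1 (μ (Pi.single i 1))
    rw [← Pi.basisFun_apply, Module.Basis.constr_basis]
  obtain ⟨l, ν, hν⟩ := (Submodule.fg_iff_exists_fin_linearMap (N := LinearMap.ker π)).1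
    (IsNoetherian.noetherian _)
  have hν0 : ∀ b, π (ν b) = 0 := fun b => by
    have h : ν b ∈ LinearMap.ker π := hν ▸ ⟨b, rfl⟩
    exact h
  -- The map `μ` kills the relations only up to torsion. Finitely many relations generate, so one
  -- `t` makes `μ' = t μ` descend to the ideal.
  obtain ⟨t, ht, ht'⟩ := exists_forall_of_monotone (S := S)
    (fun i t => (t : E) • μ (ν (Pi.single i 1)) = 0)
    (fun i t r h => by rw [Subring.coe_mul, mul_smul, h, smul_zero])
    (fun i => hφ.bcMk_one_eq_zero (by
      rw [← hμ]
      have h : fπ (ν (Pi.single i 1)) = f 0 := congrArg f (Subtype.ext (by simp [hν0]))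
      rw [h, map_zero, smul_zero]))
  let μ' : (Fin k → E) →ₗ[E] I := (Pi.basisFun E (Fin k)).constr ℕ (fun i => (t : E) • m i)
  have hμ' : ∀ a, μ' a = (t : E) • μ a := fun a => by
    simp only [μ', μ, Module.Basis.constr_apply_fintype, Finset.smul_sum]
    exact Finset.sum_congr rfl fun i _ => center_smul_comm t _ _
  have hker : LinearMap.ker π ≤ LinearMap.ker μ' := by
    rw [← hν]
    rintro _ ⟨b, rfl⟩
    refine LinearMap.congr_fun (f := μ' ∘ₗ ν) (g := 0) ((Pi.basisFun E (Fin l)).ext fun i => ?_) b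
    rw [Pi.basisFun_apply, LinearMap.comp_apply, hμ', ht' i]
    rfl
  -- Injectivity of `I` extends the descended map to all of `E`, where it is determined by `g 1`.
  obtain ⟨g, hg⟩ := hI.out ((LinearMap.ker π).liftQ π le_rfl)
    (LinearMap.ker_eq_bot.1 (Submodule.ker_liftQ_eq_bot _ _ _ le_rfl))
    ((LinearMap.ker π).liftQ μ' hker)
  have hg' : ∀ a, π a • g 1 = μ' a := fun a => by
    rw [← map_smul, smul_eq_mul, mul_one]
    exact hg (Submodule.Quotient.mk a)
  -- As `μ'` represents `t s f`, the element defining the extension of `f` has to be `(t s)⁻¹ (1 ⊗ g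
  -- 1)`.
  obtain ⟨w, hw⟩ : ∃ w : BaseChange φ I, φ (t * s) • w = bcMk φ 1 (g 1) := by
    obtain ⟨v, hv⟩ := hφ.isUnit _ (mul_mem ht hs)
    exact ⟨(v⁻¹ : Fˣ) • bcMk φ 1 (g 1), by
      rw [← Subring.coe_mul, ← hv]
      exact smul_inv_smul v (bcMk φ 1 (g 1))⟩
  refine ⟨LinearMap.toSpanSingleton F _ w, fun x hx => ?_⟩
  obtain ⟨r, hr, e, he⟩ := hφ.surj x
  obtain ⟨a, ha⟩ := (hπ e).1 (he ▸ L'.mul_mem_left _ hx)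
  have hinj : ∀ r ∈ S, ∀ y : BaseChange φ I, φ r • y = 0 → y = 0 := fun r hr y hy => by
    obtain ⟨v, hv⟩ := hφ.isUnit r hr
    rw [← hv] at hy
    exact (smul_eq_zero_iff_eq v).1 hy
  rw [LinearMap.toSpanSingleton_apply, ← sub_eq_zero]
  -- It suffices to compare after multiplication by `t`, `s` and the denominator `r` of `x`, where
  -- both sides come from `I`.
  refine hinj _ (mul_mem (mul_mem ht hs) hr) _ ?_
  rw [Subring.coe_mul, map_mul, mul_smul, smul_sub, smul_sub, smul_smul (φ (r : E)) x w, he,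
    ← map_smul f (φ (r : E)), smul_smul (φ _) (φ e) w, ← hφ.comm (t * s) (φ e), mul_smul,
    Subring.coe_mul, hw, bcMk_smul_one]
  have h : f (φ (r : E) • ⟨x, hx⟩) = fπ a := congrArg f (Subtype.ext (by simp [ha, he]))
  rw [h, map_mul, mul_smul, hμ, bcMk_smul_one, ← hμ', ← hg', ha, sub_self]

lemma IsCentralLocalization.map_baseChange_quasiIso (hφ : IsCentralLocalization S φ)
    {M N : CochainComplex (ModuleCat.{u} E) ℤ} (f : M ⟶ N) [QuasiIso f] :
    QuasiIso (((baseChange φ).mapHomologicalComplex (ComplexShape.up ℤ)).map f) :=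
  hφ.quasiIso_baseChange f fun q => IsTorsionIso.of_bijective _
    ((ConcreteCategory.isIso_iff_bijective (HomologicalComplex.homologyMap f q)).1 inferInstance)

/-- The localized resolution is a bounded complex of injectives receiving `F ⊗_E X`, which also maps
quasi-isomorphically to `X'`. Its K-injectivity extends the resolution along this second map up to
homotopy. -/
lemma IsCentralLocalization.hasFiniteInjectiveDimension (hφ : IsCentralLocalization S φ)
    [IsNoetherianRing E] {X : CochainComplex (ModuleCat.{u} E) ℤ}
    {X' : CochainComplex (ModuleCat.{u} F) ℤ} (h : HasFiniteInjectiveDimension X)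
    (u : X ⟶ restrict φ X') [QuasiIso (bcDesc φ u)] : HasFiniteInjectiveDimension X' := by
  obtain ⟨I, ι, hι, b, hb⟩ := h
  obtain ⟨a, ha⟩ := hι.boundedBelow
  have := hι.quasiIso
  have := hφ.map_baseChange_quasiIso ι
  have hI : ∀ q, Injective ((bcComplex φ I).X q) := fun q => by
    have := hι.injective q
    exact hφ.injective_baseChange (I.X q)
  have ha' : ∀ q < a, Limits.IsZero ((bcComplex φ I).X q) := fun q hq =>
    (baseChange φ).map_isZero (ha q hq)
  have : (bcComplex φ I).IsStrictlyGE a := (isStrictlyGE_iff _ _).2 fun q hq => ha' q hq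
  have := isKInjective_of_injective (bcComplex φ I) a
  obtain ⟨g, ⟨hg⟩⟩ := exists_lift_of_quasiIso (bcDesc φ u)
    (((baseChange φ).mapHomologicalComplex (ComplexShape.up ℤ)).map ι)
  have hg' : QuasiIso (bcDesc φ u ≫ g) := by
    rw [quasiIso_iff]
    intro q
    rw [quasiIsoAt_iff_isIso_homologyMap, hg.homologyMap_eq q]
    infer_instance
  exact ⟨bcComplex φ I, g, ⟨quasiIso_of_comp_left (bcDesc φ u) g, hI, a, ha'⟩, b, fun q hq =>
    (baseChange φ).map_isZero (hb q hq)⟩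

lemma IsTorsionIso.finite (hφ : IsCentralLocalization S φ) {M : ModuleCat.{u} E}
    [Module.Finite E M] {N : ModuleCat.{u} F} (f : M ⟶ (ModuleCat.restrictScalars φ).obj N)
    (hf : IsTorsionIso S f.hom) : Module.Finite F N := by
  obtain ⟨s, hs⟩ := Module.Finite.fg_top (R := E) (M := M)
  let g : M → N := fun m => f.hom m
  refine ⟨Submodule.fg_def.2 ⟨g '' s, s.finite_toSet.image _, ?_⟩⟩
  rw [eq_top_iff]
  intro n _
  obtain ⟨t, ht, m, hm⟩ := hf.coker n
  have hm' : g m ∈ Submodule.span F (g '' s) := by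
    clear hm
    have : m ∈ Submodule.span E (s : Set M) := hs ▸ Submodule.mem_top
    induction this using Submodule.span_induction with
    | mem x hx => exact Submodule.subset_span ⟨x, hx, rfl⟩
    | zero =>
      rw [show g 0 = 0 from f.hom.map_zero]
      exact zero_mem _
    | add x y _ _ hx hy =>
      rw [show g (x + y) = g x + g y from f.hom.map_add x y]
      exact add_mem hx hy
    | smul e x _ hx =>
      rw [show g (e • x) = φ e • g x from f.hom.map_smul e x]
      exact Submodule.smul_mem _ _ hx
  obtain ⟨v, hv⟩ := hφ.isUnit t ht
  have h : n = ((v⁻¹ : Fˣ) : F) • g m := by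
    rw [show g m = φ t • n from hm, ← hv, smul_smul, Units.inv_mul, one_smul]
  rw [h]
  exact Submodule.smul_mem _ _ hm'

lemma IsCentralLocalization.isNoetherianRing (hφ : IsCentralLocalization S φ)
    [IsNoetherianRing E] : IsNoetherianRing F := by
  refine ⟨fun (L : Ideal F) => ?_⟩
  let L₀ : Ideal E := L.comap φ
  obtain ⟨s, hs⟩ := IsNoetherian.noetherian L₀
  refine Submodule.fg_def.2 ⟨φ '' s, s.finite_toSet.image _, le_antisymm ?_ ?_⟩
  · rw [Submodule.span_le]
    rintro _ ⟨x, hx, rfl⟩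
    have : x ∈ L₀ := hs ▸ Submodule.subset_span hx
    exact this
  · intro x hx
    obtain ⟨t, ht, e, he⟩ := hφ.surj x
    have he' : e ∈ Submodule.span E (s : Set E) := by
      rw [hs]
      change φ e ∈ L
      rw [← he]
      exact L.mul_mem_left _ hx
    have : φ e ∈ Submodule.span F (φ '' (s : Set E)) := by
      clear he
      induction he' using Submodule.span_induction with
      | mem x hx => exact Submodule.subset_span ⟨x, hx, rfl⟩
      | zero => rw [map_zero]; exact zero_mem _
      | add x y _ _ hx hy => rw [map_add]; exact add_mem hx hy
      | smul a x _ hx => rw [smul_eq_mul, map_mul]; exact Submodule.smul_mem _ _ hx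
    obtain ⟨v, hv⟩ := hφ.isUnit t ht
    rw [show x = ((v⁻¹ : Fˣ) : F) • φ e by rw [← he, ← hv, smul_eq_mul, Units.inv_mul_cancel_left]]
    exact Submodule.smul_mem _ _ this

end CentralLocalizationFiniteness

/-! ### Morphisms which are null-homotopic after restriction of scalars -/

section Descent

open CochainComplex CochainComplex.HomComplex

/-- Part of the long exact sequence of `Hom(-, I)`: if all degree `n - 1` classes on the kernel
vanish, a degree `n` class on the quotient is detected on the middle term. -/
lemma IsCoboundary.of_shortExact {C : Type*} [Category* C] [Abelian C]
    {X L M I : CochainComplex C ℤ} (k : X ⟶ L) (p : L ⟶ M) (w : ∀ q, k.f q ≫ p.f q = 0)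
    (hS : ∀ q, (ShortComplex.mk (k.f q) (p.f q) (w q)).ShortExact) (hI : ∀ q, Injective (I.X q))
    {n : ℤ} (z : Cocycle M I n) (hz : IsCoboundary ((Cochain.ofHom p).comp z.1 (zero_add n)))
    (hX : ∀ z : Cocycle X I (n - 1), IsCoboundary z.1) : IsCoboundary z.1 := by
  have hmono : ∀ q, Mono (k.f q) := fun q => (hS q).mono_f
  have hepi : ∀ q, Epi (p.f q) := fun q => (hS q).epi_g
  have hkp : k ≫ p = 0 := HomologicalComplex.hom_ext _ _ w
  obtain ⟨h, hh⟩ := hz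
  obtain ⟨h', hh'⟩ := hX (Cocycle.mk ((Cochain.ofHom k).comp h (zero_add _)) n (by lia) (by
    rw [δ_ofHom_comp, hh, ← Cochain.comp_assoc_of_first_is_zero_cochain, ← Cochain.ofHom_comp, hkp,
      Cochain.ofHom_zero, Cochain.zero_comp]))
  rw [Cocycle.mk_coe] at hh'
  -- The bound on `X` extends degreewise to `L` by injectivity; subtracting its differential makes
  -- `h` vanish on `X`, so that it descends to `M`.
  obtain ⟨h'', rfl⟩ : ∃ h'' : Cochain L I (n - 1 - 1),
      (Cochain.ofHom k).comp h'' (zero_add _) = h' := by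
    refine ⟨Cochain.mk fun q r hqr => Injective.factorThru (h'.v q r hqr) (k.f q), ?_⟩
    ext q r hqr
    rw [Cochain.zero_cochain_comp_v, Cochain.ofHom_v, Cochain.mk_v, Injective.comp_factorThru]
  rw [δ_ofHom_comp] at hh'
  have hv : ∀ q r hqr, k.f q ≫ (h - δ (n - 1 - 1) (n - 1) h'').v q r hqr = 0 := fun q r hqr => by
    have := Cochain.congr_v hh' q r hqr
    rw [Cochain.zero_cochain_comp_v, Cochain.zero_cochain_comp_v, Cochain.ofHom_v] at this
    rw [Cochain.sub_v, Preadditive.comp_sub, this, sub_self]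
  let g : Cochain M I (n - 1) := Cochain.mk fun q r hqr =>
    have := hepi q
    (hS q).exact.desc ((h - δ (n - 1 - 1) (n - 1) h'').v q r hqr) (hv q r hqr)
  have hg : (Cochain.ofHom p).comp g (zero_add _) = h - δ (n - 1 - 1) (n - 1) h'' := by
    ext q r hqr
    have := hepi q
    rw [Cochain.zero_cochain_comp_v, Cochain.ofHom_v, Cochain.mk_v]
    exact (hS q).exact.g_desc _ _
  refine ⟨g, ?_⟩
  have h₁ := congrArg (δ (n - 1) n) hg
  rw [δ_ofHom_comp, δ_sub, hh, δ_δ, sub_zero] at h₁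
  ext q r hqr
  have h₂ := Cochain.congr_v h₁ q r hqr
  rwa [Cochain.zero_cochain_comp_v, Cochain.zero_cochain_comp_v, Cochain.ofHom_v, cancel_epi] at h₂

variable {E : Type u} [Ring E]

/-- This criterion mentions only elements and differentials, so it passes freely along restriction
of scalars and retractions. -/
lemma isLE_iff_forall (M : CochainComplex (ModuleCat.{u} E) ℤ) (b : ℤ) :
    M.IsLE b ↔ ∀ p q r : ℤ, p + 1 = q → q + 1 = r → b < q → ∀ x : M.X q, (M.d q r).hom x = 0 →
      ∃ w : M.X p, (M.d p q).hom w = x := by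
  have key : ∀ p q r : ℤ, p + 1 = q → q + 1 = r → (M.ExactAt q ↔
      ∀ x : M.X q, (M.d q r).hom x = 0 → ∃ w : M.X p, (M.d p q).hom w = x) := fun p q r hp hr => by
    rw [M.exactAt_iff' p q r (by simp [← hp]) (by simp [← hr]), ShortComplex.moduleCat_exact_iff]
    rfl
  rw [isLE_iff]
  constructor
  · exact fun h p q r hp hr hq => (key p q r hp hr).1 (h q hq)
  · exact fun h q hq => (key (q - 1) q (q + 1) (by lia) rfl).2 (h _ _ _ (by lia) rfl hq)

/-- The degreewise kernel of a morphism of complexes of modules. -/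
def kerComplex {L M : CochainComplex (ModuleCat.{u} E) ℤ} (p : L ⟶ M) :
    CochainComplex (ModuleCat.{u} E) ℤ where
  X q := ModuleCat.of E (LinearMap.ker (p.f q).hom)
  d q r := ModuleCat.ofHom ((L.d q r).hom.restrict fun x hx => by
    rw [LinearMap.mem_ker] at hx ⊢
    rw [← d_f_apply, hx, map_zero])
  shape q r h := by
    ext x
    exact congrArg (fun k => k.hom x.1) (L.shape q r h)
  d_comp_d' q r s _ _ := by
    ext x
    exact d_d_apply q r s x.1

/-- The inclusion of the kernel. -/
def kerComplexι {L M : CochainComplex (ModuleCat.{u} E) ℤ} (p : L ⟶ M) : kerComplex p ⟶ L where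
  f q := ModuleCat.ofHom (LinearMap.ker (p.f q).hom).subtype
  comm' _ _ _ := rfl

lemma kerComplexι_comp {L M : CochainComplex (ModuleCat.{u} E) ℤ} (p : L ⟶ M) (q : ℤ) :
    (kerComplexι p).f q ≫ p.f q = 0 := by
  ext x
  exact x.2

lemma kerComplexι_shortExact {L M : CochainComplex (ModuleCat.{u} E) ℤ} (p : L ⟶ M)
    (hp : ∀ q, Function.Surjective (p.f q).hom) (q : ℤ) :
    (ShortComplex.mk _ _ (kerComplexι_comp p q)).ShortExact where
  exact := (ShortComplex.moduleCat_exact_iff _).2 fun x hx => ⟨⟨x, hx⟩, rfl⟩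
  mono_f := (ModuleCat.mono_iff_injective _).2 Subtype.val_injective
  epi_g := (ModuleCat.epi_iff_surjective _).2 (hp q)

/-- A section `η` over the smaller ring gives the idempotent `1 - η p`, whose values lie in the
kernel. Over `G` there need be no such splitting. -/
lemma exists_retraction_kerComplex {G : Type u} [Ring G] (i : E →+* G)
    {L M : CochainComplex (ModuleCat.{u} G) ℤ} (p : L ⟶ M) (η : restrict i M ⟶ restrict i L)
    (hη : η ≫ restrictMap i p = 𝟙 _) :
    ∃ r : restrict i L ⟶ restrict i (kerComplex p), restrictMap i (kerComplexι p) ≫ r = 𝟙 _ := by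
  obtain ⟨e, he⟩ : ∃ e, e = 𝟙 (restrict i L) - restrictMap i p ≫ η := ⟨_, rfl⟩
  have hep : e ≫ restrictMap i p = 0 := by
    rw [he, Preadditive.sub_comp, Category.assoc, hη, Category.comp_id, Category.id_comp, sub_self]
  have hie : restrictMap i (kerComplexι p) ≫ e = restrictMap i (kerComplexι p) := by
    have h : restrictMap i (kerComplexι p) ≫ restrictMap i p = 0 := by
      rw [restrictMap, restrictMap, ← Functor.map_comp, show kerComplexι p ≫ p = 0 from
        HomologicalComplex.hom_ext _ _ (kerComplexι_comp p), Functor.map_zero]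
    rw [he, Preadditive.comp_sub, reassoc_of% h, Limits.zero_comp, Category.comp_id, sub_zero]
  have hep' : ∀ q (t : (restrict i L).X q), (p.f q).hom ((e.f q).hom t) = 0 := fun q t =>
    congrArg (fun f => (f.f q).hom t) hep
  let r : restrict i L ⟶ restrict i (kerComplex p) :=
    { f := fun q => ModuleCat.ofHom (X := (restrict i L).X q) (Y := (restrict i (kerComplex p)).X q)
        { toFun := fun t => (⟨(e.f q).hom t, hep' q t⟩ :
            LinearMap.ker (p.f q).hom)
          map_add' := fun s t => Subtype.ext (map_add (e.f q).hom s t)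
          map_smul' := fun a t => Subtype.ext (map_smul (e.f q).hom a t) }
      comm' := fun q q' _ => by
        ext t
        exact Subtype.ext (d_f_apply e q q' t) }
  refine ⟨r, HomologicalComplex.hom_ext _ _ fun q => ?_⟩
  ext x
  exact Subtype.ext (congrArg (fun f => (f.f q).hom x) hie)

end Descent

/-! ### Descent along a free extension `E → G` -/

section Basis

open CochainComplex CochainComplex.HomComplex

variable {E F G : Type u} [Ring E] [Ring F] [Ring G]

/-- A basis of `G` as a right module over `E`, consisting of elements of `F`. -/
structure RightBasis (i : E →+* G) (j : F →+* G) where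
  /-- the index type -/
  κ : Type u
  /-- the basis elements -/
  b : κ → F
  /-- the coordinates -/
  c : G ≃+ (κ →₀ E)
  c_mul : ∀ g e k, c (g * i e) k = c g k * e
  c_symm_single : ∀ k e, c.symm (Finsupp.single k e) = j (b k) * i e

namespace RightBasis

variable {i : E →+* G} {j : F →+* G} (β : RightBasis i j)

section

variable {M : Type u} [AddCommGroup M] [Module E M]

/-- `G ⊗_E M` is a direct sum of copies of `M`. -/
def toFinsupp : BaseChange i M →+ (β.κ →₀ M) :=
  bcLiftAdd i (AddMonoidHom.mk' (fun g => AddMonoidHom.mk'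
      (fun m => (β.c g).mapRange (fun e => e • m) (zero_smul E m))
      (fun m n => by ext; simp))
    (fun g g' => by ext; simp [add_smul])) (fun g e m => by ext k; simp [β.c_mul, mul_smul])

lemma toFinsupp_mk (g : G) (m : M) (k : β.κ) : β.toFinsupp (bcMk i g m) k = β.c g k • m := rfl

lemma toFinsupp_mk_b (k : β.κ) (m : M) :
    β.toFinsupp (bcMk i (j (β.b k)) m) = Finsupp.single k m := by
  classical
  ext k'
  have h : β.c (j (β.b k)) = Finsupp.single k 1 := by
    rw [β.c.symm_apply_eq.1 (β.c_symm_single k 1), map_one, mul_one]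
  rw [toFinsupp_mk, h, Finsupp.single_apply, Finsupp.single_apply]
  split_ifs <;> simp

lemma induction {P : BaseChange i M → Prop} (t : BaseChange i M)
    (mk : ∀ k m, P (bcMk i (j (β.b k)) m)) (zero : P 0) (add : ∀ s t, P s → P t → P (s + t)) :
    P t := by
  induction t using bc_induction with
  | zero => exact zero
  | add s t hs ht => exact add s t hs ht
  | mk g m =>
    obtain ⟨x, rfl⟩ := β.c.symm.surjective g
    induction x using Finsupp.induction_linear with
    | zero =>
      rw [map_zero, show bcMk i (0 : G) m = 0 by simpa using bcMk_add_left i (0 : G) 0 m]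
      exact zero
    | add x y hx hy =>
      rw [map_add, bcMk_add_left]
      exact add _ _ hx hy
    | single k e =>
      rw [β.c_symm_single, bcMk_mul]
      exact mk k _

lemma toFinsupp_injective : Function.Injective (β.toFinsupp (M := M)) := by
  let l : (β.κ →₀ M) →+ BaseChange i M :=
    Finsupp.liftAddHom fun k => AddMonoidHom.mk' (bcMk i (j (β.b k))) (bcMk_add_right i _)
  refine Function.LeftInverse.injective (g := l) fun t => ?_
  induction t using β.induction with
  | mk k m => rw [toFinsupp_mk_b]; exact Finsupp.liftAddHom_apply_single _ k m
  | zero => simp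
  | add s t hs ht => rw [map_add, map_add, hs, ht]

end

include β in
lemma isFlatHom : IsFlatHom i where
  preservesMono := ⟨fun {M N} f hf => by
    rw [ModuleCat.mono_iff_injective] at hf ⊢
    refine fun x y h => β.toFinsupp_injective (Finsupp.ext fun k => hf ?_)
    have key : ∀ t : BaseChange i M, β.toFinsupp (baseChangeMap i f.hom t) k =
        f.hom (β.toFinsupp t k) := fun t => by
      induction t using bc_induction with
      | zero => simp
      | mk g m => exact (f.hom.map_smul _ _).symm
      | add s t hs ht => rw [map_add, map_add, map_add, Finsupp.add_apply, Finsupp.add_apply,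
          hs, ht, map_add]
    exact (key x).symm.trans ((congrArg (fun t => β.toFinsupp t k) h).trans (key y))⟩

variable (h : ∀ e f, Commute (i e) (j f))

/-- The `k`-th inclusion `M → G ⊗_E M`. -/
def incl (k : β.κ) (M : CochainComplex (ModuleCat.{u} E) ℤ) : M ⟶ restrict i (bcComplex i M) where
  f q := ModuleCat.ofHom (Y := (ModuleCat.restrictScalars i).obj ((baseChange i).obj (M.X q)))
    { toFun := fun m => bcMk i (j (β.b k)) m
      map_add' := bcMk_add_right i _
      map_smul' := fun e m => by
        change _ = i e • bcMk i (j (β.b k)) m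
        rw [← bcMk_mul, bcMk_smul, (h e _).eq] }
  comm' _ _ _ := rfl

-- The basis elements come from `F`, so they commute with the image of `E`. Hence each summand `b_k
-- ⊗ M` is `E`-stable, and a family of `E`-linear maps on the summands glues to an `E`-linear map.
include h in
lemma exists_desc {M : ModuleCat.{u} E} {N : ModuleCat.{u} E} (w : β.κ → (M ⟶ N)) :
    ∃ f : (ModuleCat.restrictScalars i).obj ((baseChange i).obj M) ⟶ N,
      ∀ k m, f.hom (bcMk i (j (β.b k)) m) = (w k).hom m := by
  let l : (β.κ →₀ M) →+ N := Finsupp.liftAddHom fun k => (w k).hom.toAddMonoidHom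
  have hl : ∀ k m, l (β.toFinsupp (bcMk i (j (β.b k)) m)) = (w k).hom m := fun k m => by
    rw [toFinsupp_mk_b]
    simp [l]
  refine ⟨ModuleCat.ofHom (X := (ModuleCat.restrictScalars i).obj ((baseChange i).obj M))
    { toFun := fun t => l (β.toFinsupp (show BaseChange i M from t))
      map_add' := fun s t => (congrArg l (map_add β.toFinsupp (show BaseChange i M from s)
        (show BaseChange i M from t))).trans (map_add l _ _)
      map_smul' := fun e t => ?_ }, hl⟩
  change l (β.toFinsupp (i e • (show BaseChange i M from t))) =
    e • l (β.toFinsupp (show BaseChange i M from t))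
  generalize (show BaseChange i M from t) = t
  induction t using β.induction with
  | mk k m => rw [bcMk_smul, (h e _).eq, bcMk_mul, hl, hl, map_smul]
  | zero => simp
  | add s t hs ht => rw [smul_add, map_add, map_add, hs, ht, map_add, map_add, smul_add]

/-- A cochain on `G ⊗_E M` is a coboundary if its restrictions to the summands are. -/
lemma isCoboundary {M I : CochainComplex (ModuleCat.{u} E) ℤ} {n : ℤ}
    (z : Cochain (restrict i (bcComplex i M)) I n)
    (hz : ∀ k, IsCoboundary ((Cochain.ofHom (β.incl h k M)).comp z (zero_add n))) :
    IsCoboundary z := by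
  choose w hw using hz
  choose f hf using fun p q (hpq : p + (n - 1) = q) =>
    β.exists_desc h (M := M.X p) (N := I.X q) fun k => (w k).v p q hpq
  let v : Cochain (restrict i (bcComplex i M)) I (n - 1) := Cochain.mk f
  have hv : ∀ k, (Cochain.ofHom (β.incl h k M)).comp v (zero_add (n - 1)) = w k := fun k => by
    ext p q hpq m
    rw [Cochain.zero_cochain_comp_v, Cochain.ofHom_v]
    exact hf p q hpq k m
  refine ⟨v, ?_⟩
  ext p q hpq t
  have key : ∀ k m, ((δ (n - 1) n v).v p q hpq).hom (((β.incl h k M).f p).hom m) =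
      (z.v p q hpq).hom (((β.incl h k M).f p).hom m) := fun k m => by
    have h₁ := hw k
    rw [← hv k, δ_ofHom_comp] at h₁
    have h₂ := Cochain.congr_v h₁ p q hpq
    rw [Cochain.zero_cochain_comp_v, Cochain.zero_cochain_comp_v, Cochain.ofHom_v] at h₂
    exact congrArg (fun f => f.hom m) h₂
  change BaseChange i (M.X p) at t
  induction t using β.induction with
  | mk k m => exact key k m
  | zero =>
    exact (map_zero ((δ (n - 1) n v).v p q hpq).hom).trans
      (map_zero (z.v p q hpq).hom).symm
  | add s t hs ht =>
    exact (map_add ((δ (n - 1) n v).v p q hpq).hom _ _).trans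
      ((congrArg₂ _ hs ht).trans (map_add (z.v p q hpq).hom _ _).symm)

include β h in
/-- If there are no cocycles of negative degree over `E`, then a cocycle over `G` which is a
coboundary over `E` is a coboundary over `G`. -/
lemma isCoboundary_of_restrict {I : CochainComplex (ModuleCat.{u} G) ℤ} (a : ℤ)
    [I.IsStrictlyGE a] (hI : ∀ q, Injective (I.X q)) (M : CochainComplex (ModuleCat.{u} G) ℤ)
    (b : ℤ) [M.IsLE b]
    (hM : ∀ n < 0, ∀ z : Cocycle (restrict i M) (restrict i I) n, IsCoboundary z.1) {n : ℤ}
    (hn : n ≤ 0) (z : Cocycle M I n)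
    (hz : IsCoboundary (z.1.map (ModuleCat.restrictScalars.{u} i))) : IsCoboundary z.1 := by
  have := isKInjective_of_injective I a
  have hi := β.isFlatHom
  -- Induction on the overlap of degrees: `b` stays fixed and `n` drops by one at each step, until
  -- the cocycle vanishes for degree reasons.
  obtain ⟨N, hN⟩ : ∃ N : ℕ, b + n < a + N := ⟨(b + n - a).toNat + 1, by lia⟩
  induction N generalizing M n with
  | zero => exact exists_δ_eq_of_isLE a b (sub_add_cancel n 1) (by lia) z
  | succ N ih =>
    -- One step of a relative bar resolution: `G ⊗_E M → M` is split over `E` by the unit, and the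
    -- degree `n` class on `M` is traded for a degree `n - 1` class on the kernel.
    let p : bcComplex i (restrict i M) ⟶ M := bcDesc i (𝟙 (restrict i M))
    have hη : ∀ q (m : M.X q), (p.f q).hom (bcMk i 1 m) = m := fun q m => by
      have := congrArg (fun f => (f.f q).hom m) (bcUnitComplex_bcDesc (𝟙 (restrict i M)))
      exact this
    obtain ⟨r, hr⟩ := exists_retraction_kerComplex i p (bcUnitComplex i (restrict i M))
      (bcUnitComplex_bcDesc (𝟙 (restrict i M)))
    have h₁ : (restrict i M).IsLE b :=
      (isLE_iff_forall _ b).2 fun p q r hp hr hb => (isLE_iff_forall M b).1 inferInstance p q r hp hr hb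
    have h₂ : (bcComplex i (restrict i M)).IsLE b := by
      rw [isLE_iff] at h₁ ⊢
      exact fun q hq => (h₁ q hq).map (baseChange i)
    have h₃ : (kerComplex p).IsLE b := by
      rw [isLE_iff_forall] at h₂ ⊢
      intro q₁ q₂ q₃ hq₁ hq₂ hb x hx
      obtain ⟨y, hy⟩ := h₂ q₁ q₂ q₃ hq₁ hq₂ hb x.1 (congrArg Subtype.val hx)
      refine ⟨(r.f q₁).hom y, ?_⟩
      have h₄ : ((kerComplex p).d q₁ q₂).hom ((r.f q₁).hom y) =
        (r.f q₂).hom (((bcComplex i (restrict i M)).d q₁ q₂).hom y) := d_f_apply r q₁ q₂ y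
      rw [h₄, hy]
      exact congrArg (fun f => (f.f q₂).hom x) hr
    -- Over `E` the kernel is a retract of a direct sum of copies of `M`, so it inherits the
    -- vanishing in negative degrees.
    have h₅ : ∀ m < 0, ∀ z : Cocycle (restrict i (kerComplex p)) (restrict i I) m,
        IsCoboundary z.1 := fun m hm z => by
      have h₆ : IsCoboundary (z.precomp r).1 :=
        β.isCoboundary h _ fun k => hM m hm ((z.precomp r).precomp (β.incl h k (restrict i M)))
      have h₇ := h₆.ofHom_comp (restrictMap i (kerComplexι p))
      rwa [Cocycle.precomp_coe, ← Cochain.comp_assoc_of_first_is_zero_cochain,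
        ← Cochain.ofHom_comp, hr, Cochain.id_comp] at h₇
    refine IsCoboundary.of_shortExact (kerComplexι p) p (kerComplexι_comp p)
      (kerComplexι_shortExact p fun q m => ⟨bcMk i 1 m, hη q m⟩) hI z
      (IsCoboundary.bcDesc_comp (𝟙 _) z.1 ?_) fun z' => ?_
    · rwa [Cochain.id_comp]
    -- Here `n ≤ 0` is essential: the new degree `n - 1` is negative, so the required coboundary
    -- over `E` exists without a further hypothesis.
    · refine ih (kerComplex p) h₅ (by lia) z' ?_ (by lia)
      exact h₅ (n - 1) (by lia) (Cocycle.mk (z'.1.map _) (n - 1 + 1) rfl (by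
        rw [δ_map, Cocycle.δ_eq_zero, Cochain.map_zero]))

end RightBasis

end Basis

/-! ### Central endomorphisms in the derived category -/

section CentralEndomorphisms

open CochainComplex CochainComplex.HomComplex

lemma homologyMap_eq_of_Q_map_eq {C : Type*} [Category* C] [Abelian C] [HasDerivedCategory C]
    {K L : CochainComplex C ℤ} {f g : K ⟶ L}
    (h : DerivedCategory.Q.map f = DerivedCategory.Q.map g) (q : ℤ) :
    HomologicalComplex.homologyMap f q = HomologicalComplex.homologyMap g q := by
  have hf := (DerivedCategory.homologyFunctorFactors C q).hom.naturality f
  have hg := (DerivedCategory.homologyFunctorFactors C q).hom.naturality g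
  rw [Functor.comp_map, h] at hf
  exact (cancel_epi ((DerivedCategory.homologyFunctorFactors C q).hom.app K)).1
    (hf.symm.trans hg)

variable {E F G : Type u} [Ring E] [Ring F] [Ring G] {i : E →+* G} {j : F →+* G}

lemma RightBasis.mem_center (β : RightBasis i j) {g : G} (hi : ∀ e, i e * g = g * i e)
    (hj : ∀ f, j f * g = g * j f) : g ∈ Subring.center G := by
  rw [Subring.mem_center_iff]
  intro x
  obtain ⟨x, rfl⟩ := β.c.symm.surjective x
  induction x using Finsupp.induction_linear with
  | zero => rw [map_zero, zero_mul, mul_zero]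
  | add x y hx hy => rw [map_add, add_mul, mul_add, hx, hy]
  | single k e => rw [β.c_symm_single, mul_assoc, hi, ← mul_assoc, hj, mul_assoc]

/-- If `F ⟶ RHom_E(R, R)` is an isomorphism, then the endomorphism of `R` given by a central
element of `G` is given by a central element of `F`. -/
lemma HomothetyIsIso.exists_central (β : RightBasis i j) (h : ∀ e f, Commute (i e) (j f))
    {R : CochainComplex (ModuleCat.{u} G) ℤ} (hR : HomothetyIsIso i j h R) (b : ℤ) [R.IsLE b]
    (z : Subring.center G) : ∃ f ∈ Subring.center F, ∃ hf : j f ∈ Subring.center G,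
      DerivedCategory.Q.map (centralAction R z) =
        DerivedCategory.Q.map (centralAction R ⟨j f, hf⟩) := by
  obtain ⟨I, ι, hι, hq⟩ := hR
  rw [quasiIso_homothety_iff] at hq
  obtain ⟨a, ha⟩ := hι.exists_isStrictlyGE
  -- Over `E`, the action of `z` agrees up to homotopy with that of some `f`.
  obtain ⟨f, hf⟩ := hq.exists_isCoboundary_sub
    (Cocycle.ofHom (restrictMap i (centralAction R z ≫ ι)))
  rw [Cocycle.ofHom_coe] at hf
  -- The action of `z` commutes with every `f'`, so `f' f - f f'` acts as a coboundary and is zero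
  -- by faithfulness.
  have hfc : f ∈ Subring.center F := by
    rw [Subring.mem_center_iff]
    intro f'
    rw [← sub_eq_zero]
    refine hq.eq_zero _ ?_
    have h₁ := hf.comp_ofHom (commActHom i j h I f')
    have h₂ := hf.ofHom_comp (commActHom i j h R f')
    have h₅ : (commActHom i j h R f ≫ restrictMap i ι) ≫ commActHom i j h I f' =
        commActHom i j h R (f' * f) ≫ restrictMap i ι := by
      rw [Category.assoc, ← commActHom_naturality, ← Category.assoc, map_mul]
      rfl
    rw [Cochain.sub_comp, ← Cochain.ofHom_comp, ← Cochain.ofHom_comp, h₅] at h₁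
    rw [Cochain.comp_sub, ← Cochain.ofHom_comp, ← Cochain.ofHom_comp, ← Category.assoc _ _
      (restrictMap i ι),
      show commActHom i j h R f' ≫ commActHom i j h R f = commActHom i j h R (f * f') from
        (map_mul (commActHom i j h R) _ _).symm] at h₂
    have h₃ : restrictMap i (centralAction R z ≫ ι) ≫ commActHom i j h I f' =
        commActHom i j h R f' ≫ restrictMap i (centralAction R z ≫ ι) :=
      (commActHom_naturality i j h _ f').symm
    rw [h₃] at h₁
    have h₄ := h₁.sub_comm.sub_trans h₂
    rwa [← Cochain.ofHom_sub, ← Preadditive.sub_comp, ← map_sub] at h₄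
  have hjf : j f ∈ Subring.center G := β.mem_center (fun e => (h e f).eq) fun f' => by
    rw [← map_mul, ← map_mul, Subring.mem_center_iff.1 hfc]
  refine ⟨f, hfc, hjf, ?_⟩
  -- The two endomorphisms agree so far only over `E`. The descent lemma in degree zero makes the
  -- homotopy `G`-linear.
  have hz : IsCoboundary (Cocycle.ofHom (centralAction R z ≫ ι -
      centralAction R ⟨j f, hjf⟩ ≫ ι)).1 := by
    refine β.isCoboundary_of_restrict h a hι.injective R b
      (fun n hn z => hq.isCoboundary n hn.ne z) le_rfl _ ?_
    rw [Cocycle.ofHom_coe, Cochain.map_ofHom, Functor.map_sub, Cochain.ofHom_sub]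
    convert hf using 3
    exact Functor.map_comp _ _ _
  rw [Cocycle.ofHom_coe, Cochain.ofHom_sub] at hz
  obtain ⟨H⟩ := hz.homotopy
  have h₁ := DerivedCategory.Q_map_eq_of_homotopy _ H
  have := hι.quasiIso
  rwa [Functor.map_comp, Functor.map_comp, cancel_mono] at h₁

end CentralEndomorphisms

/-! ### Localization of dualizing complexes on one side -/

section Square

variable {E E' G G' : Type u} [Ring E] [Ring E'] [Ring G] [Ring G'] {i : E →+* G} {i' : E' →+* G'}
  {φ : E →+* E'} {ψ : G →+* G'} (sq : ψ.comp i = i'.comp φ)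

/-- The two restrictions of scalars along a commutative square of rings agree. -/
def restrictSquare (Y : CochainComplex (ModuleCat.{u} G') ℤ) :
    restrict i (restrict ψ Y) ⟶ restrict φ (restrict i' Y) where
  f q := ModuleCat.ofHom (X := (restrict i (restrict ψ Y)).X q)
    (Y := (restrict φ (restrict i' Y)).X q)
    { toFun := fun y => y
      map_add' := fun _ _ => rfl
      map_smul' := fun e y => congrArg (fun r => r • (show Y.X q from y)) (RingHom.congr_fun sq e) }
  comm' _ _ _ := rfl

lemma isIso_restrictSquare (Y : CochainComplex (ModuleCat.{u} G') ℤ) :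
    IsIso (restrictSquare sq Y) := by
  have : ∀ q, IsIso ((restrictSquare sq Y).f q) := fun q =>
    (ConcreteCategory.isIso_iff_bijective _).2 Function.bijective_id
  exact HomologicalComplex.Hom.isIso_of_components _

end Square

lemma IsTorsionIso.comp_isIso {E : Type u} [Ring E] {S : Submonoid (Subring.center E)}
    {M N P : ModuleCat.{u} E} {f : M ⟶ N} (hf : IsTorsionIso S f.hom) (g : N ⟶ P) [IsIso g] :
    IsTorsionIso S (f ≫ g).hom :=
  hf.comp (IsTorsionIso.of_bijective g.hom ((ConcreteCategory.isIso_iff_bijective g).1 inferInstance))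

section CenterImage

variable {E G : Type u} [Ring E] [Ring G]

/-- The image of a submonoid of the center under a ring homomorphism, as far as it is central. -/
def centerImage (S : Submonoid (Subring.center E)) (i : E →+* G) :
    Submonoid (Subring.center G) where
  carrier := {z | ∃ s ∈ S, (z : G) = i s}
  one_mem' := ⟨1, one_mem _, by simp⟩
  mul_mem' := by
    rintro z w ⟨s, hs, hz⟩ ⟨t, ht, hw⟩
    exact ⟨s * t, mul_mem hs ht, by simp [hz, hw]⟩

end CenterImage

/-! ### The two-sided localization as a one-sided localization -/

section OneSided

open CochainComplex CochainComplex.HomComplex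

variable {E F G : Type u} [Ring E] [Ring F] [Ring G] {i : E →+* G} {j : F →+* G}
variable {E' F' G' : Type u} [Ring E'] [Ring F'] [Ring G'] {i' : E' →+* G'} {j' : F' →+* G'}
variable {φ : E →+* E'} {χ : F →+* F'} {ψ : G →+* G'}
variable {S : Submonoid (Subring.center E)} {T : Submonoid (Subring.center F)}
  {U : Submonoid (Subring.center G)}

/-- Cohomology maps with `U`-torsion kernel and cokernel to a complex on which `U` acts
bijectively have `T`-torsion kernel and cokernel, if `U` acts on the source through `T`. -/
lemma IsCentralLocalization.isTorsionIso_homologyMap_of_exchange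
    (hψ : IsCentralLocalization U ψ) {R : CochainComplex (ModuleCat.{u} G) ℤ}
    {Y : CochainComplex (ModuleCat.{u} G') ℤ} (f : R ⟶ restrict ψ Y) (q : ℤ)
    (hf : IsTorsionIso U (HomologicalComplex.homologyMap f q).hom)
    {T : Submonoid (Subring.center G)}
    (hT : ∀ s ∈ U, ∃ t ∈ T, ∀ m : R.homology q, (s : G) • m = (t : G) • m) :
    IsTorsionIso T (HomologicalComplex.homologyMap f q).hom := by
  refine hf.of_exchange (fun s hs n hn => ?_) hT
  obtain ⟨c, rfl⟩ := homologyπ_surjective _ q n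
  rw [← map_smul, homologyπ_eq_zero_iff _ (sub_add_cancel q 1), map_smul] at hn
  rw [homologyπ_eq_zero_iff _ (sub_add_cancel q 1)]
  obtain ⟨w, hw⟩ := hn
  obtain ⟨v, hv⟩ := hψ.isUnit s hs
  generalize ((restrict ψ Y).iCycles q).hom c = y at hw ⊢
  change Y.X q at y
  change Y.X (q - 1) at w
  have hw' : (Y.d (q - 1) q).hom w = ψ s • y := hw
  refine ⟨((v⁻¹ : G'ˣ) : G') • w, ?_⟩
  refine ((Y.d (q - 1) q).hom.map_smul _ w).trans ?_
  rw [hw', ← hv, smul_smul, Units.inv_mul, one_smul]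

/-- Passage from torsion over `G` to torsion over `E`. -/
lemma isTorsionIso_homologyMap_restrict {M N : CochainComplex (ModuleCat.{u} G) ℤ} (f : M ⟶ N)
    (q : ℤ) (hf : IsTorsionIso (centerImage S i) (HomologicalComplex.homologyMap f q).hom) :
    IsTorsionIso S (HomologicalComplex.homologyMap (restrictMap i f) q).hom := by
  refine isTorsionIso_homologyMap (sub_add_cancel q 1) rfl (fun x w hx hw => ?_) fun y hy => ?_
  · obtain ⟨z, ⟨s, hs, hz⟩, v, hv⟩ := hf.exists_boundary (sub_add_cancel q 1) rfl x hx w hw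
    exact ⟨s, hs, v, hv.trans (congrArg (· • (show M.X q from x)) hz)⟩
  · obtain ⟨z, ⟨s, hs, hz⟩, x, hx, w, hw⟩ := hf.exists_cycle (sub_add_cancel q 1) rfl y hy
    exact ⟨s, hs, x, hx, w, hw.trans (congrArg (fun r => (f.f q).hom x - r • (show N.X q from y)) hz)⟩

/-- The data for localizing on both sides a complex of bimodules. -/
structure BimoduleLocalization (i : E →+* G) (j : F →+* G) (i' : E' →+* G') (j' : F' →+* G')
    (φ : E →+* E') (χ : F →+* F') (ψ : G →+* G') (S : Submonoid (Subring.center E))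
    (T : Submonoid (Subring.center F)) (U : Submonoid (Subring.center G)) : Prop where
  comm : ∀ e f, Commute (i e) (j f)
  comm' : ∀ e f, Commute (i' e) (j' f)
  flat : IsFlatHom i
  flat' : IsFlatHom i'
  sqi : ψ.comp i = i'.comp φ
  sqj : ψ.comp j = j'.comp χ
  left : IsCentralLocalization S φ
  right : IsCentralLocalization T χ
  both : IsCentralLocalization U ψ
  mem_center_left : ∀ s ∈ S, i s ∈ Subring.center G
  mem_center_right : ∀ t ∈ T, j t ∈ Subring.center G
  exists_eq_mul : ∀ z ∈ U, ∃ s ∈ S, ∃ t ∈ T, (z : G) = i s * j t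

namespace BimoduleLocalization

variable (D : BimoduleLocalization i j i' j' φ χ ψ S T U)
  {R : CochainComplex (ModuleCat.{u} G) ℤ}
include D

section

variable (hST : ∀ s ∈ S, ∃ t ∈ T, ∀ q (m : R.homology q), i s • m = j t • m)
include hST

/-- An element of `U` is a product `s t`, and on cohomology `s` acts as some `t'` in `T`. So
inverting `T` alone has the effect of inverting both sets. -/
lemma isTorsionIso_right (q : ℤ) : IsTorsionIso (centerImage T j)
    (HomologicalComplex.homologyMap (bcUnitComplex ψ R) q).hom := by
  refine D.both.isTorsionIso_homologyMap_of_exchange _ q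
    (D.both.isTorsionIso_homologyMap_bcUnitComplex R q) fun z hz => ?_
  obtain ⟨s, hs, t, ht, hz⟩ := D.exists_eq_mul z hz
  obtain ⟨t', ht', h⟩ := hST s hs
  refine ⟨⟨j (t' * t : Subring.center F), D.mem_center_right _ (mul_mem ht' ht)⟩,
    ⟨t' * t, mul_mem ht' ht, rfl⟩, fun m => ?_⟩
  rw [hz, mul_smul, h, smul_smul, ← map_mul]
  rfl

end

section

variable (hTS : ∀ t ∈ T, ∃ s ∈ S, ∀ q (m : R.homology q), i s • m = j t • m)
include hTS

lemma isTorsionIso_left (q : ℤ) : IsTorsionIso (centerImage S i)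
    (HomologicalComplex.homologyMap (bcUnitComplex ψ R) q).hom := by
  refine D.both.isTorsionIso_homologyMap_of_exchange _ q
    (D.both.isTorsionIso_homologyMap_bcUnitComplex R q) fun z hz => ?_
  obtain ⟨s, hs, t, ht, hz⟩ := D.exists_eq_mul z hz
  obtain ⟨s', hs', h⟩ := hTS t ht
  refine ⟨⟨i (s * s' : Subring.center E), D.mem_center_left _ (mul_mem hs hs')⟩,
    ⟨s * s', mul_mem hs hs', rfl⟩, fun m => ?_⟩
  rw [hz, mul_smul, ← h, smul_smul, ← map_mul]
  rfl

/-- The `E`-linear map from `R` to its localization. -/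
lemma isTorsionIso_comp (q : ℤ) : IsTorsionIso S (HomologicalComplex.homologyMap
    (restrictMap i (bcUnitComplex ψ R) ≫ restrictSquare D.sqi (bcComplex ψ R)) q).hom := by
  have := isIso_restrictSquare D.sqi (bcComplex ψ R)
  rw [HomologicalComplex.homologyMap_comp]
  exact (isTorsionIso_homologyMap_restrict (bcUnitComplex ψ R) q
    (D.isTorsionIso_left hTS q)).comp_isIso _

/-- Identifies the one-sided localization `E' ⊗_E R` with the two-sided one. This is what reduces
the one-sided conditions on `R_S` to those on `R`. -/
lemma quasiIso_bcDesc : QuasiIso (bcDesc φ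
    (restrictMap i (bcUnitComplex ψ R) ≫ restrictSquare D.sqi (bcComplex ψ R))) :=
  D.left.quasiIso_bcDesc _ (D.isTorsionIso_comp hTS)

lemma hasFiniteInjectiveDimension [IsNoetherianRing E]
    (hR : HasFiniteInjectiveDimension (restrict i R)) :
    HasFiniteInjectiveDimension (restrict i' (bcComplex ψ R)) := by
  have := D.quasiIso_bcDesc hTS
  exact D.left.hasFiniteInjectiveDimension hR
    (restrictMap i (bcUnitComplex ψ R) ≫ restrictSquare D.sqi (bcComplex ψ R))

lemma hasFiniteCohomology (hR : HasFiniteCohomology (restrict i R)) :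
    HasFiniteCohomology (restrict i' (bcComplex ψ R)) := fun q => by
  have := hR q
  let e : (restrict φ (restrict i' (bcComplex ψ R))).homology q ≅
      (ModuleCat.restrictScalars.{u} φ).obj ((restrict i' (bcComplex ψ R)).homology q) :=
    ((restrict i' (bcComplex ψ R)).sc q).mapHomologyIso (ModuleCat.restrictScalars.{u} φ)
  refine IsTorsionIso.finite D.left (HomologicalComplex.homologyMap
    (restrictMap i (bcUnitComplex ψ R) ≫ restrictSquare D.sqi (bcComplex ψ R)) q ≫ e.hom) ?_
  exact (D.isTorsionIso_comp hTS q).comp_isIso e.hom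

end

/-- Injective resolutions over `G` and `G'` are compared by a lift `κ` of the localization map. It
is a `T`-torsion isomorphism on cohomology, as `R → R_S` is one. Flatness keeps the terms injective
over `E` and `E'`, so the general localization result for homotheties applies. -/
lemma homothetyIsIso [IsNoetherianRing E]
    (hST : ∀ s ∈ S, ∃ t ∈ T, ∀ q (m : R.homology q), i s • m = j t • m)
    (hTS : ∀ t ∈ T, ∃ s ∈ S, ∀ q (m : R.homology q), i s • m = j t • m)
    (hb : HasBoundedCohomology R) (hR : HasFiniteCohomology (restrict i R))
    (h : HomothetyIsIso i j D.comm R) : HomothetyIsIso i' j' D.comm' (bcComplex ψ R) := by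
  obtain ⟨I, ι, hι, hq⟩ := h
  rw [quasiIso_homothety_iff] at hq
  obtain ⟨b₁, b₂, hb⟩ := hb
  have hψflat := D.both.isFlatHom
  have hφflat := D.left.isFlatHom
  have := D.flat
  have := D.flat'
  obtain ⟨I', ι', hι'⟩ := exists_isInjectiveResolution (bcComplex ψ R) b₁ fun q hq' => by
    rw [← HomologicalComplex.exactAt_iff_isZero_homology]
    exact ((HomologicalComplex.exactAt_iff_isZero_homology _ _).2 (hb q (Or.inl hq'))).map
      (baseChange ψ)
  rw [homothetyIsIso_iff i' j' D.comm' hι']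
  obtain ⟨a₁, ha₁⟩ := hι.boundedBelow
  obtain ⟨a₂, ha₂⟩ := hι'.boundedBelow
  -- Injectivity of `I'` over `G`, and not just over `E`, allows `κ` to be constructed over `G`;
  -- hence it commutes with the action of `F`.
  have hI'ψ : ∀ q, Injective ((restrict ψ I').X q) := fun q => by
    have := hι'.injective q
    exact restrictScalars_injective ψ (I'.X q)
  have hK : (restrict ψ I').IsKInjective := by
    have : (restrict ψ I').IsStrictlyGE a₂ := (isStrictlyGE_iff _ _).2 fun q hq =>
      (ModuleCat.restrictScalars.{u} ψ).map_isZero (ha₂ q hq)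
    exact isKInjective_of_injective _ a₂
  have := hι.quasiIso
  have := hι'.quasiIso
  obtain ⟨κ, ⟨hκ⟩⟩ := exists_lift_of_quasiIso ι (bcUnitComplex ψ R ≫ restrictMap ψ ι')
  have hκtors : ∀ q, IsTorsionIso (centerImage T j) (HomologicalComplex.homologyMap κ q).hom :=
    fun q => by
      refine IsTorsionIso.of_iso (HomologicalComplex.homologyMap ι q)
        (HomologicalComplex.homologyMap (restrictMap ψ ι') q) ?_ (D.isTorsionIso_right hST q)
      rw [← HomologicalComplex.homologyMap_comp, ← HomologicalComplex.homologyMap_comp]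
      exact (hκ.homologyMap_eq q).symm
  let u := restrictMap i (bcUnitComplex ψ R) ≫ restrictSquare D.sqi (bcComplex ψ R)
  let κ' := restrictMap i κ ≫ restrictSquare D.sqi I'
  have := D.quasiIso_bcDesc hTS
  let τ : T →* End (restrict i I) := ((commActHom i j D.comm I : F →* _).comp
    ((Subring.center F).subtype : Subring.center F →* F)).comp T.subtype
  let τ' : T →* End (restrict φ (restrict i' I')) := (((ModuleCat.restrictScalars.{u}
    φ).mapHomologicalComplex (ComplexShape.up ℤ)).mapEnd (restrict i' I')).comp
    ((((commActHom i' j' D.comm' I').comp χ : F →+* _) : F →* _).comp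
      (((Subring.center F).subtype : Subring.center F →* F).comp T.subtype))
  have hjχ : ∀ f q (y : I'.X q), ψ (j f) • y = j' (χ f) • y := fun f q y =>
    congrArg (· • y) (RingHom.congr_fun D.sqj f)
  have hjχ' : ∀ f q (y : (bcComplex ψ R).X q), ψ (j f) • y = j' (χ f) • y := fun f q y =>
    congrArg (· • y) (RingHom.congr_fun D.sqj f)
  have htors : IsTorsionHom κ' τ τ' := by
    refine ⟨fun t => ?_, fun p q r hp hr x w hx hw => ?_, fun p q r hp hr y hy => ?_⟩
    · refine HomologicalComplex.hom_ext _ _ fun q => ?_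
      ext x
      exact ((κ.f q).hom.map_smul (j (t : Subring.center F)) x).trans (hjχ _ q _)
    · obtain ⟨z, ⟨t, ht, hz⟩, v, hv⟩ := (hκtors q).exists_boundary hp hr x hx w hw
      exact ⟨⟨t, ht⟩, v, hv.trans (congrArg (· • (show I.X q from x)) hz)⟩
    · obtain ⟨z, ⟨t, ht, hz⟩, x, hx, w, hw⟩ := (hκtors q).exists_cycle hp hr y hy
      refine ⟨⟨t, ht⟩, x, hx, w, hw.trans ?_⟩
      refine congrArg (fun y => (κ.f q).hom x - y) ?_
      exact (congrArg (fun r => ψ r • (show I'.X q from y)) hz).trans (hjχ _ q _)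
  have h₁ : (restrict i I).IsStrictlyGE (min a₁ a₂) := (isStrictlyGE_iff _ _).2 fun q hq =>
    (ModuleCat.restrictScalars.{u} i).map_isZero (ha₁ q (by lia))
  have h₂ : (restrict i' I').IsStrictlyGE (min a₁ a₂) := (isStrictlyGE_iff _ _).2 fun q hq =>
    (ModuleCat.restrictScalars.{u} i').map_isZero (ha₂ q (by lia))
  have h₃ : ∀ q, Injective ((restrict i I).X q) := fun q => by
    have := hι.injective q
    exact restrictScalars_injective i (I.X q)
  have h₄ : ∀ q, Injective ((restrict i' I').X q) := fun q => by
    have := hι'.injective q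
    exact restrictScalars_injective i' (I'.X q)
  have h₅ : ∀ q, Injective ((restrict φ (restrict i' I')).X q) := fun q => by
    have := h₄ q
    exact restrictScalars_injective φ ((restrict i' I').X q)
  have h₆ : R.IsLE b₂ := (isLE_iff _ _).2 fun q hq =>
    (HomologicalComplex.exactAt_iff_isZero_homology _ _).2 (hb q (Or.inr hq))
  have h₇ : (restrict i R).IsLE b₂ := (isLE_iff_forall _ b₂).2 fun p q r hp hr hb =>
    (isLE_iff_forall R b₂).1 h₆ p q r hp hr hb
  have hκ' : Homotopy (restrictMap i ι ≫ κ') (u ≫ restrictMap φ (restrictMap i' ι')) := by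
    have h₈ := (Functor.mapHomotopy (ModuleCat.restrictScalars.{u} i) hκ).compRight
      (restrictSquare D.sqi I')
    exact h₈
  refine hq.of_isTorsionHom D.right (commActHom_naturality i j D.comm ι)
    (commActHom_naturality i' j' D.comm' ι') (u := u) (fun f => ?_) hκ' (τ := τ) (τ' := τ')
    (fun _ => rfl) (fun _ => rfl) htors (min a₁ a₂) h₃ h₄ h₅ b₂ (fun q => ?_)
  · refine HomologicalComplex.hom_ext _ _ fun q => ?_
    ext x
    exact (((bcUnitComplex ψ R).f q).hom.map_smul (j f) x).trans (hjχ' _ q _)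
  · have := hR q
    exact isNoetherian_of_isNoetherianRing_of_finite _ _

end BimoduleLocalization

end OneSided

/-! ### Tensor products of central localizations -/

section TensorTorsion

variable {K : Type v} [Field K] {E F : Type u} [Ring E] [Algebra K E] [Ring F] [Algebra K F]
variable {S : Submonoid (Subring.center E)} {T : Submonoid (Subring.center F)}

variable {M N : Type*} [AddCommGroup M] [Module K M] [Module E M] [IsScalarTower K E M]
  [AddCommGroup N] [Module K N] [Module F N] [IsScalarTower K F N]

/-- Over a field the kernel of `f ⊗ N` is `ker f ⊗ N`. An element of it is a finite sum, so the
product of the annihilators of the terms kills it. -/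
lemma exists_rTensor_lsmul_eq_zero {M' N : Type*} [AddCommGroup M'] [Module K M']
    [AddCommGroup N] [Module K N] (f : M →ₗ[K] M')
    (hf : ∀ m, f m = 0 → ∃ s ∈ S, (s : E) • m = 0) (x : M ⊗[K] N) (hx : f.rTensor N x = 0) :
    ∃ s ∈ S, (Algebra.lsmul K K M (s : E)).rTensor N x = 0 := by
  obtain ⟨y, rfl⟩ := ((Module.Flat.rTensor_exact N (f := (LinearMap.ker f).subtype) (g := f)
    (LinearMap.exact_subtype_ker_map f)) x).1 hx
  clear hx
  induction y with
  | zero => exact ⟨1, one_mem _, by simp⟩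
  | tmul m n =>
    obtain ⟨s, hs, h⟩ := hf m m.2
    exact ⟨s, hs, by simp [h]⟩
  | add y z hy hz =>
    obtain ⟨s, hs, hy⟩ := hy
    obtain ⟨t, ht, hz⟩ := hz
    refine ⟨s * t, mul_mem hs ht, ?_⟩
    rw [map_add, map_add, Subring.coe_mul, map_mul]
    nth_rw 1 [← map_mul, center_comm t (s : E), map_mul]
    simp [LinearMap.rTensor_mul, hy, hz]

lemma exists_lTensor_lsmul_eq_zero {M N' : Type*} [AddCommGroup M] [Module K M]
    [AddCommGroup N'] [Module K N'] (g : N →ₗ[K] N')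
    (hg : ∀ n, g n = 0 → ∃ t ∈ T, (t : F) • n = 0) (x : M ⊗[K] N) (hx : g.lTensor M x = 0) :
    ∃ t ∈ T, (Algebra.lsmul K K N (t : F)).lTensor M x = 0 := by
  obtain ⟨t, ht, h⟩ := exists_rTensor_lsmul_eq_zero g hg (TensorProduct.comm K M N x) (by
    rw [← LinearMap.comm_comp_lTensor_comp_comm_eq]
    simp [hx])
  refine ⟨t, ht, (TensorProduct.comm K M N).injective ?_⟩
  rw [map_zero, ← h, ← LinearMap.comm_comp_lTensor_comp_comm_eq]
  simp

/-- The kernel of a tensor product of maps with torsion kernels is torsion. -/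
lemma exists_map_lsmul_eq_zero {M' N' : Type*} [AddCommGroup M'] [Module K M']
    [AddCommGroup N'] [Module K N'] (f : M →ₗ[K] M') (g : N →ₗ[K] N')
    (hf : ∀ m, f m = 0 → ∃ s ∈ S, (s : E) • m = 0)
    (hg : ∀ n, g n = 0 → ∃ t ∈ T, (t : F) • n = 0) (x : M ⊗[K] N)
    (hx : TensorProduct.map f g x = 0) : ∃ s ∈ S, ∃ t ∈ T,
      TensorProduct.map (Algebra.lsmul K K M (s : E)) (Algebra.lsmul K K N (t : F)) x = 0 := by
  rw [← LinearMap.lTensor_comp_rTensor] at hx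
  obtain ⟨t, ht, h⟩ := exists_lTensor_lsmul_eq_zero g hg _ hx
  rw [← LinearMap.comp_apply, LinearMap.lTensor_comp_rTensor, ← LinearMap.rTensor_comp_lTensor] at h
  obtain ⟨s, hs, h⟩ := exists_rTensor_lsmul_eq_zero f hf _ h
  refine ⟨s, hs, t, ht, ?_⟩
  rwa [← LinearMap.rTensor_comp_lTensor]

/-- The cokernel of a tensor product of semilinear maps with torsion cokernels is torsion. -/
lemma exists_map_eq_map_lsmul {E' F' : Type*} [Ring E'] [Algebra K E'] [Ring F'] [Algebra K F']
    {M' N' : Type*} [AddCommGroup M'] [Module K M'] [Module E' M']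
    [IsScalarTower K E' M'] [AddCommGroup N'] [Module K N'] [Module F' N'] [IsScalarTower K F' N']
    (φ : E →ₐ[K] E') (χ : F →ₐ[K] F') (f : M →ₗ[K] M') (g : N →ₗ[K] N')
    (hf : ∀ e m, f (e • m) = φ e • f m) (hg : ∀ e n, g (e • n) = χ e • g n)
    (hf' : ∀ m', ∃ s ∈ S, ∃ m, f m = φ (s : E) • m')
    (hg' : ∀ n', ∃ t ∈ T, ∃ n, g n = χ (t : F) • n') (y : M' ⊗[K] N') :
    ∃ s ∈ S, ∃ t ∈ T, ∃ x : M ⊗[K] N, TensorProduct.map f g x =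
      TensorProduct.map (Algebra.lsmul K K M' (φ (s : E))) (Algebra.lsmul K K N' (χ (t : F))) y := by
  have key : ∀ (s : E) (t : F) (x : M ⊗[K] N),
      TensorProduct.map f g
        (TensorProduct.map (Algebra.lsmul K K M s) (Algebra.lsmul K K N t) x) =
      TensorProduct.map (Algebra.lsmul K K M' (φ s)) (Algebra.lsmul K K N' (χ t))
        (TensorProduct.map f g x) := fun s t x => by
    induction x with
    | zero => simp
    | add x y hx hy => simp only [map_add, hx, hy]
    | tmul m n => simp [hf, hg]
  induction y with
  | zero => exact ⟨1, one_mem _, 1, one_mem _, 0, by simp⟩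
  | tmul m' n' =>
    obtain ⟨s, hs, m, hm⟩ := hf' m'
    obtain ⟨t, ht, n, hn⟩ := hg' n'
    exact ⟨s, hs, t, ht, m ⊗ₜ n, by simp [hm, hn]⟩
  | add y z hy hz =>
    obtain ⟨s, hs, t, ht, x, hx⟩ := hy
    obtain ⟨s', hs', t', ht', x', hx'⟩ := hz
    refine ⟨s' * s, mul_mem hs' hs, t' * t, mul_mem ht' ht,
      TensorProduct.map (Algebra.lsmul K K M (s' : E)) (Algebra.lsmul K K N (t' : F)) x +
      TensorProduct.map (Algebra.lsmul K K M (s : E)) (Algebra.lsmul K K N (t : F)) x', ?_⟩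
    rw [map_add, key, key, hx, hx', map_add, Subring.coe_mul, Subring.coe_mul]
    congr 1
    · rw [map_mul, map_mul, map_mul, map_mul, TensorProduct.map_mul]
      rfl
    · rw [← center_comm s' (s : E), ← center_comm t' (t : F), map_mul, map_mul, map_mul, map_mul,
        TensorProduct.map_mul]
      rfl

variable (K S T) in
/-- The elements `s ⊗ t` of the center of `E ⊗ F`, for `s ∈ S` and `t ∈ T`. -/
abbrev centerTensor : Submonoid (Subring.center (E ⊗[K] F)) :=
  centerImage S (Algebra.TensorProduct.includeLeft : E →ₐ[K] E ⊗[K] F).toRingHom ⊔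
    centerImage T (Algebra.TensorProduct.includeRight : F →ₐ[K] E ⊗[K] F).toRingHom

variable (K) in
lemma tmul_mem_center (s : Subring.center E) (t : Subring.center F) :
    ((s : E) ⊗ₜ[K] (t : F)) ∈ Subring.center (E ⊗[K] F) := by
  rw [Subring.mem_center_iff]
  intro g
  induction g with
  | zero => simp
  | add x y hx hy => rw [add_mul, mul_add, hx, hy]
  | tmul x y => simp [center_comm s x, center_comm t y]

lemma tmul_mem_centerTensor {s : Subring.center E} (hs : s ∈ S) {t : Subring.center F}
    (ht : t ∈ T) : ⟨_, tmul_mem_center K s t⟩ ∈ centerTensor K S T := by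
  refine Submonoid.mem_sup.2 ⟨⟨_, tmul_mem_center K s 1⟩, ⟨s, hs, rfl⟩,
    ⟨_, tmul_mem_center K 1 t⟩, ⟨t, ht, rfl⟩, ?_⟩
  exact Subtype.ext (by simp)

lemma exists_eq_tmul_of_mem_centerTensor {z : Subring.center (E ⊗[K] F)}
    (hz : z ∈ centerTensor K S T) : ∃ s ∈ S, ∃ t ∈ T, (z : E ⊗[K] F) = (s : E) ⊗ₜ (t : F) := by
  obtain ⟨y, ⟨s, hs, hy⟩, w, ⟨t, ht, hw⟩, rfl⟩ := Submonoid.mem_sup.1 hz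
  exact ⟨s, hs, t, ht, by rw [Subring.coe_mul, hy, hw]; simp⟩

variable (K) in
/-- The tensor product of two central localizations. -/
lemma IsCentralLocalization.tensor {E' F' : Type u} [Ring E'] [Algebra K E'] [Ring F']
    [Algebra K F'] {φ : E →ₐ[K] E'} {χ : F →ₐ[K] F'}
    (hφ : IsCentralLocalization S φ.toRingHom) (hχ : IsCentralLocalization T χ.toRingHom) :
    IsCentralLocalization (centerTensor K S T) (Algebra.TensorProduct.map φ χ).toRingHom := by
  refine ⟨fun z hz => ?_, fun x => ?_, fun e he => ?_⟩
  · obtain ⟨y, ⟨s, hs, hy⟩, w, ⟨t, ht, hw⟩, rfl⟩ := Submonoid.mem_sup.1 hz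
    rw [Subring.coe_mul, map_mul, hy, hw]
    refine IsUnit.mul ?_ ?_
    · have h := (hφ.isUnit s hs).map
        (Algebra.TensorProduct.includeLeft : E' →ₐ[K] E' ⊗[K] F')
      have h' : (Algebra.TensorProduct.map φ χ).toRingHom
        ((Algebra.TensorProduct.includeLeft : E →ₐ[K] E ⊗[K] F).toRingHom s) =
        (Algebra.TensorProduct.includeLeft : E' →ₐ[K] E' ⊗[K] F') (φ.toRingHom s) := by simp
      rwa [h']
    · have h := (hχ.isUnit t ht).map
        (Algebra.TensorProduct.includeRight : F' →ₐ[K] E' ⊗[K] F')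
      have h' : (Algebra.TensorProduct.map φ χ).toRingHom
        ((Algebra.TensorProduct.includeRight : F →ₐ[K] E ⊗[K] F).toRingHom t) =
        (Algebra.TensorProduct.includeRight : F' →ₐ[K] E' ⊗[K] F') (χ.toRingHom t) := by simp
      rwa [h']
  · obtain ⟨s, hs, t, ht, y, hy⟩ := exists_map_eq_map_lsmul φ χ φ.toLinearMap χ.toLinearMap
      (fun e x => φ.map_mul e x) (fun e x => χ.map_mul e x)
      (fun x => by
        obtain ⟨s, hs, e, he⟩ := hφ.surj x
        exact ⟨s, hs, e, he.symm⟩)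
      (fun x => by
        obtain ⟨s, hs, e, he⟩ := hχ.surj x
        exact ⟨s, hs, e, he.symm⟩) x
    refine ⟨_, tmul_mem_centerTensor hs ht, y, ?_⟩
    refine Eq.trans ?_ hy.symm
    clear hy
    induction x with
    | zero => rw [map_zero, mul_zero]
    | add x y hx hy => rw [map_add, mul_add, hx, hy]
    | tmul x y => exact Algebra.TensorProduct.tmul_mul_tmul _ _ _ _
  · obtain ⟨s, hs, t, ht, h⟩ := exists_map_lsmul_eq_zero φ.toLinearMap χ.toLinearMap hφ.ker hχ.ker
      e he
    refine ⟨_, tmul_mem_centerTensor hs ht, ?_⟩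
    refine Eq.trans ?_ h
    clear h he
    induction e with
    | zero => rw [map_zero, mul_zero]
    | add x y hx hy => rw [map_add, mul_add, hx, hy]
    | tmul x y => exact Algebra.TensorProduct.tmul_mul_tmul _ _ _ _

open scoped Classical in
variable (K E F) in
/-- `E ⊗ F` is free over `E`. -/
def rightBasisLeft :
    RightBasis (Algebra.TensorProduct.includeLeft : E →ₐ[K] E ⊗[K] F).toRingHom
      (Algebra.TensorProduct.includeRight : F →ₐ[K] E ⊗[K] F).toRingHom where
  κ := Module.Basis.ofVectorSpaceIndex K F
  b := Module.Basis.ofVectorSpace K F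
  c := (TensorProduct.equivFinsuppOfBasisRight (Module.Basis.ofVectorSpace K F)).toAddEquiv
  c_mul g e k := by
    induction g with
    | zero => simp
    | add x y hx hy =>
      simp only [LinearEquiv.coe_toAddEquiv, map_add, Finsupp.add_apply, add_mul] at hx hy ⊢
      rw [hx, hy]
    | tmul x y => simp
  c_symm_single k e := by
    refine (TensorProduct.equivFinsuppOfBasisRight_symm_apply _ _).trans ?_
    simp

open scoped Classical in
variable (K E F) in
/-- `E ⊗ F` is free over `F`. -/
def rightBasisRight :
    RightBasis (Algebra.TensorProduct.includeRight : F →ₐ[K] E ⊗[K] F).toRingHom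
      (Algebra.TensorProduct.includeLeft : E →ₐ[K] E ⊗[K] F).toRingHom where
  κ := Module.Basis.ofVectorSpaceIndex K E
  b := Module.Basis.ofVectorSpace K E
  c := (TensorProduct.equivFinsuppOfBasisLeft (Module.Basis.ofVectorSpace K E)).toAddEquiv
  c_mul g e k := by
    induction g with
    | zero => simp
    | add x y hx hy =>
      simp only [LinearEquiv.coe_toAddEquiv, map_add, Finsupp.add_apply, add_mul] at hx hy ⊢
      rw [hx, hy]
    | tmul x y => simp
  c_symm_single k e := by
    refine (TensorProduct.equivFinsuppOfBasisLeft_symm_apply _ _).trans ?_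
    simp

end TensorTorsion

/-! ### The concrete localizations `A_S` and their opposites -/

section CentralLoc

variable (K : Type v) [Field K] {A : Type u} [Ring A] [Algebra K A]

variable (A) in
/-- The center as a subalgebra and as a subring. -/
def toCenter : Subalgebra.center K A →* Subring.center A where
  toFun a := ⟨a, Subring.mem_center_iff.2 (Subalgebra.mem_center_iff.1 a.2)⟩
  map_one' := rfl
  map_mul' _ _ := rfl

variable (A) in
/-- The center of the opposite algebra. -/
def toCenterOp : Subalgebra.center K A →* Subring.center Aᵐᵒᵖ where
  toFun a := ⟨MulOpposite.op (a : A), Subring.mem_center_iff.2 fun x =>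
    MulOpposite.unop_injective (Subalgebra.mem_center_iff.1 a.2 x.unop).symm⟩
  map_one' := rfl
  map_mul' a b := Subtype.ext (MulOpposite.unop_injective (Subalgebra.mem_center_iff.1 b.2 a))

/-- The ring `S⁻¹Z(A) ⊗ A` is the localized `Z(A)`-module of `A`, and the required fraction calculus
is that of localized modules. -/
lemma isCentralLocalization_toCentralLoc (S : Submonoid (Subalgebra.center K A)) :
    IsCentralLocalization (F := CentralLoc K S) (S.map (toCenter K A)) (toCentralLoc K S).toRingHom := by
  let f : A →ₗ[Subalgebra.center K A] CentralLoc K S :=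
    TensorProduct.mk (Subalgebra.center K A) (Localization S) A 1
  have hf : IsLocalizedModule S f := inferInstance
  have hmul : ∀ (s : Subalgebra.center K A) (x : CentralLoc K S),
      (toCentralLoc K S).toRingHom ((toCenter K A s : Subring.center A) : A) * x = s • x := by
    intro s x
    have h : (toCentralLoc K S).toRingHom ((toCenter K A s : Subring.center A) : A) =
        algebraMap (Subalgebra.center K A) (CentralLoc K S) s :=
      (Algebra.TensorProduct.includeRight :
        A →ₐ[Subalgebra.center K A] CentralLoc K S).commutes s
    rw [h]
    exact (Algebra.smul_def s x).symm
  refine ⟨?_, fun x => ?_, fun e he => ?_⟩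
  · rintro _ ⟨s, hs, rfl⟩
    have h : IsUnit (algebraMap (Localization S) (CentralLoc K S)
        (algebraMap (Subalgebra.center K A) (Localization S) s)) :=
      (IsLocalization.map_units (Localization S) (⟨s, hs⟩ : S)).map _
    rw [← IsScalarTower.algebraMap_apply] at h
    rwa [show (toCentralLoc K S).toRingHom ((toCenter K A s : Subring.center A) : A) =
        algebraMap (Subalgebra.center K A) (CentralLoc K S) s from
      (Algebra.TensorProduct.includeRight :
        A →ₐ[Subalgebra.center K A] CentralLoc K S).commutes s]
  · obtain ⟨⟨a, s⟩, h⟩ := IsLocalizedModule.surj S f x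
    exact ⟨toCenter K A s, ⟨s, s.2, rfl⟩, a, (hmul s x).trans h⟩
  · obtain ⟨s, hs⟩ := (IsLocalizedModule.eq_zero_iff S f).1 he
    exact ⟨toCenter K A s, ⟨s, s.2, rfl⟩, hs⟩

lemma isCentralLocalization_op_toCentralLoc (S : Submonoid (Subalgebra.center K A)) :
    IsCentralLocalization (F := (CentralLoc K S)ᵐᵒᵖ) (S.map (toCenterOp K A)) (AlgHom.op (toCentralLoc K S)).toRingHom := by
  have h := isCentralLocalization_toCentralLoc K S
  refine ⟨?_, fun x => ?_, fun e he => ?_⟩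
  · rintro _ ⟨s, hs, rfl⟩
    exact (h.isUnit _ ⟨s, hs, rfl⟩).op
  · obtain ⟨_, ⟨s, hs, rfl⟩, e, he⟩ := h.surj x.unop
    refine ⟨toCenterOp K A s, ⟨s, hs, rfl⟩, MulOpposite.op e, MulOpposite.unop_injective ?_⟩
    -- Passing to the opposite ring turns left fractions into right ones; they agree because
    -- denominators are central.
    exact (h.comm _ _).trans he
  · obtain ⟨_, ⟨s, hs, rfl⟩, hs'⟩ := h.ker e.unop (MulOpposite.op_injective he)
    refine ⟨toCenterOp K A s, ⟨s, hs, rfl⟩, MulOpposite.unop_injective ?_⟩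
    exact (Subalgebra.mem_center_iff.1 s.2 e.unop).trans hs'

end CentralLoc

/-! ### Localization of dualizing complexes -/

section LocalizeDualizing

/-- Exchanging the two sides yields the conditions over `Bᵒᵖ` from the arguments over `A`. -/
lemma BimoduleLocalization.symm {E F G E' F' G' : Type u} [Ring E] [Ring F] [Ring G] [Ring E']
    [Ring F'] [Ring G'] {i : E →+* G} {j : F →+* G} {i' : E' →+* G'} {j' : F' →+* G'}
    {φ : E →+* E'} {χ : F →+* F'} {ψ : G →+* G'} {S : Submonoid (Subring.center E)}
    {T : Submonoid (Subring.center F)} {U : Submonoid (Subring.center G)}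
    (D : BimoduleLocalization i j i' j' φ χ ψ S T U) (hj : IsFlatHom j) (hj' : IsFlatHom j') :
    BimoduleLocalization j i j' i' χ φ ψ T S U where
  comm f e := (D.comm e f).symm
  comm' f e := (D.comm' e f).symm
  flat := hj
  flat' := hj'
  sqi := D.sqj
  sqj := D.sqi
  left := D.right
  right := D.left
  both := D.both
  mem_center_left := D.mem_center_right
  mem_center_right := D.mem_center_left
  exists_eq_mul z hz := by
    obtain ⟨s, hs, t, ht, h⟩ := D.exists_eq_mul z hz
    exact ⟨t, ht, s, hs, h.trans (D.comm _ _).eq⟩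

variable (K : Type v) [Field K] {A B : Type u} [Ring A] [Algebra K A] [Ring B] [Algebra K B]

lemma homologyMap_centralAction {G : Type u} [Ring G] (M : CochainComplex (ModuleCat.{u} G) ℤ)
    (z : Subring.center G) (q : ℤ) (m : M.homology q) :
    (HomologicalComplex.homologyMap (centralAction M z) q).hom m = (z : G) • m := by
  obtain ⟨c, rfl⟩ := homologyπ_surjective _ q m
  rw [homologyMap_homologyπ, ← map_smul]
  congr 1
  apply iCycles_injective
  rw [iCycles_cyclesMap, map_smul]
  rfl

variable {K} in
lemma bimoduleLocalization {A' B' : Type u} [Ring A'] [Algebra K A'] [Ring B'] [Algebra K B']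
    {φ : A →ₐ[K] A'} {χ : Bᵐᵒᵖ →ₐ[K] B'ᵐᵒᵖ} {S : Submonoid (Subalgebra.center K A)}
    {T : Submonoid (Subalgebra.center K B)}
    (hφ : IsCentralLocalization (S.map (toCenter K A)) φ.toRingHom)
    (hχ : IsCentralLocalization (T.map (toCenterOp K B)) χ.toRingHom) :
    BimoduleLocalization (inl K A B) (inr K A B) (inl K A' B') (inr K A' B') φ.toRingHom
      χ.toRingHom (Algebra.TensorProduct.map φ χ).toRingHom
      (S.map (toCenter K A)) (T.map (toCenterOp K B))
      (centerImage (S.map (toCenter K A)) (inl K A B) ⊔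
        centerImage (T.map (toCenterOp K B)) (inr K A B)) where
  comm := inl_commute_inr K A B
  comm' := inl_commute_inr K _ _
  flat := (rightBasisLeft K A Bᵐᵒᵖ).isFlatHom
  flat' := (rightBasisLeft K A' B'ᵐᵒᵖ).isFlatHom
  sqi := by
    ext a
    simp
  sqj := by
    ext b
    simp
  left := hφ
  right := hχ
  both := IsCentralLocalization.tensor K hφ hχ
  mem_center_left := by
    rintro _ ⟨s, -, rfl⟩
    exact (centerInl K A B s).2
  mem_center_right := by
    rintro _ ⟨t, -, rfl⟩
    exact (centerInr K A B t).2
  exists_eq_mul z hz := by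
    obtain ⟨y, ⟨s, hs, hy⟩, w, ⟨t, ht, hw⟩, rfl⟩ := Submonoid.mem_sup.1 hz
    exact ⟨s, hs, t, ht, by rw [Subring.coe_mul, hy, hw]⟩

variable {K} {R : BimodComplex K A B}

lemma HasBoundedCohomology.exists_isLE {E : Type u} [Ring E]
    {M : CochainComplex (ModuleCat.{u} E) ℤ} (h : HasBoundedCohomology M) : ∃ b, M.IsLE b := by
  obtain ⟨a, b, h⟩ := h
  exact ⟨b, (CochainComplex.isLE_iff _ _).2 fun q hq =>
    (HomologicalComplex.exactAt_iff_isZero_homology _ _).2 (h q (Or.inr hq))⟩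

lemma HasBoundedCohomology.bcComplex {E F : Type u} [Ring E] [Ring F]
    {M : CochainComplex (ModuleCat.{u} E) ℤ} (h : HasBoundedCohomology M) (φ : E →+* F)
    [IsFlatHom φ] : HasBoundedCohomology (bcComplex φ M) := by
  obtain ⟨a, b, h⟩ := h
  refine ⟨a, b, fun q hq => ?_⟩
  rw [← HomologicalComplex.exactAt_iff_isZero_homology]
  exact ((HomologicalComplex.exactAt_iff_isZero_homology _ _).2 (h q hq)).map (baseChange φ)

/-- In the derived category, the center of `A` acts on `R` through the center of `B`. -/
lemma IsDualizingComplex.exists_rightCenter_eq (hR : IsDualizingComplex K R)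
    (a : Subalgebra.center K A) : ∃ b : Subalgebra.center K B,
      leftCenter K R a = rightCenter K R b := by
  obtain ⟨n, hn⟩ := hR.bounded.exists_isLE
  obtain ⟨f, hf, hf', h⟩ := hR.homothety_right.exists_central (rightBasisLeft K A Bᵐᵒᵖ) _ n
    (centerInl K A B a)
  refine ⟨⟨f.unop, Subalgebra.mem_center_iff.2 fun x => ?_⟩, h⟩
  exact MulOpposite.op_injective (Subring.mem_center_iff.1 hf (MulOpposite.op x)).symm

/-- In the derived category, the center of `B` acts on `R` through the center of `A`. -/
lemma IsDualizingComplex.exists_leftCenter_eq (hR : IsDualizingComplex K R)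
    (b : Subalgebra.center K B) : ∃ a : Subalgebra.center K A,
      rightCenter K R b = leftCenter K R a := by
  obtain ⟨n, hn⟩ := hR.bounded.exists_isLE
  obtain ⟨f, hf, hf', h⟩ := hR.homothety_left.exists_central (rightBasisRight K A Bᵐᵒᵖ) _ n
    (centerInr K A B b)
  exact ⟨⟨f, Subalgebra.mem_center_iff.2 (Subring.mem_center_iff.1 hf)⟩, h⟩

lemma smul_homology_eq_of_center_eq {a : Subalgebra.center K A} {b : Subalgebra.center K B}
    (h : leftCenter K R a = rightCenter K R b) (q : ℤ) (m : R.homology q) :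
    inl K A B a • m = inr K A B (MulOpposite.op (b : B)) • m :=
  (homologyMap_centralAction R (centerInl K A B a) q m).symm.trans
    ((congrArg (fun f => f.hom m) (homologyMap_eq_of_Q_map_eq h q)).trans
      (homologyMap_centralAction R (centerInr K A B b) q m))

/-- Localizations of dualizing complexes are dualizing. -/
lemma IsDualizingComplex.isDualizingComplex_bcComplex (hR : IsDualizingComplex K R)
    {A' B' : Type u} [Ring A'] [Algebra K A'] [Ring B'] [Algebra K B']
    {φ : A →ₐ[K] A'} {χ : Bᵐᵒᵖ →ₐ[K] B'ᵐᵒᵖ} (S : Submonoid (DerivedEnd K R))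
    (hφ : IsCentralLocalization ((leftSubset K S).map (toCenter K A)) φ.toRingHom)
    (hχ : IsCentralLocalization ((rightSubset K S).map (toCenterOp K B)) χ.toRingHom) :
    IsDualizingComplex K (A := A') (B := B')
      (bcComplex (Algebra.TensorProduct.map φ χ).toRingHom R) := by
  have hA := hR.isNoetherian_left
  have hB := hR.isNoetherian_right
  let D := bimoduleLocalization hφ hχ
  have hj : IsFlatHom (inr K A B) := (rightBasisRight K A Bᵐᵒᵖ).isFlatHom
  have hj' : IsFlatHom (inr K A' B') := (rightBasisRight K A' B'ᵐᵒᵖ).isFlatHom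
  -- An element of `Z(A)` and its partner in `Z(B)` give the same endomorphism of `R`. Membership in
  -- `S` is a condition on that endomorphism, so the partner lies in the corresponding subset.
  have hST : ∀ s ∈ (leftSubset K S).map (toCenter K A),
      ∃ t ∈ (rightSubset K S).map (toCenterOp K B), ∀ q (m : R.homology q),
        inl K A B s • m = inr K A B t • m := by
    rintro _ ⟨s, hs, rfl⟩
    obtain ⟨t, ht⟩ := hR.exists_rightCenter_eq s
    have hmem : t ∈ rightSubset K S := by
      change rightCenter K R t ∈ S
      rw [← ht]
      exact hs
    exact ⟨_, ⟨t, hmem, rfl⟩, fun q m => smul_homology_eq_of_center_eq ht q m⟩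
  have hTS : ∀ t ∈ (rightSubset K S).map (toCenterOp K B),
      ∃ s ∈ (leftSubset K S).map (toCenter K A), ∀ q (m : R.homology q),
        inl K A B s • m = inr K A B t • m := by
    rintro _ ⟨t, ht, rfl⟩
    obtain ⟨s, hs⟩ := hR.exists_leftCenter_eq t
    have hmem : s ∈ leftSubset K S := by
      change leftCenter K R s ∈ S
      rw [← hs]
      exact ht
    exact ⟨_, ⟨s, hmem, rfl⟩, fun q m => smul_homology_eq_of_center_eq hs.symm q m⟩
  have hST' : ∀ t ∈ (rightSubset K S).map (toCenterOp K B),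
      ∃ s ∈ (leftSubset K S).map (toCenter K A), ∀ q (m : R.homology q),
        inr K A B t • m = inl K A B s • m := fun t ht => by
    obtain ⟨s, hs, h⟩ := hTS t ht
    exact ⟨s, hs, fun q m => (h q m).symm⟩
  have hTS' : ∀ s ∈ (leftSubset K S).map (toCenter K A),
      ∃ t ∈ (rightSubset K S).map (toCenterOp K B), ∀ q (m : R.homology q),
        inr K A B t • m = inl K A B s • m := fun s hs => by
    obtain ⟨t, ht, h⟩ := hST s hs
    exact ⟨t, ht, fun q m => (h q m).symm⟩
  let D' := D.symm hj hj'
  have hψ := D.both.isFlatHom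
  exact
  { isNoetherian_left := D.left.isNoetherianRing
    isNoetherian_right := D.right.isNoetherianRing
    bounded := hR.bounded.bcComplex _
    injDim_left := D.hasFiniteInjectiveDimension hTS hR.injDim_left
    injDim_right := D'.hasFiniteInjectiveDimension hTS' hR.injDim_right
    finite_left := D.hasFiniteCohomology hTS hR.finite_left
    finite_right := D'.hasFiniteCohomology hTS' hR.finite_right
    homothety_right := D.homothetyIsIso hST hTS hR.bounded hR.finite_left hR.homothety_right
    homothety_left := D'.homothetyIsIso hST' hTS' hR.bounded hR.finite_right hR.homothety_left }

/-- The localization of a dualizing complex over `(A, B)` at a multiplicative subset of its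
endomorphisms is a dualizing complex over `(A_S, B_S)`. -/
theorem IsDualizingComplex.localize (hR : IsDualizingComplex K R)
    (S : Submonoid (DerivedEnd K R)) :
    IsDualizingComplex K (localize K (leftSubset K S) (rightSubset K S) R) :=
  hR.isDualizingComplex_bcComplex S (isCentralLocalization_toCentralLoc K _)
    (isCentralLocalization_op_toCentralLoc K _)

end LocalizeDualizing

/-! ### Comparison of total complexes -/

section TotalComparison

open HomologicalComplex

variable {C₁ C₂ C₁' C₂' D D' : Type*} [Category* C₁] [Category* C₂] [Category* C₁'] [Category* C₂']
  [Category* D] [Category* D'] [Limits.HasZeroMorphisms C₁] [Limits.HasZeroMorphisms C₂]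
  [Limits.HasZeroMorphisms C₁'] [Limits.HasZeroMorphisms C₂'] [Preadditive D] [Preadditive D']
  {X₁ : CochainComplex C₁ ℤ} {X₂ : CochainComplex C₂ ℤ} {Y₁ : CochainComplex C₁' ℤ}
  {Y₂ : CochainComplex C₂' ℤ}
  {T : C₁ ⥤ C₂ ⥤ D} [T.PreservesZeroMorphisms] [∀ X, (T.obj X).PreservesZeroMorphisms]
  {T' : C₁' ⥤ C₂' ⥤ D'} [T'.PreservesZeroMorphisms] [∀ X, (T'.obj X).PreservesZeroMorphisms]
  [HasMapBifunctor X₁ X₂ T (ComplexShape.up ℤ)] [HasMapBifunctor Y₁ Y₂ T' (ComplexShape.up ℤ)]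
  (Φ : D ⥤ D') [Φ.Additive]
  (θ : ∀ p q, (T'.obj (Y₁.X p)).obj (Y₂.X q) ⟶ Φ.obj ((T.obj (X₁.X p)).obj (X₂.X q)))
  (h₁ : ∀ p p' q, (T'.map (Y₁.d p p')).app (Y₂.X q) ≫ θ p' q =
    θ p q ≫ Φ.map ((T.map (X₁.d p p')).app (X₂.X q)))
  (h₂ : ∀ p q q', (T'.obj (Y₁.X p)).map (Y₂.d q q') ≫ θ p q' =
    θ p q ≫ Φ.map ((T.obj (X₁.X p)).map (X₂.d q q')))

/-- The map of total complexes given by maps of the terms of double complexes, in one degree. -/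
def totalMapf (n : ℤ) : (mapBifunctor Y₁ Y₂ T' (ComplexShape.up ℤ)).X n ⟶
    Φ.obj ((mapBifunctor X₁ X₂ T (ComplexShape.up ℤ)).X n) :=
  mapBifunctorDesc fun p q h => θ p q ≫ Φ.map (ιMapBifunctor X₁ X₂ T _ p q n h)

omit [Φ.Additive] in
lemma ι_totalMapf (p q n : ℤ) (h : p + q = n) :
    ιMapBifunctor Y₁ Y₂ T' (ComplexShape.up ℤ) p q n h ≫ totalMapf Φ θ n =
      θ p q ≫ Φ.map (ιMapBifunctor X₁ X₂ T (ComplexShape.up ℤ) p q n h) :=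
  ι_mapBifunctorDesc _ _ _ _

omit [Φ.Additive] in
lemma ι_totalMapf_assoc (p q n : ℤ) (h : p + q = n) {Z : D'}
    (f : Φ.obj ((mapBifunctor X₁ X₂ T (ComplexShape.up ℤ)).X n) ⟶ Z) :
    ιMapBifunctor Y₁ Y₂ T' (ComplexShape.up ℤ) p q n h ≫ totalMapf Φ θ n ≫ f =
      θ p q ≫ Φ.map (ιMapBifunctor X₁ X₂ T (ComplexShape.up ℤ) p q n h) ≫ f := by
  rw [← Category.assoc, ι_totalMapf, Category.assoc]

include h₁ h₂ in
lemma totalMapf_comm (n n' : ℤ) (hn : n + 1 = n') :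
    totalMapf Φ θ n ≫ Φ.map ((mapBifunctor X₁ X₂ T (ComplexShape.up ℤ)).d n n') =
      (mapBifunctor Y₁ Y₂ T' (ComplexShape.up ℤ)).d n n' ≫ totalMapf Φ θ n' := by
  refine mapBifunctor.hom_ext fun p q h => ?_
  have hpq : p + q = n := h
  have e₁ : p + 1 + q = n' := by lia
  have e₂ : p + (q + 1) = n' := by lia
  rw [ι_totalMapf_assoc _ _ _ _ _ hpq, ← Φ.map_comp, mapBifunctor.d_eq, mapBifunctor.d_eq,
    Preadditive.comp_add,
    Preadditive.add_comp, Preadditive.comp_add, mapBifunctor.ι_D₁, mapBifunctor.ι_D₂,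
    mapBifunctor.ι_D₁_assoc, mapBifunctor.ι_D₂_assoc,
    mapBifunctor.d₁_eq _ _ _ _ (show (ComplexShape.up ℤ).Rel p (p + 1) from rfl) q n' e₁,
    mapBifunctor.d₁_eq _ _ _ _ (show (ComplexShape.up ℤ).Rel p (p + 1) from rfl) q n' e₁,
    mapBifunctor.d₂_eq _ _ _ _ p (show (ComplexShape.up ℤ).Rel q (q + 1) from rfl) n' e₂,
    mapBifunctor.d₂_eq _ _ _ _ p (show (ComplexShape.up ℤ).Rel q (q + 1) from rfl) n' e₂]
  simp only [Category.assoc, Units.smul_def,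
    Functor.map_add, Functor.map_zsmul, Functor.map_comp, Preadditive.comp_add,
    Preadditive.comp_zsmul, Preadditive.zsmul_comp]
  rw [ι_totalMapf _ _ _ _ _ e₁, ι_totalMapf _ _ _ _ _ e₂, reassoc_of% (h₁ p (p + 1) q),
    reassoc_of% (h₂ p q (q + 1))]

include h₁ h₂ in
/-- The map of total complexes given by maps of the terms of double complexes. -/
def totalMap : mapBifunctor Y₁ Y₂ T' (ComplexShape.up ℤ) ⟶
    (Φ.mapHomologicalComplex (ComplexShape.up ℤ)).obj
      (mapBifunctor X₁ X₂ T (ComplexShape.up ℤ)) where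
  f n := totalMapf Φ θ n
  comm' n n' hn := totalMapf_comm Φ θ h₁ h₂ n n' hn

end TotalComparison

/-! ### Torsion maps of total complexes -/

section TotalTorsion

open HomologicalComplex

/-- Valid for infinite direct sums: each element has finite support, so finitely many denominators
have to be combined. -/
lemma IsTorsionIso.directSum {P : Type*} [Ring P] {S : Submonoid (Subring.center P)} {ι : Type*}
    [DecidableEq ι] {Z W : ι → Type*} [∀ i, AddCommGroup (Z i)] [∀ i, Module P (Z i)]
    [∀ i, AddCommGroup (W i)] [∀ i, Module P (W i)] (f : ∀ i, Z i →ₗ[P] W i)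
    (hf : ∀ i, IsTorsionIso S (f i)) : IsTorsionIso S (DFinsupp.mapRange.linearMap f) where
  ker x hx := by
    classical
    obtain ⟨s, hs, h⟩ := exists_forall_of_monotone (S := S)
      (fun (i : x.support) s => (s : P) • x i = 0)
      (fun i s r h => by rw [Subring.coe_mul, mul_smul, h, smul_zero])
      (fun i => (hf i).ker _ (DFunLike.congr_fun hx (i : ι)))
    refine ⟨s, hs, DFinsupp.ext fun i => ?_⟩
    by_cases hi : i ∈ x.support
    · exact h ⟨i, hi⟩
    · rw [DFinsupp.notMem_support_iff] at hi
      simp [hi]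
  coker y := by
    induction y using DFinsupp.induction with
    | h0 => exact ⟨1, one_mem _, 0, by simp⟩
    | ha i w y _ _ hy =>
      obtain ⟨s, hs, x, hx⟩ := hy
      obtain ⟨t, ht, z, hz⟩ := (hf i).coker w
      refine ⟨s * t, mul_mem hs ht, (s : P) • DFinsupp.single i z + (t : P) • x, ?_⟩
      have h : DFinsupp.mapRange.linearMap f (DFinsupp.single i z) =
          (t : P) • DFinsupp.single i w := by
        rw [DFinsupp.mapRange.linearMap_apply, DFinsupp.mapRange_single, hz,
          DFinsupp.single_smul]
      rw [map_add, map_smul, map_smul, hx, h, smul_add, Subring.coe_mul, mul_smul,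
        ← center_comm s (t : P), mul_smul]

variable {C₁ C₂ C₁' C₂' : Type*} [Category* C₁] [Category* C₂] [Category* C₁'] [Category* C₂']
  [Limits.HasZeroMorphisms C₁] [Limits.HasZeroMorphisms C₂]
  [Limits.HasZeroMorphisms C₁'] [Limits.HasZeroMorphisms C₂']
  {X₁ : CochainComplex C₁ ℤ} {X₂ : CochainComplex C₂ ℤ} {Y₁ : CochainComplex C₁' ℤ}
  {Y₂ : CochainComplex C₂' ℤ} {P Q : Type*} [Ring P] [Ring Q] (φ : P →+* Q)
  {T : C₁ ⥤ C₂ ⥤ ModuleCat.{u} Q} [T.PreservesZeroMorphisms]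
  [∀ X, (T.obj X).PreservesZeroMorphisms]
  {T' : C₁' ⥤ C₂' ⥤ ModuleCat.{u} P} [T'.PreservesZeroMorphisms]
  [∀ X, (T'.obj X).PreservesZeroMorphisms]
  (θ : ∀ p q, (T'.obj (Y₁.X p)).obj (Y₂.X q) ⟶
    (ModuleCat.restrictScalars.{u} φ).obj ((T.obj (X₁.X p)).obj (X₂.X q)))
  (h₁ : ∀ p p' q, (T'.map (Y₁.d p p')).app (Y₂.X q) ≫ θ p' q =
    θ p q ≫ (ModuleCat.restrictScalars.{u} φ).map ((T.map (X₁.d p p')).app (X₂.X q)))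
  (h₂ : ∀ p q q', (T'.obj (Y₁.X p)).map (Y₂.d q q') ≫ θ p q' =
    θ p q ≫ (ModuleCat.restrictScalars.{u} φ).map ((T.obj (X₁.X p)).map (X₂.d q q')))
  {S : Submonoid (Subring.center P)}

include h₁ h₂ in
lemma isTorsionIso_totalMap (hθ : ∀ p q, IsTorsionIso S (θ p q).hom) (n : ℤ) :
    IsTorsionIso S ((totalMap (ModuleCat.restrictScalars.{u} φ) θ h₁ h₂).f n).hom := by
  classical
  let κ := {i : ℤ × ℤ // i.1 + i.2 = n}
  let Z : κ → ModuleCat.{u} P := fun i => (T'.obj (Y₁.X i.1.1)).obj (Y₂.X i.1.2)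
  let W : κ → ModuleCat.{u} Q := fun i => (T.obj (X₁.X i.1.1)).obj (X₂.X i.1.2)
  let e : (mapBifunctor Y₁ Y₂ T' (ComplexShape.up ℤ)).X n ≅
    ModuleCat.of P (DirectSum κ fun i => Z i) := ModuleCat.coprodIsoDirectSum Z
  let e' : (mapBifunctor X₁ X₂ T (ComplexShape.up ℤ)).X n ≅
    ModuleCat.of Q (DirectSum κ fun i => W i) := ModuleCat.coprodIsoDirectSum W
  let f : ∀ i : κ, Z i →ₗ[P] (ModuleCat.restrictScalars.{u} φ).obj (W i) :=
    fun i => (θ i.1.1 i.1.2).hom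
  have hf := IsTorsionIso.directSum f fun i => hθ _ _
  -- The identity on elements: restriction of scalars commutes with direct sums.
  let m : ModuleCat.of P (DirectSum κ fun i => (ModuleCat.restrictScalars.{u} φ).obj (W i)) ⟶
      (ModuleCat.restrictScalars.{u} φ).obj (ModuleCat.of Q (DirectSum κ fun i => W i)) :=
    ModuleCat.ofHom (X := ModuleCat.of P (DirectSum κ fun i =>
        (ModuleCat.restrictScalars.{u} φ).obj (W i)))
      (Y := (ModuleCat.restrictScalars.{u} φ).obj (ModuleCat.of Q (DirectSum κ fun i => W i)))
      { toFun := fun x => x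
        map_add' := fun _ _ => rfl
        map_smul' := fun _ _ => rfl }
  have hm : Function.Bijective m.hom := Function.bijective_id
  have key : totalMapf (ModuleCat.restrictScalars.{u} φ) θ n =
      e.hom ≫ (ModuleCat.ofHom (DFinsupp.mapRange.linearMap f) ≫ m) ≫
        (ModuleCat.restrictScalars.{u} φ).map e'.inv := by
    refine mapBifunctor.hom_ext fun p q h => ?_
    have h₃ : ιMapBifunctor Y₁ Y₂ T' (ComplexShape.up ℤ) p q n h ≫ e.hom =
      ModuleCat.ofHom (DirectSum.lof P κ (fun i => Z i) ⟨(p, q), h⟩) :=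
        ModuleCat.ι_coprodIsoDirectSum_hom Z ⟨(p, q), h⟩
    have h₄ : ModuleCat.ofHom (DirectSum.lof Q κ (fun i => W i) ⟨(p, q), h⟩) ≫ e'.inv =
        ιMapBifunctor X₁ X₂ T (ComplexShape.up ℤ) p q n h :=
      ModuleCat.lof_coprodIsoDirectSum_inv W ⟨(p, q), h⟩
    rw [ι_totalMapf _ _ _ _ _ h, reassoc_of% h₃, ← h₄]
    refine ModuleCat.hom_ext (LinearMap.ext fun x => ?_)
    have h₅ : DFinsupp.mapRange.linearMap f (DFinsupp.single ⟨(p, q), h⟩ x) =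
        DFinsupp.single ⟨(p, q), h⟩ ((θ p q).hom x) :=
      DFinsupp.mapRange_single (hf := fun i => (f i).map_zero)
    exact (congrArg (fun y => e'.inv.hom (m.hom y)) h₅).symm
  change IsTorsionIso S (totalMapf (ModuleCat.restrictScalars.{u} φ) θ n).hom
  rw [key]
  refine (IsTorsionIso.of_bijective e.hom.hom
    ((ConcreteCategory.isIso_iff_bijective e.hom).1 inferInstance)).comp ?_
  refine IsTorsionIso.comp (hf.comp (IsTorsionIso.of_bijective _ hm)) (IsTorsionIso.of_bijective _ ?_)
  exact (ConcreteCategory.isIso_iff_bijective e'.inv).1 inferInstance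

end TotalTorsion

/-! ### Tensor products of complexes over a field -/

section VectorSpaces

open CochainComplex CochainComplex.HomComplex

variable {K : Type v} [Field K]

/-- The image of `d` splits off both from the target and, through a section, from the source. The
generalized inverses are used to build a contraction of an acyclic complex. -/
lemma exists_comp_comp_eq {V W : ModuleCat.{u} K} (d : V ⟶ W) : ∃ g : W ⟶ V, d ≫ g ≫ d = d := by
  obtain ⟨s, hs⟩ := d.hom.rangeRestrict.exists_rightInverse_of_surjective
    (LinearMap.range_rangeRestrict _)
  obtain ⟨r, hr⟩ := (LinearMap.range d.hom).subtype.exists_leftInverse_of_injective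
    (Submodule.ker_subtype _)
  refine ⟨ModuleCat.ofHom (s ∘ₗ r), ?_⟩
  ext x
  have h₁ : r (d.hom x) = ⟨d.hom x, x, rfl⟩ := LinearMap.congr_fun hr ⟨d.hom x, x, rfl⟩
  have h₂ := congrArg Subtype.val (LinearMap.congr_fun hs ⟨d.hom x, x, rfl⟩)
  change d.hom (s (r (d.hom x))) = d.hom x
  rw [h₁]
  exact h₂

/-- Every complex of vector spaces is K-injective. -/
instance isKInjective_of_field (L : CochainComplex (ModuleCat.{u} K) ℤ) : L.IsKInjective where
  nonempty_homotopy_zero {X} f hX := by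
    choose g hg using fun p q => exists_comp_comp_eq (X.d q p)
    -- A contraction made of generalized inverses `g`. By acyclicity, `1 - d g` (in diagrammatic
    -- order) has values in boundaries, where `g d` is the identity; this is `hex`. The correction
    -- factor `1 - g d` in `h` then makes `δ h` the identity.
    let h : Cochain X X (-1) := Cochain.mk fun p q _ => g p q ≫ (𝟙 _ - g q (q - 1) ≫ X.d (q - 1) q)
    have hδ : δ (-1) 0 h = Cochain.ofHom (𝟙 X) := by
      refine Cochain.ext₀ _ _ fun p => ?_
      have h₀ : X.d p (p + 1) ≫ g (p + 1) p ≫ X.d p (p + 1) = X.d p (p + 1) := hg (p + 1) p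
      have key : X.d (p - 1) p ≫ g p (p - 1) ≫ X.d (p - 1) p = X.d (p - 1) p := hg p (p - 1)
      have hex : ((𝟙 (X.X p) - X.d p (p + 1) ≫ g (p + 1) p) ≫ g p (p - 1) ≫ X.d (p - 1) p) =
          𝟙 (X.X p) - X.d p (p + 1) ≫ g (p + 1) p := by
        have hexact : (ShortComplex.mk (X.d (p - 1) p) (X.d p (p + 1)) (X.d_comp_d _ _ _)).Exact := by
          have := hX p
          rwa [HomologicalComplex.exactAt_iff' _ (p - 1) p (p + 1) (by simp) (by simp)] at this
        rw [ShortComplex.moduleCat_exact_iff] at hexact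
        ext x
        obtain ⟨y, hy⟩ := hexact ((𝟙 (X.X p) - X.d p (p + 1) ≫ g (p + 1) p).hom x) (by
          have := congrArg (fun k => k.hom x)
            (show (𝟙 (X.X p) - X.d p (p + 1) ≫ g (p + 1) p) ≫ X.d p (p + 1) = 0 by
              rw [Preadditive.sub_comp, Category.assoc, h₀, Category.id_comp, sub_self])
          exact this)
        have h₁ := congrArg (fun k => k.hom y) key
        exact (congrArg (fun w => (X.d (p - 1) p).hom ((g p (p - 1)).hom w)) hy.symm).trans
          (h₁.trans hy)
      rw [δ_v (-1) 0 rfl h p p (add_zero p) (p - 1) (p + 1) rfl rfl]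
      simp only [h, Cochain.mk_v, Cochain.ofHom_v, HomologicalComplex.id_f]
      simp only [Preadditive.comp_sub, Preadditive.sub_comp, Category.assoc, Category.comp_id,
        HomologicalComplex.d_comp_d, Limits.comp_zero, sub_zero, Category.id_comp] at hex ⊢
      simp only [Int.negOnePow_zero, one_smul]
      rw [← sub_add_cancel (𝟙 (X.X p)) (X.d p (p + 1) ≫ g (p + 1) p), ← hex]
      abel
    have hf : IsCoboundary (Cochain.ofHom f - Cochain.ofHom 0) := by
      have h1 : IsCoboundary (Cochain.ofHom (𝟙 X)) := IsCoboundary.of_δ (by lia) h hδ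
      have h2 := h1.comp_ofHom f
      rwa [← Cochain.ofHom_comp, Category.id_comp, ← sub_zero (Cochain.ofHom f),
        ← Cochain.ofHom_zero] at h2
    exact hf.homotopy

/-- Quasi-isomorphisms with K-injective source and target are homotopy equivalences. -/
lemma exists_homotopyEquiv_of_quasiIso {C : Type*} [Category* C] [Abelian C]
    {X Y : CochainComplex C ℤ} [X.IsKInjective] [Y.IsKInjective] (f : X ⟶ Y) [QuasiIso f] :
    ∃ g : Y ⟶ X, Nonempty (Homotopy (f ≫ g) (𝟙 X)) ∧ Nonempty (Homotopy (g ≫ f) (𝟙 Y)) := by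
  obtain ⟨g, ⟨hg⟩⟩ := exists_lift_of_quasiIso f (𝟙 X)
  refine ⟨g, ⟨hg⟩, ?_⟩
  let := HasDerivedCategory.standard C
  refine homotopy_of_Q_map_eq _ _ ?_
  have h := DerivedCategory.Q_map_eq_of_homotopy _ hg
  rw [Functor.map_comp, CategoryTheory.Functor.map_id] at h
  rw [← cancel_epi (DerivedCategory.Q.map f), ← Functor.map_comp, ← Category.assoc,
    Functor.map_comp, Functor.map_comp, h, CategoryTheory.Functor.map_id, Category.id_comp,
    Category.comp_id]

end VectorSpaces

/-! ### Bifunctors on complexes and homotopy equivalences -/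

section MapBifunctor

open HomologicalComplex

variable {C₁ C₂ D : Type*} [Category* C₁] [Category* C₂] [Category* D]

section

variable [Limits.HasZeroMorphisms C₁] [Limits.HasZeroMorphisms C₂] [Preadditive D]
  (T : C₁ ⥤ C₂ ⥤ D) [T.PreservesZeroMorphisms] [∀ X, (T.obj X).PreservesZeroMorphisms]

lemma mapBifunctorMap_id (X : CochainComplex C₁ ℤ) (Y : CochainComplex C₂ ℤ)
    [HasMapBifunctor X Y T (ComplexShape.up ℤ)] :
    mapBifunctorMap (𝟙 X) (𝟙 Y) T (ComplexShape.up ℤ) = 𝟙 _ := by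
  refine hom_ext _ _ fun n => mapBifunctor.hom_ext fun p q h => ?_
  simp

lemma mapBifunctorMap_comp {X X' X'' : CochainComplex C₁ ℤ} {Y Y' Y'' : CochainComplex C₂ ℤ}
    [HasMapBifunctor X Y T (ComplexShape.up ℤ)] [HasMapBifunctor X' Y' T (ComplexShape.up ℤ)]
    [HasMapBifunctor X'' Y'' T (ComplexShape.up ℤ)]
    (f : X ⟶ X') (f' : X' ⟶ X'') (g : Y ⟶ Y') (g' : Y' ⟶ Y'') :
    mapBifunctorMap (f ≫ f') (g ≫ g') T (ComplexShape.up ℤ) =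
      mapBifunctorMap f g T _ ≫ mapBifunctorMap f' g' T _ := by
  refine hom_ext _ _ fun n => mapBifunctor.hom_ext fun p q h => ?_
  simp

end

lemma quasiIso_mapBifunctorMap_of_homotopy [Preadditive C₁] [Preadditive C₂] [Abelian D]
    (T : C₁ ⥤ C₂ ⥤ D) [T.Additive] [∀ X, (T.obj X).Additive]
    {X X' : CochainComplex C₁ ℤ} {Y Y' : CochainComplex C₂ ℤ}
    [∀ (X : CochainComplex C₁ ℤ) (Y : CochainComplex C₂ ℤ),
      HasMapBifunctor X Y T (ComplexShape.up ℤ)]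
    {f : X ⟶ X'} {f' : X' ⟶ X} {g : Y ⟶ Y'} {g' : Y' ⟶ Y} (hf : Homotopy (f ≫ f') (𝟙 X))
    (hf' : Homotopy (f' ≫ f) (𝟙 X')) (hg : Homotopy (g ≫ g') (𝟙 Y))
    (hg' : Homotopy (g' ≫ g) (𝟙 Y')) :
    QuasiIso (mapBifunctorMap f g T (ComplexShape.up ℤ)) := by
  let e : HomotopyEquiv (mapBifunctor X Y T (ComplexShape.up ℤ))
      (mapBifunctor X' Y' T (ComplexShape.up ℤ)) :=
    { hom := mapBifunctorMap f g T (ComplexShape.up ℤ)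
      inv := mapBifunctorMap f' g' T (ComplexShape.up ℤ)
      homotopyHomInvId := (Homotopy.ofEq (mapBifunctorMap_comp T f f' g g').symm).trans
        ((mapBifunctorMapHomotopy₁ hf (g ≫ g') T _).trans
          ((mapBifunctorMapHomotopy₂ (𝟙 X) hg T _).trans
            (Homotopy.ofEq (mapBifunctorMap_id T X Y))))
      homotopyInvHomId := (Homotopy.ofEq (mapBifunctorMap_comp T f' f g' g).symm).trans
        ((mapBifunctorMapHomotopy₁ hf' (g' ≫ g) T _).trans
          ((mapBifunctorMapHomotopy₂ (𝟙 X') hg' T _).trans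
            (Homotopy.ofEq (mapBifunctorMap_id T X' Y')))) }
  exact e.quasiIso_hom

end MapBifunctor

/-! ### The tensor product of complexes of modules -/

section KTensor

open HomologicalComplex

variable (K : Type v) [Field K]

/-- The tensor product of vector spaces, as a bifunctor. -/
def vectTensor : ModuleCat.{u} K ⥤ ModuleCat.{u} K ⥤ ModuleCat.{u} K where
  obj M :=
    { obj := fun N => ModuleCat.of K (M ⊗[K] N)
      map := fun g => ModuleCat.ofHom (g.hom.lTensor M)
      map_id := fun _ => by
        ext : 1
        exact LinearMap.lTensor_id _ _
      map_comp := fun _ _ => by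
        ext : 1
        exact LinearMap.lTensor_comp _ _ _ }
  map f :=
    { app := fun N => ModuleCat.ofHom (f.hom.rTensor N)
      naturality := fun _ _ g => by
        ext : 1
        exact (LinearMap.rTensor_comp_lTensor _ _ _).trans
          (LinearMap.lTensor_comp_rTensor _ _ _).symm }
  map_id _ := by
    ext N : 3
    exact LinearMap.rTensor_id _ _
  map_comp _ _ := by
    ext N : 3
    exact LinearMap.rTensor_comp _ _ _

instance : (vectTensor.{u} K).Additive where
  map_add {_ _ f g} := by
    ext N : 3
    exact LinearMap.rTensor_add _ _ _

instance (M : ModuleCat.{u} K) : ((vectTensor.{u} K).obj M).Additive where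
  map_add {_ _ f g} := by
    ext : 1
    exact LinearMap.lTensor_add _ _ _

open scoped ModuleCat

variable {E F : Type u} [Ring E] [Algebra K E] [Ring F] [Algebra K F]

variable (E) in
/-- The functor underlying complexes of vector spaces. -/
abbrev toVect : ModuleCat.{u} E ⥤ ModuleCat.{u} K :=
  ModuleCat.restrictScalars.{u} (algebraMap K E)

variable {K} in
lemma extTensorAction_tmul (M : ModuleCat.{u} E) (N : ModuleCat.{u} F) (e : E) (f : F)
    (t : M ⊗[K] N) : extTensorAction K M N (e ⊗ₜ f) t =
      TensorProduct.map (Algebra.lsmul K K M e) (Algebra.lsmul K K N f) t := by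
  simp [extTensorAction, Module.endTensorEndAlgHom_apply]
  rfl

/-- The vector space underlying `M ⊗ N`. -/
def extTensorToVect (M : ModuleCat.{u} E) (N : ModuleCat.{u} F) :
    ((vectTensor K).obj ((toVect K E).obj M)).obj ((toVect K F).obj N) ⟶
      (toVect K (E ⊗[K] F)).obj (extTensorObj K M N) :=
  ModuleCat.ofHom (X := ((vectTensor K).obj ((toVect K E).obj M)).obj ((toVect K F).obj N))
    (Y := (toVect K (E ⊗[K] F)).obj (extTensorObj K M N))
    { toFun := fun t => (show M ⊗[K] N from t)
      map_add' := fun _ _ => rfl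
      map_smul' := fun k t => by
        change k • (show M ⊗[K] N from t) =
          extTensorAction K M N (algebraMap K (E ⊗[K] F) k) t
        rw [AlgHom.commutes]
        rfl }

variable {M M' : CochainComplex (ModuleCat.{u} E) ℤ} {N N' : CochainComplex (ModuleCat.{u} F) ℤ}

variable (M N) in
/-- The tensor product of complexes, compared with that of the underlying complexes of vector
spaces. -/
def tensorToVect : mapBifunctor (((toVect K E).mapHomologicalComplex _).obj M)
      (((toVect K F).mapHomologicalComplex _).obj N) (vectTensor.{u} K) (ComplexShape.up ℤ) ⟶
    ((toVect K (E ⊗[K] F)).mapHomologicalComplex (ComplexShape.up ℤ)).obj (tensorComplex K M N) :=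
  totalMap (toVect K (E ⊗[K] F)) (fun p q => extTensorToVect K (M.X p) (N.X q))
    (fun _ _ _ => rfl) (fun _ _ _ => rfl)

/-- The tensor product of two morphisms of complexes. -/
def tensorMap (f : M ⟶ M') (g : N ⟶ N') : tensorComplex K M N ⟶ tensorComplex K M' N' :=
  mapBifunctorMap f g (extTensor K E F) (ComplexShape.up ℤ)

lemma tensorToVect_naturality (f : M ⟶ M') (g : N ⟶ N') :
    mapBifunctorMap (((toVect K E).mapHomologicalComplex _).map f)
      (((toVect K F).mapHomologicalComplex _).map g) (vectTensor.{u} K) (ComplexShape.up ℤ) ≫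
      tensorToVect K M' N' =
    tensorToVect K M N ≫
      ((toVect K (E ⊗[K] F)).mapHomologicalComplex _).map (tensorMap K f g) := by
  refine hom_ext _ _ fun n => mapBifunctor.hom_ext fun p q h => ?_
  have h₁ : ιMapBifunctor M N (extTensor K E F) (ComplexShape.up ℤ) p q n h ≫
      (tensorMap K f g).f n = ((extTensor K E F).map (f.f p)).app (N.X q) ≫
        ((extTensor K E F).obj (M'.X p)).map (g.f q) ≫
          ιMapBifunctor M' N' (extTensor K E F) (ComplexShape.up ℤ) p q n h :=
    ι_mapBifunctorMap _ _ _ _ _ _ _ _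
  have h₂ := congrArg (toVect K (E ⊗[K] F)).map h₁
  refine (ι_mapBifunctorMap_assoc _ _ _ _ _ _ _ _ _).trans ?_
  refine Eq.trans ?_ (ι_totalMapf_assoc _ _ _ _ _ h _).symm
  refine Eq.trans ?_ (congrArg (fun k => extTensorToVect K (M.X p) (N.X q) ≫ k) h₂.symm)
  refine (congrArg (fun k => _ ≫ _ ≫ k) (ι_totalMapf _ _ _ _ _ h)).trans ?_
  rfl

lemma isIso_tensorToVect : IsIso (tensorToVect K M N) := by
  have h : ∀ n, IsIso ((tensorToVect K M N).f n) := fun n => by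
    -- Being a torsion isomorphism for the trivial monoid is plain bijectivity, so the result on
    -- total complexes can be reused.
    have h : IsTorsionIso (⊥ : Submonoid (Subring.center K)) ((tensorToVect K M N).f n).hom :=
      isTorsionIso_totalMap (algebraMap K (E ⊗[K] F)) _ _ _
        (fun p q => IsTorsionIso.of_bijective _ Function.bijective_id) n
    refine (ConcreteCategory.isIso_iff_bijective _).2
      ⟨(injective_iff_map_eq_zero ((tensorToVect K M N).f n).hom).2 fun x hx => ?_, fun y => ?_⟩
    · obtain ⟨s, hs, h'⟩ := h.ker x hx
      rw [Submonoid.mem_bot.1 hs] at h'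
      exact (one_smul K x).symm.trans h'
    · obtain ⟨s, hs, x, h'⟩ := h.coker y
      rw [Submonoid.mem_bot.1 hs] at h'
      exact ⟨x, h'.trans (one_smul K y)⟩
  exact HomologicalComplex.Hom.isIso_of_components _

/-- Over a field, the tensor product of complexes preserves quasi-isomorphisms. -/
lemma quasiIso_tensorMap (f : M ⟶ M') (g : N ⟶ N') [QuasiIso f] [QuasiIso g] :
    QuasiIso (tensorMap K f g) := by
  -- Over `K` every complex is K-injective, so `f` and `g` become homotopy equivalences of complexes
  -- of vector spaces, which the tensor product respects. Quasi-isomorphisms are detected over `K`.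
  obtain ⟨f', ⟨hf⟩, ⟨hf'⟩⟩ := exists_homotopyEquiv_of_quasiIso
    (((toVect K E).mapHomologicalComplex (ComplexShape.up ℤ)).map f)
  obtain ⟨g', ⟨hg⟩, ⟨hg'⟩⟩ := exists_homotopyEquiv_of_quasiIso
    (((toVect K F).mapHomologicalComplex (ComplexShape.up ℤ)).map g)
  have h := quasiIso_mapBifunctorMap_of_homotopy (vectTensor.{u} K) hf hf' hg hg'
  have := isIso_tensorToVect K (M := M) (N := N)
  have := isIso_tensorToVect K (M := M') (N := N')
  have h' : QuasiIso (tensorToVect K M N ≫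
      ((toVect K (E ⊗[K] F)).mapHomologicalComplex _).map (tensorMap K f g)) := by
    rw [← tensorToVect_naturality]
    infer_instance
  rw [quasiIso_iff_comp_left] at h'
  exact (quasiIso_map_iff_of_preservesHomology (tensorMap K f g) (toVect K (E ⊗[K] F))).1 h'

end KTensor

/-! ### Localization of tensor products of complexes -/

section TensorRestrict

open HomologicalComplex

open scoped ModuleCat

variable {K : Type v} [Field K] {E F E' F' : Type u} [Ring E] [Algebra K E] [Ring F] [Algebra K F]
  [Ring E'] [Algebra K E'] [Ring F'] [Algebra K F'] (φ : E →ₐ[K] E') (χ : F →ₐ[K] F')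

/-- A homomorphism of modules along an algebra homomorphism, as a linear map. -/
def linearOfRestrict {M : ModuleCat.{u} E} {M' : ModuleCat.{u} E'}
    (f : M ⟶ (ModuleCat.restrictScalars.{u} φ.toRingHom).obj M') : M →ₗ[K] M' where
  toFun m := f.hom m
  map_add' := f.hom.map_add
  map_smul' k m := by
    refine (f.hom.map_smul (algebraMap K E k) m).trans ?_
    change φ (algebraMap K E k) • (show M' from f.hom m) = algebraMap K E' k • (show M' from f.hom m)
    rw [AlgHom.commutes]

/-- The tensor product of two homomorphisms of modules along algebra homomorphisms. -/
def extTensorRestrict {M : ModuleCat.{u} E} {M' : ModuleCat.{u} E'} {N : ModuleCat.{u} F}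
    {N' : ModuleCat.{u} F'} (f : M ⟶ (ModuleCat.restrictScalars.{u} φ.toRingHom).obj M')
    (g : N ⟶ (ModuleCat.restrictScalars.{u} χ.toRingHom).obj N') :
    extTensorObj K M N ⟶ (ModuleCat.restrictScalars.{u}
      (Algebra.TensorProduct.map φ χ).toRingHom).obj (extTensorObj K M' N') :=
  ModuleCat.ofHom (X := extTensorObj K M N) (Y := (ModuleCat.restrictScalars.{u}
      (Algebra.TensorProduct.map φ χ).toRingHom).obj (extTensorObj K M' N'))
    { toFun := fun t => TensorProduct.map (linearOfRestrict φ f) (linearOfRestrict χ g)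
        (show M ⊗[K] N from t)
      map_add' := fun x y => map_add (TensorProduct.map (linearOfRestrict φ f)
        (linearOfRestrict χ g)) (show M ⊗[K] N from x) (show M ⊗[K] N from y)
      map_smul' := fun r t => by
        change TensorProduct.map (linearOfRestrict φ f) (linearOfRestrict χ g)
          (extTensorAction K M N r t) = extTensorAction K M' N' (Algebra.TensorProduct.map φ χ r)
            (TensorProduct.map (linearOfRestrict φ f) (linearOfRestrict χ g) (show M ⊗[K] N from t))
        change M ⊗[K] N at t
        induction r with
        | zero => simp only [map_zero, LinearMap.zero_apply]
        | add a b ha hb => simp only [map_add, LinearMap.add_apply, ha, hb]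
        | tmul e x =>
          rw [Algebra.TensorProduct.map_tmul, extTensorAction_tmul, extTensorAction_tmul]
          induction t with
          | zero => simp only [map_zero]
          | add a b ha hb => simp only [map_add, ha, hb]
          | tmul m n =>
            exact congrArg₂ (fun a b => a ⊗ₜ[K] b) (f.hom.map_smul e m) (g.hom.map_smul x n) }

lemma isTorsionIso_extTensorRestrict {S : Submonoid (Subring.center E)}
    {T : Submonoid (Subring.center F)} {M : ModuleCat.{u} E} {M' : ModuleCat.{u} E'}
    {N : ModuleCat.{u} F} {N' : ModuleCat.{u} F'}
    {f : M ⟶ (ModuleCat.restrictScalars.{u} φ.toRingHom).obj M'}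
    {g : N ⟶ (ModuleCat.restrictScalars.{u} χ.toRingHom).obj N'}
    (hf : IsTorsionIso S f.hom) (hg : IsTorsionIso T g.hom) :
    IsTorsionIso (centerTensor K S T) (extTensorRestrict φ χ f g).hom where
  ker x hx := by
    obtain ⟨s, hs, t, ht, h⟩ := exists_map_lsmul_eq_zero (linearOfRestrict φ f)
      (linearOfRestrict χ g) hf.ker hg.ker x hx
    exact ⟨_, tmul_mem_centerTensor hs ht, (extTensorAction_tmul M N _ _ x).trans h⟩
  coker y := by
    obtain ⟨s, hs, t, ht, x, h⟩ := exists_map_eq_map_lsmul φ χ (linearOfRestrict φ f)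
      (linearOfRestrict χ g) f.hom.map_smul g.hom.map_smul hf.coker hg.coker y
    refine ⟨_, tmul_mem_centerTensor hs ht, x, h.trans ?_⟩
    refine (extTensorAction_tmul M' N' _ _ y).symm.trans ?_
    exact congrArg (fun r => extTensorAction K M' N' r y)
      (Algebra.TensorProduct.map_tmul φ χ (s : E) (t : F)).symm

variable {M : CochainComplex (ModuleCat.{u} E) ℤ} {M' : CochainComplex (ModuleCat.{u} E') ℤ}
  {N : CochainComplex (ModuleCat.{u} F) ℤ} {N' : CochainComplex (ModuleCat.{u} F') ℤ}

/-- The tensor product of two morphisms of complexes along algebra homomorphisms. -/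
def tensorRestrict (f : M ⟶ restrict φ.toRingHom M') (g : N ⟶ restrict χ.toRingHom N') :
    tensorComplex K M N ⟶
      restrict (Algebra.TensorProduct.map φ χ).toRingHom (tensorComplex K M' N') :=
  totalMap (ModuleCat.restrictScalars.{u} (Algebra.TensorProduct.map φ χ).toRingHom)
    (fun p q => extTensorRestrict φ χ (f.f p) (g.f q))
    (fun p p' q => extTensor_hom_ext K fun m n =>
      congrArg (fun a => a ⊗ₜ[K] (linearOfRestrict χ (g.f q) n)) (d_f_apply f p p' m).symm)
    (fun p q q' => extTensor_hom_ext K fun m n =>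
      congrArg (fun a => (linearOfRestrict φ (f.f p) m) ⊗ₜ[K] a) (d_f_apply g q q' n).symm)

lemma isTorsionIso_tensorRestrict {S : Submonoid (Subring.center E)}
    {T : Submonoid (Subring.center F)} {f : M ⟶ restrict φ.toRingHom M'}
    {g : N ⟶ restrict χ.toRingHom N'} (hf : ∀ p, IsTorsionIso S (f.f p).hom)
    (hg : ∀ q, IsTorsionIso T (g.f q).hom) (n : ℤ) :
    IsTorsionIso (centerTensor K S T) ((tensorRestrict φ χ f g).f n).hom :=
  isTorsionIso_totalMap _ _ _ _ (fun p q => isTorsionIso_extTensorRestrict φ χ (hf p) (hg q)) n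

end TensorRestrict

/-- A morphism of complexes whose components have torsion kernels and cokernels has this property
in cohomology. -/
lemma isTorsionIso_homologyMap_of_forall {E : Type u} [Ring E] {S : Submonoid (Subring.center E)}
    {M N : CochainComplex (ModuleCat.{u} E) ℤ} {f : M ⟶ N}
    (hf : ∀ n, IsTorsionIso S (f.f n).hom) (n : ℤ) :
    IsTorsionIso S (HomologicalComplex.homologyMap f n).hom := by
  refine isTorsionIso_homologyMap (sub_add_cancel n 1) rfl (fun x w hx hw => ?_) fun y hy => ?_
  -- After `s`, the element `w` lifts to `v`. Then `s x - d v` lies in the kernel of `f` and is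
  -- killed by a further `t`, so `t v` bounds `t s x`.
  · obtain ⟨s, hs, v, hv⟩ := (hf (n - 1)).coker w
    obtain ⟨t, ht, h⟩ := (hf n).ker ((s : E) • x - (M.d (n - 1) n).hom v) (by
      rw [map_sub, map_smul, ← hw, ← d_f_apply, hv, map_smul, sub_self])
    refine ⟨t * s, mul_mem ht hs, (t : E) • v, ?_⟩
    rw [map_smul, Subring.coe_mul, mul_smul]
    rw [smul_sub, sub_eq_zero] at h
    exact h.symm
  · obtain ⟨s, hs, x, hx⟩ := (hf n).coker y
    obtain ⟨t, ht, h⟩ := (hf (n + 1)).ker ((M.d n (n + 1)).hom x) (by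
      rw [← d_f_apply, hx, map_smul, hy, smul_zero])
    refine ⟨t * s, mul_mem ht hs, (t : E) • x, by rw [map_smul, h], 0, ?_⟩
    rw [map_zero, map_smul, hx, Subring.coe_mul, mul_smul, sub_self]

/-! ### Central actions on tensor products -/

section TensorCentral

open HomologicalComplex

open scoped ModuleCat

variable (K : Type v) [Field K] {E F : Type u} [Ring E] [Algebra K E] [Ring F] [Algebra K F]
  {M M' : CochainComplex (ModuleCat.{u} E) ℤ} {N N' : CochainComplex (ModuleCat.{u} F) ℤ}

lemma tensorMap_comp {M'' : CochainComplex (ModuleCat.{u} E) ℤ}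
    {N'' : CochainComplex (ModuleCat.{u} F) ℤ} (f : M ⟶ M') (f' : M' ⟶ M'') (g : N ⟶ N')
    (g' : N' ⟶ N'') : tensorMap K (f ≫ f') (g ≫ g') = tensorMap K f g ≫ tensorMap K f' g' :=
  mapBifunctorMap_comp _ _ _ _ _

instance : (extTensor K E F).Additive where
  map_add {_ _ f g} := by
    ext1; ext1 N
    exact extTensor_hom_ext K fun m n => TensorProduct.add_tmul (f.hom m) (g.hom m) n

instance (M : ModuleCat.{u} E) : ((extTensor K E F).obj M).Additive where
  map_add {_ _ f g} := extTensor_hom_ext K fun m n => TensorProduct.tmul_add m (f.hom n) (g.hom n)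

/-- The tensor product respects homotopies. -/
def tensorMapHomotopy {f f' : M ⟶ M'} {g g' : N ⟶ N'} (hf : Homotopy f f') (hg : Homotopy g g') :
    Homotopy (tensorMap K f g) (tensorMap K f' g') :=
  (mapBifunctorMapHomotopy₁ hf g (extTensor K E F) _).trans
    (mapBifunctorMapHomotopy₂ f' hg (extTensor K E F) _)

lemma centralAction_tensorComplex (s : Subring.center E) (t : Subring.center F) :
    centralAction (tensorComplex K M N) ⟨_, tmul_mem_center K s t⟩ =
      tensorMap K (centralAction M s) (centralAction N t) := by
  refine hom_ext _ _ fun n => mapBifunctor.hom_ext fun p q h => ?_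
  refine Eq.trans ?_ (ι_mapBifunctorMap _ _ _ _ _ _ _ _).symm
  rw [← Category.assoc]
  refine extTensor_hom_ext K fun a b => ?_
  exact ((ιMapBifunctor M N (extTensor K E F) (ComplexShape.up ℤ) p q n h).hom.map_smul
    ((s : E) ⊗ₜ[K] (t : F)) (show M.X p ⊗[K] N.X q from a ⊗ₜ b)).symm.trans
      (congrArg (ιMapBifunctor M N (extTensor K E F) (ComplexShape.up ℤ) p q n h).hom
        (extTensorAction_tmul (M.X p) (N.X q) _ _ (a ⊗ₜ b)))

/-- The tensor product of complexes with a K-injective resolution is well-defined on morphisms in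
the derived category. -/
lemma Q_map_tensorMap_eq {f f' : M ⟶ M'} {g g' : N ⟶ N'}
    (hf : DerivedCategory.Q.map f = DerivedCategory.Q.map f')
    (hg : DerivedCategory.Q.map g = DerivedCategory.Q.map g')
    {I : CochainComplex (ModuleCat.{u} E) ℤ} {J : CochainComplex (ModuleCat.{u} F) ℤ}
    [I.IsKInjective] [J.IsKInjective] (ι : M' ⟶ I) (ι' : N' ⟶ J) [QuasiIso ι] [QuasiIso ι'] :
    DerivedCategory.Q.map (tensorMap K f g) = DerivedCategory.Q.map (tensorMap K f' g') := by
  obtain ⟨H⟩ := homotopy_of_Q_map_eq (f ≫ ι) (f' ≫ ι) (by simp only [Functor.map_comp, hf])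
  obtain ⟨H'⟩ := homotopy_of_Q_map_eq (g ≫ ι') (g' ≫ ι') (by simp only [Functor.map_comp, hg])
  have h := DerivedCategory.Q_map_eq_of_homotopy _ (tensorMapHomotopy K H H')
  have := quasiIso_tensorMap K ι ι'
  rwa [tensorMap_comp, tensorMap_comp, Functor.map_comp, Functor.map_comp, cancel_mono] at h

/-- Tensoring over a field preserves quasi-isomorphisms, so both factors may be truncated. If `p + q
< a + b`, then `p < a` or `q < b`, and every summand vanishes. -/
lemma isZero_homology_tensorComplex {a b : ℤ} (hM : ∀ q < a, Limits.IsZero (M.homology q))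
    (hN : ∀ q < b, Limits.IsZero (N.homology q)) (n : ℤ) (hn : n < a + b) :
    Limits.IsZero ((tensorComplex K M N).homology n) := by
  have hM' : M.IsGE a := (CochainComplex.isGE_iff _ _).2 fun q hq =>
    (exactAt_iff_isZero_homology _ _).2 (hM q hq)
  have hN' : N.IsGE b := (CochainComplex.isGE_iff _ _).2 fun q hq =>
    (exactAt_iff_isZero_homology _ _).2 (hN q hq)
  have := quasiIso_tensorMap K (M.πTruncGE a) (N.πTruncGE b)
  refine Limits.IsZero.of_iso ?_ (asIso (homologyMap (tensorMap K (M.πTruncGE a) (N.πTruncGE b)) n))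
  rw [← exactAt_iff_isZero_homology]
  refine ShortComplex.exact_of_isZero_X₂ _ ?_
  refine (Limits.IsZero.iff_id_eq_zero _).2 (mapBifunctor.hom_ext fun p q h => ?_)
  have hpq : p + q = n := h
  refine Limits.IsZero.eq_of_src ?_ _ _
  by_cases hp : p < a
  · have h0 := (M.truncGE a).isZero_of_isStrictlyGE a p hp
    rw [Limits.IsZero.iff_id_eq_zero, ← NatTrans.id_app, ← CategoryTheory.Functor.map_id,
      (Limits.IsZero.iff_id_eq_zero _).1 h0, Functor.map_zero, Limits.zero_app]
  · exact Functor.map_isZero _ ((N.truncGE b).isZero_of_isStrictlyGE b q (by lia))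

end TensorCentral

/-! ### Naturality of central actions in the derived category -/

section CentralNaturality

open HomologicalComplex

variable {G H : Type u} [Ring G] [Ring H]

lemma centralAction_naturality {M N : CochainComplex (ModuleCat.{u} G) ℤ} (f : M ⟶ N)
    (z : Subring.center G) : centralAction M z ≫ f = f ≫ centralAction N z := by
  refine hom_ext _ _ fun q => ?_
  ext m
  exact (f.f q).hom.map_smul (z : G) m

/-- A morphism of the derived category is a fraction of two morphisms of complexes, and central
actions commute with both. -/
lemma Q_map_centralAction_naturality {M N : CochainComplex (ModuleCat.{u} G) ℤ}
    (f : DerivedCategory.Q.obj M ⟶ DerivedCategory.Q.obj N) (z : Subring.center G) :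
    DerivedCategory.Q.map (centralAction M z) ≫ f =
      f ≫ DerivedCategory.Q.map (centralAction N z) := by
  obtain ⟨X, g, s, hs, rfl⟩ := DerivedCategory.left_fac f
  rw [← cancel_mono (DerivedCategory.Q.map s)]
  simp only [Category.assoc, IsIso.inv_hom_id, Category.comp_id]
  rw [← Functor.map_comp, ← Functor.map_comp, centralAction_naturality, centralAction_naturality,
    Functor.map_comp, Functor.map_comp, IsIso.inv_hom_id_assoc]

lemma Q_map_restrictMap_eq (i : H →+* G) {X Y : CochainComplex (ModuleCat.{u} G) ℤ} {f g : X ⟶ Y}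
    (h : DerivedCategory.Q.map f = DerivedCategory.Q.map g) :
    DerivedCategory.Q.map (restrictMap i f) = DerivedCategory.Q.map (restrictMap i g) := by
  have hf := (ModuleCat.restrictScalars.{u} i).mapDerivedCategoryFactors.hom.naturality f
  have hg := (ModuleCat.restrictScalars.{u} i).mapDerivedCategoryFactors.hom.naturality g
  rw [Functor.comp_map, h] at hf
  exact (cancel_epi ((ModuleCat.restrictScalars.{u} i).mapDerivedCategoryFactors.hom.app X)).1
    (hf.symm.trans hg)

end CentralNaturality

/-! ### Central actions on `Hom`-complexes -/

section HomComplexes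

variable (K : Type v) [Field K] {E F : Type u} [Ring E] [Algebra K E] [Ring F] [Algebra K F]

/-- The complex `Hom_E(M, J)` of `F`-modules. -/
abbrev homFunctorComplex (M : ModuleCat.{u} E) (J : CochainComplex (ModuleCat.{u} (E ⊗[K] F)) ℤ) :
    CochainComplex (ModuleCat.{u} F) ℤ :=
  ((homFunctor K F M).mapHomologicalComplex (ComplexShape.up ℤ)).obj J

variable {K} {M : ModuleCat.{u} E} {J : CochainComplex (ModuleCat.{u} (E ⊗[K] F)) ℤ}

/-- By linearity, acting on the values of a homomorphism from `M` is the same as acting on its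
argument in `M`. For the diagonal bimodule this identifies `a ⊗ 1` with `1 ⊗ a`. -/
lemma homFunctor_map_centralAction_eq {s s' : Subring.center E}
    (h : ∀ m : M, (s : E) • m = (s' : E) • m) :
    ((homFunctor K F M).mapHomologicalComplex (ComplexShape.up ℤ)).map
        (centralAction J ⟨_, tmul_mem_center K s 1⟩) =
      ((homFunctor K F M).mapHomologicalComplex (ComplexShape.up ℤ)).map
        (centralAction J ⟨_, tmul_mem_center K s' 1⟩) := by
  refine HomologicalComplex.hom_ext _ _ fun q => ?_
  refine ModuleCat.hom_ext (LinearMap.ext fun g => ModuleCat.hom_ext (LinearMap.ext fun m => ?_))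
  change M ⟶ _ at g
  exact (g.hom.map_smul (s : E) m).symm.trans ((congrArg g.hom (h m)).trans
    (g.hom.map_smul (s' : E) m))

end HomComplexes

/-! ### Equality of the two central actions on a rigid complex -/

section Rigid

variable {K : Type v} [Field K] {A : Type u} [Ring A] [Algebra K A] {R : BimodComplex K A A}

section

variable (K : Type v) [Field K] {E F H : Type u} [Ring E] [Algebra K E] [Ring F] [Algebra K F]
  [Ring H] {M : CochainComplex (ModuleCat.{u} E) ℤ} {N : CochainComplex (ModuleCat.{u} F) ℤ}

lemma centralAction_restrict_tensorComplex (τ : H →+* E ⊗[K] F) {z : Subring.center H}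
    {s : Subring.center E} {t : Subring.center F} (hz : τ z = (s : E) ⊗ₜ (t : F)) :
    centralAction (restrict τ (tensorComplex K M N)) z =
      restrictMap τ (tensorMap K (centralAction M s) (centralAction N t)) := by
  rw [← centralAction_tensorComplex]
  refine HomologicalComplex.hom_ext _ _ fun q => ?_
  refine ModuleCat.hom_ext (LinearMap.ext fun m => ?_)
  exact congrArg (fun r => r • (show (tensorComplex K M N).X q from m)) hz

/-- Central elements acting factorwise on `M ⊗ N` may be replaced by others with the same classes in
the derived endomorphisms of `M` and `N`. The homotopies realizing this exist after injective
resolution of the factors. -/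
lemma Q_map_centralAction_restrict_tensorComplex_eq (τ : H →+* E ⊗[K] F) {z z' : Subring.center H}
    {s s' : Subring.center E} {t t' : Subring.center F} (hz : τ z = (s : E) ⊗ₜ (t : F))
    (hz' : τ z' = (s' : E) ⊗ₜ (t' : F)) (hM : HasBoundedCohomology M) (hN : HasBoundedCohomology N)
    (hs : DerivedCategory.Q.map (centralAction M s) = DerivedCategory.Q.map (centralAction M s'))
    (ht : DerivedCategory.Q.map (centralAction N t) = DerivedCategory.Q.map (centralAction N t')) :
    DerivedCategory.Q.map (centralAction (restrict τ (tensorComplex K M N)) z) =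
      DerivedCategory.Q.map (centralAction (restrict τ (tensorComplex K M N)) z') := by
  obtain ⟨a, b, hab⟩ := hM
  obtain ⟨I, ι, hι⟩ := exists_isInjectiveResolution M a fun q hq => hab q (Or.inl hq)
  have := hι.isKInjective
  have := hι.quasiIso
  obtain ⟨a, b, hab⟩ := hN
  obtain ⟨J, ι', hι'⟩ := exists_isInjectiveResolution N a fun q hq => hab q (Or.inl hq)
  have := hι'.isKInjective
  have := hι'.quasiIso
  rw [centralAction_restrict_tensorComplex K τ hz, centralAction_restrict_tensorComplex K τ hz']
  exact Q_map_restrictMap_eq _ (Q_map_tensorMap_eq K hs ht ι ι')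

end

variable (K) in
lemma tmul_smul_diagonal (a : A) (b : Aᵐᵒᵖ) (m : A) :
    ((a ⊗ₜ[K] b : Env K A) • (show diagonal K A from m)) =
      (show diagonal K A from a * m * b.unop) := by
  let : Module (Env K A) A := instModuleTensorProductMop K A
  change (a ⊗ₜ[K] b : Env K A) • m = a * m * b.unop
  rw [TensorProduct.Algebra.smul_def]
  simp [mul_assoc]

variable (K) in
lemma inl_smul_diagonal (a : Subalgebra.center K A) (m : diagonal K A) :
    (centerInl K A A a : Env K A) • m = (centerInr K A A a : Env K A) • m := by
  refine (tmul_smul_diagonal K (a : A) 1 m).trans ?_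
  refine Eq.trans ?_ (tmul_smul_diagonal K 1 (MulOpposite.op (a : A)) m).symm
  change (a : A) * (show A from m) * 1 = 1 * (show A from m) * a
  rw [mul_one, one_mul]
  exact (Subalgebra.mem_center_iff.1 a.2 m).symm

/-- On a rigid dualizing complex, the two actions of the center agree in the derived category. -/
lemma IsRigidDualizingComplex.leftCenter_eq_rightCenter (hR : IsRigidDualizingComplex K R)
    (a : Subalgebra.center K A) : leftCenter K R a = rightCenter K R a := by
  obtain ⟨a₀, ha₀⟩ := hR.exists_rightCenter_eq a
  obtain ⟨c, hc⟩ := hR.exists_leftCenter_eq a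
  obtain ⟨J, ι, hι, ⟨ρ⟩⟩ := hR.rigid
  have := hι.isKInjective
  have := hι.quasiIso
  -- Pairs of outside and inside central elements which act equally on the factors of `R ⊗ R` act
  -- equally on `J`, and then on `Hom_{Aᵉ}(A, J)`.
  have key : ∀ {z w z' w' s t s' t' : Subring.center (Env K A)},
      outsideInside K A ((z : Env K A) ⊗ₜ (w : Env K A)) = (s : Env K A) ⊗ₜ (t : Env K A) →
      outsideInside K A ((z' : Env K A) ⊗ₜ (w' : Env K A)) = (s' : Env K A) ⊗ₜ (t' : Env K A) →
      DerivedCategory.Q.map (centralAction R s) = DerivedCategory.Q.map (centralAction R s') →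
      DerivedCategory.Q.map (centralAction R t) = DerivedCategory.Q.map (centralAction R t') →
      DerivedCategory.Q.map (((homFunctor K (Env K A) (diagonal K A)).mapHomologicalComplex
        (ComplexShape.up ℤ)).map (centralAction J ⟨_, tmul_mem_center K z w⟩)) =
      DerivedCategory.Q.map (((homFunctor K (Env K A) (diagonal K A)).mapHomologicalComplex
        (ComplexShape.up ℤ)).map (centralAction J ⟨_, tmul_mem_center K z' w'⟩)) := by
    intro z w z' w' s t s' t' h₁ h₂ h₃ h₄
    have h₅ := Q_map_centralAction_restrict_tensorComplex_eq K (M := R) (N := R)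
      (outsideInside K A).toRingHom (z := ⟨_, tmul_mem_center K z w⟩)
      (z' := ⟨_, tmul_mem_center K z' w'⟩) h₁ h₂ hR.bounded hR.bounded h₃ h₄
    change DerivedCategory.Q.map (centralAction (selfTensor K R) _) =
      DerivedCategory.Q.map (centralAction (selfTensor K R) _) at h₅
    have h₆ : DerivedCategory.Q.map (centralAction J ⟨_, tmul_mem_center K z w⟩) =
        DerivedCategory.Q.map (centralAction J ⟨_, tmul_mem_center K z' w'⟩) := by
      rw [← cancel_epi (DerivedCategory.Q.map ι), ← Functor.map_comp, ← Functor.map_comp,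
        ← centralAction_naturality, ← centralAction_naturality, Functor.map_comp, Functor.map_comp,
        h₅]
    obtain ⟨H⟩ := homotopy_of_Q_map_eq _ _ h₆
    exact DerivedCategory.Q_map_eq_of_homotopy _
      (Functor.mapHomotopy (homFunctor K (Env K A) (diagonal K A)) H)
  have hone : ∀ x y : A, outsideInside K A
      ((x ⊗ₜ MulOpposite.op y) ⊗ₜ ((1 : Env K A))) = (x ⊗ₜ 1) ⊗ₜ (1 ⊗ₜ MulOpposite.op y) :=
    fun x y => outsideInside_tmul K _ _ _ _
  have hone' : ∀ x y : A, outsideInside K A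
      ((1 : Env K A) ⊗ₜ (x ⊗ₜ MulOpposite.op y)) = (1 ⊗ₜ MulOpposite.op y) ⊗ₜ (x ⊗ₜ 1) :=
    fun x y => outsideInside_tmul K _ _ _ _
  -- The inside action of `1 ⊗ a₀` is right multiplication by `a₀` on the first factor. This equals
  -- left multiplication by `a` there, which is the outside action of `a ⊗ 1`.
  have e₁ := key (z := 1) (w := centerInr K A A a₀) (z' := centerInl K A A a) (w' := 1)
    (s := centerInr K A A a₀) (t := 1) (s' := centerInl K A A a) (t' := 1)
    (hone' 1 a₀) (hone a 1) ha₀.symm rfl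
  -- On the second factor: the outside action of `1 ⊗ a` is right multiplication by `a`, equal to
  -- left multiplication by `c`, the inside action of `c ⊗ 1`.
  have e₂ := key (z := centerInr K A A a) (w := 1) (z' := 1) (w' := centerInl K A A c)
    (s := 1) (t := centerInr K A A a) (s' := 1) (t' := centerInl K A A c)
    (hone 1 a) (hone' c 1) rfl hc
  -- The outside actions of `a ⊗ 1` and `1 ⊗ a` on `Hom_{Aᵉ}(A, J)` coincide, which joins the two
  -- chains. Transport along `ρ` then gives the same equality on `R`.
  have e₃ : DerivedCategory.Q.map (centralAction (homFunctorComplex K (diagonal K A) J)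
      (centerInr K A A a₀)) = DerivedCategory.Q.map (centralAction
        (homFunctorComplex K (diagonal K A) J) (centerInl K A A c)) := by
    refine e₁.trans (Eq.trans ?_ e₂)
    exact congrArg _ (homFunctor_map_centralAction_eq (inl_smul_diagonal K a))
  have e₄ : rightCenter K R a₀ = leftCenter K R c := by
    refine (cancel_mono ρ.hom).1 ?_
    refine (Q_map_centralAction_naturality ρ.hom _).trans ?_
    refine Eq.trans ?_ (Q_map_centralAction_naturality ρ.hom _).symm
    exact congrArg _ e₃
  rw [ha₀, e₄, hc]

lemma IsRigidDualizingComplex.leftSubset_eq_rightSubset (hR : IsRigidDualizingComplex K R)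
    (S : Submonoid (DerivedEnd K R)) : leftSubset K S = rightSubset K S := by
  ext a
  change leftCenter K R a ∈ S ↔ rightCenter K R a ∈ S
  rw [hR.leftCenter_eq_rightCenter]

end Rigid

/-! ### Localization of `Hom`-complexes -/

section TorsionHomSingle

open CochainComplex CochainComplex.HomComplex

variable {E : Type u} [Ring E] {I I' : CochainComplex (ModuleCat.{u} E) ℤ} {κ : I ⟶ I'}
  {Λ : Type*} [CommMonoid Λ] {ρ : Λ →* End I} {ρ' : Λ →* End I'}

lemma isNoetherian_homology_single (X : ModuleCat.{u} E) [IsNoetherian E X] (q : ℤ) :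
    IsNoetherian E (((singleFunctor (ModuleCat.{u} E) 0).obj X).homology q) := by
  have : IsNoetherian E (((singleFunctor (ModuleCat.{u} E) 0).obj X).X q) := by
    by_cases hq : q = 0
    · subst hq
      exact isNoetherian_of_linearEquiv
        (HomologicalComplex.singleObjXSelf (.up ℤ) 0 X).symm.toLinearEquiv
    · have := ModuleCat.subsingleton_of_isZero (HomologicalComplex.isZero_single_obj_X
        (ComplexShape.up ℤ) 0 X q hq)
      have : Finite (((singleFunctor (ModuleCat.{u} E) 0).obj X).X q) :=
        @Finite.of_subsingleton _ this
      exact isNoetherian_of_finite _ _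
  exact isNoetherian_homology _

namespace IsTorsionHom

variable [IsNoetherianRing E] (h : IsTorsionHom κ ρ ρ') (a : ℤ) [I.IsStrictlyGE a] [I'.IsStrictlyGE a]
  (hI : ∀ q, Injective (I.X q)) (hI' : ∀ q, Injective (I'.X q))
  (X : ModuleCat.{u} E) [IsNoetherian E X] {p q r : ℤ} (hp : p + 1 = q) (hr : q + 1 = r)
include h a hI hI' hp hr

/-- Specializes the torsion statement on cocycles to a module in degree zero, whose cochains are
just homomorphisms to the terms of the complex. -/
lemma exists_hom (g : X ⟶ I'.X q) (hg : g ≫ I'.d q r = 0) : ∃ (l : Λ) (g' : X ⟶ I.X q),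
    g' ≫ I.d q r = 0 ∧ ∃ w : X ⟶ I'.X p, w ≫ I'.d p q = g' ≫ κ.f q - g ≫ (ρ' l).f q := by
  obtain ⟨l, z, w, hw⟩ := h.exists_cocycle a hI hI' 0 (fun q => isNoetherian_homology_single X q) hp
    (Cocycle.fromSingleMk g (zero_add q) r hr hg)
  obtain ⟨g', hg', rfl⟩ := Cocycle.fromSingleMk_surjective z q (zero_add q) r hr
  obtain ⟨w, rfl⟩ := Cochain.fromSingleMk_surjective w p (zero_add p)
  refine ⟨l, g', hg', -w, ?_⟩
  rw [Preadditive.neg_comp, ← neg_sub (g ≫ (ρ' l).f q), neg_inj]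
  rw [Cochain.δ_fromSingleMk _ _ _ q (zero_add q)] at hw
  refine (Cochain.fromSingleEquiv (zero_add q)).symm.injective ?_
  refine hw.trans ?_
  exact ((Cochain.fromSingleMk_sub _ _ (zero_add q)).trans (congrArg₂ (· - ·)
    (Cochain.fromSingleMk_postcomp _ (zero_add q) _)
    (Cochain.fromSingleMk_postcomp _ (zero_add q) _))).symm

lemma exists_comp_d_eq (g : X ⟶ I.X q) (hg : g ≫ I.d q r = 0) (w : X ⟶ I'.X p)
    (hw : w ≫ I'.d p q = g ≫ κ.f q) :
    ∃ (l : Λ) (w' : X ⟶ I.X p), w' ≫ I.d p q = g ≫ (ρ l).f q := by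
  obtain ⟨l, w', hw'⟩ := h.exists_δ_eq a hI hI' 0 (fun q => isNoetherian_homology_single X q) hp
    (Cocycle.fromSingleMk g (zero_add q) r hr hg) (Cochain.fromSingleMk w (zero_add p)) (by
      rw [Cochain.δ_fromSingleMk _ _ _ q (zero_add q), hw]
      exact Cochain.fromSingleMk_postcomp _ _ _)
  obtain ⟨w', rfl⟩ := Cochain.fromSingleMk_surjective w' p (zero_add p)
  refine ⟨l, w', ?_⟩
  rw [Cochain.δ_fromSingleMk _ _ _ q (zero_add q)] at hw'
  refine (Cochain.fromSingleEquiv (zero_add q)).symm.injective ?_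
  refine hw'.trans ?_
  exact (Cochain.fromSingleMk_postcomp _ (zero_add q) _).symm

end IsTorsionHom

end TorsionHomSingle

/-! ### Localization of `Hom_E(D, -)` -/

section HomLocalization

variable (K : Type v) [Field K] {E F : Type u} [Ring E] [Algebra K E] [Ring F] [Algebra K F]

lemma includeLeft_commute_includeRight (e : E) (f : F) :
    Commute ((Algebra.TensorProduct.includeLeft : E →ₐ[K] E ⊗[K] F).toRingHom e)
      ((Algebra.TensorProduct.includeRight : F →ₐ[K] E ⊗[K] F).toRingHom f) := by
  change (e ⊗ₜ[K] (1 : F)) * ((1 : E) ⊗ₜ[K] f) = ((1 : E) ⊗ₜ[K] f) * (e ⊗ₜ[K] (1 : F))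
  simp

/-- `Hom_E(D, -)` of a morphism of complexes. -/
abbrev homFunctorComplexMap (D : ModuleCat.{u} E) {J Y : CochainComplex (ModuleCat.{u} (E ⊗[K] F)) ℤ}
    (κ : J ⟶ Y) : homFunctorComplex K D J ⟶ homFunctorComplex K D Y :=
  ((homFunctor K F D).mapHomologicalComplex (ComplexShape.up ℤ)).map κ

variable {K} in
/-- `Hom_E(D, -)` of a torsion isomorphism between bounded below complexes of injectives is a torsion
isomorphism. -/
lemma isTorsionIso_homologyMap_homFunctorComplexMap [IsNoetherianRing E]
    {T : Submonoid (Subring.center F)} (D : ModuleCat.{u} E) [IsNoetherian E D]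
    {J Y : CochainComplex (ModuleCat.{u} (E ⊗[K] F)) ℤ} (κ : J ⟶ Y)
    (hκ : ∀ q, IsTorsionIso
      (centerImage T (Algebra.TensorProduct.includeRight : F →ₐ[K] E ⊗[K] F).toRingHom)
      (HomologicalComplex.homologyMap κ q).hom)
    (a : ℤ) [J.IsStrictlyGE a] [Y.IsStrictlyGE a] (hJ : ∀ q, Injective (J.X q))
    (hY : ∀ q, Injective (Y.X q)) (q : ℤ) :
    IsTorsionIso T (HomologicalComplex.homologyMap (homFunctorComplexMap K D κ) q).hom := by
  let i : E →+* E ⊗[K] F := (Algebra.TensorProduct.includeLeft : E →ₐ[K] E ⊗[K] F).toRingHom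
  let j : F →+* E ⊗[K] F := (Algebra.TensorProduct.includeRight : F →ₐ[K] E ⊗[K] F).toRingHom
  have hi : IsFlatHom i := (rightBasisLeft K E F).isFlatHom
  let τ (X : CochainComplex (ModuleCat.{u} (E ⊗[K] F)) ℤ) : T →* End (restrict i X) :=
    ((commActHom i j (includeLeft_commute_includeRight K) X : F →* _).comp
      ((Subring.center F).subtype : Subring.center F →* F)).comp T.subtype
  have htors : IsTorsionHom (restrictMap i κ) (τ J) (τ Y) := by
    refine ⟨fun t => ?_, fun p q r hp hr x w hx hw => ?_, fun p q r hp hr y hy => ?_⟩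
    · exact commActHom_naturality i j (includeLeft_commute_includeRight K) κ _
    · obtain ⟨z, ⟨t, ht, hz⟩, v, hv⟩ := (hκ q).exists_boundary hp hr x hx w hw
      exact ⟨⟨t, ht⟩, v, hv.trans (congrArg (fun r => r • (show J.X q from x)) hz)⟩
    · obtain ⟨z, ⟨t, ht, hz⟩, x, hx, w, hw⟩ := (hκ q).exists_cycle hp hr y hy
      exact ⟨⟨t, ht⟩, x, hx, w, hw.trans
        (congrArg (fun r => (κ.f q).hom x - r • (show Y.X q from y)) hz)⟩
  have h₁ : (restrict i J).IsStrictlyGE a := (CochainComplex.isStrictlyGE_iff _ _).2 fun q hq =>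
    (ModuleCat.restrictScalars.{u} i).map_isZero (J.isZero_of_isStrictlyGE a q hq)
  have h₂ : (restrict i Y).IsStrictlyGE a := (CochainComplex.isStrictlyGE_iff _ _).2 fun q hq =>
    (ModuleCat.restrictScalars.{u} i).map_isZero (Y.isZero_of_isStrictlyGE a q hq)
  have h₃ : ∀ q, Injective ((restrict i J).X q) := fun q => by
    have := hJ q
    exact restrictScalars_injective i (J.X q)
  have h₄ : ∀ q, Injective ((restrict i Y).X q) := fun q => by
    have := hY q
    exact restrictScalars_injective i (Y.X q)
  refine isTorsionIso_homologyMap (sub_add_cancel q 1) rfl (fun x w hx hw => ?_) fun y hy => ?_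
  · obtain ⟨l, w', h⟩ := htors.exists_comp_d_eq a h₃ h₄ D (sub_add_cancel q 1) rfl x hx w hw
    exact ⟨l, l.2, w', h⟩
  · obtain ⟨l, g, hg, w, hw⟩ := htors.exists_hom a h₃ h₄ D (sub_add_cancel q 1) rfl y hy
    exact ⟨l, l.2, g, hg, w, hw⟩

variable {E' F' : Type u} [Ring E'] [Algebra K E'] [Ring F'] [Algebra K F']

variable {K}

/-- The map `Hom_{E'}(D', N) → Hom_E(D, N)` induced by an `E`-linear map `D → D'`. -/
def homRestrict (φ : E →ₐ[K] E') (χ : F →ₐ[K] F') {D : ModuleCat.{u} E}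
    {D' : ModuleCat.{u} E'} (δ : D ⟶ (ModuleCat.restrictScalars.{u} φ.toRingHom).obj D')
    {N : ModuleCat.{u} (E' ⊗[K] F')} (g : D' ⟶ (ModuleCat.restrictScalars.{u}
      (Algebra.TensorProduct.includeLeft : E' →ₐ[K] E' ⊗[K] F').toRingHom).obj N) :
    D ⟶ (ModuleCat.restrictScalars.{u} (Algebra.TensorProduct.includeLeft :
      E →ₐ[K] E ⊗[K] F).toRingHom).obj ((ModuleCat.restrictScalars.{u}
        (Algebra.TensorProduct.map φ χ).toRingHom).obj N) :=
  ModuleCat.ofHom (Y := (ModuleCat.restrictScalars.{u} (Algebra.TensorProduct.includeLeft :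
      E →ₐ[K] E ⊗[K] F).toRingHom).obj ((ModuleCat.restrictScalars.{u}
        (Algebra.TensorProduct.map φ χ).toRingHom).obj N))
    { toFun := fun m => (g.hom (δ.hom m) : N)
      map_add' := fun x y => (congrArg g.hom (δ.hom.map_add x y)).trans (g.hom.map_add _ _)
      map_smul' := fun e x => by
        refine (congrArg g.hom (δ.hom.map_smul e x)).trans ((g.hom.map_smul (φ e) _).trans ?_)
        refine congrArg (fun r : E' ⊗[K] F' => r • (show N from g.hom (δ.hom x))) ?_
        exact ((Algebra.TensorProduct.map_tmul φ χ e 1).trans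
          (congrArg (φ e ⊗ₜ[K] ·) (map_one χ))).symm }

/-- The map `Hom_{E'}(D', N) → Hom_E(D, N)` induced by an `E`-linear map `D → D'`. -/
def homFunctorComplexRestrict (φ : E →ₐ[K] E') (χ : F →ₐ[K] F') {D : ModuleCat.{u} E}
    {D' : ModuleCat.{u} E'} (δ : D ⟶ (ModuleCat.restrictScalars.{u} φ.toRingHom).obj D')
    (J : CochainComplex (ModuleCat.{u} (E' ⊗[K] F')) ℤ) :
    restrict χ.toRingHom (homFunctorComplex K D' J) ⟶
      homFunctorComplex K D (restrict (Algebra.TensorProduct.map φ χ).toRingHom J) where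
  f q := ModuleCat.ofHom
    (X := (restrict χ.toRingHom (homFunctorComplex K D' J)).X q)
    (Y := (homFunctorComplex K D (restrict (Algebra.TensorProduct.map φ χ).toRingHom J)).X q)
    { toFun := fun g => homRestrict φ χ δ g
      map_add' := fun g g' => rfl
      map_smul' := fun f g => by
        refine ModuleCat.hom_ext (LinearMap.ext fun m => ?_)
        refine congrArg (fun r : E' ⊗[K] F' => r • (show J.X q from
          (show D' ⟶ (ModuleCat.restrictScalars _).obj (J.X q) from g).hom (δ.hom m))) ?_
        exact ((Algebra.TensorProduct.map_tmul φ χ 1 f).trans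
          (congrArg (· ⊗ₜ[K] χ f) (map_one φ))).symm }
  comm' p q _ := rfl

/-- If every `E`-linear map from `D` to an `E'`-module extends uniquely to `D'`, then
`Hom_{E'}(D', N)` and `Hom_E(D, N)` agree. -/
lemma isIso_homFunctorComplexRestrict (φ : E →ₐ[K] E') (χ : F →ₐ[K] F') {D : ModuleCat.{u} E}
    {D' : ModuleCat.{u} E'} (δ : D ⟶ (ModuleCat.restrictScalars.{u} φ.toRingHom).obj D')
    (hδ : ∀ (N : ModuleCat.{u} E') (g : D ⟶ (ModuleCat.restrictScalars.{u} φ.toRingHom).obj N),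
      ∃! g' : D' ⟶ N, δ ≫ (ModuleCat.restrictScalars.{u} φ.toRingHom).map g' = g)
    (J : CochainComplex (ModuleCat.{u} (E' ⊗[K] F')) ℤ) :
    IsIso (homFunctorComplexRestrict φ χ δ J) := by
  have : ∀ q, IsIso ((homFunctorComplexRestrict φ χ δ J).f q) := fun q => by
    refine (ConcreteCategory.isIso_iff_bijective _).2 ⟨fun g g' h => ?_, fun g => ?_⟩
    · let g₁ : D' ⟶ (ModuleCat.restrictScalars.{u} (Algebra.TensorProduct.includeLeft :
        E' →ₐ[K] E' ⊗[K] F').toRingHom).obj (J.X q) := g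
      let g₂ : D' ⟶ (ModuleCat.restrictScalars.{u} (Algebra.TensorProduct.includeLeft :
        E' →ₐ[K] E' ⊗[K] F').toRingHom).obj (J.X q) := g'
      change homRestrict φ χ δ g₁ = homRestrict φ χ δ g₂ at h
      exact (hδ _ (δ ≫ (ModuleCat.restrictScalars.{u} φ.toRingHom).map g₂)).unique (y₁ := g₁)
        (ModuleCat.hom_ext (LinearMap.ext fun m => congrArg (fun k => k.hom m) h)) rfl
    · let g₀ : D ⟶ (ModuleCat.restrictScalars.{u} φ.toRingHom).obj
          ((ModuleCat.restrictScalars.{u} (Algebra.TensorProduct.includeLeft :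
            E' →ₐ[K] E' ⊗[K] F').toRingHom).obj (J.X q)) := ModuleCat.ofHom
        (Y := (ModuleCat.restrictScalars.{u} φ.toRingHom).obj
          ((ModuleCat.restrictScalars.{u} (Algebra.TensorProduct.includeLeft :
            E' →ₐ[K] E' ⊗[K] F').toRingHom).obj (J.X q)))
        { toFun := fun m => (show D ⟶ (ModuleCat.restrictScalars _).obj
            ((ModuleCat.restrictScalars _).obj (J.X q)) from g).hom m
          map_add' := fun x y => (show D ⟶ (ModuleCat.restrictScalars _).obj
            ((ModuleCat.restrictScalars _).obj (J.X q)) from g).hom.map_add x y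
          map_smul' := fun e x => by
            refine ((show D ⟶ (ModuleCat.restrictScalars _).obj
              ((ModuleCat.restrictScalars _).obj (J.X q)) from g).hom.map_smul e x).trans ?_
            refine congrArg (fun r : E' ⊗[K] F' => r • (show J.X q from (show D ⟶ (ModuleCat.restrictScalars _).obj
              ((ModuleCat.restrictScalars _).obj (J.X q)) from g).hom x)) ?_
            exact ((Algebra.TensorProduct.map_tmul φ χ e 1).trans
              (congrArg (φ e ⊗ₜ[K] ·) (map_one χ))) }
      obtain ⟨g', hg', -⟩ := hδ _ g₀
      refine ⟨g', ModuleCat.hom_ext (LinearMap.ext fun m => ?_)⟩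
      exact congrArg (fun k => k.hom m) hg'
  exact HomologicalComplex.Hom.isIso_of_components _

/-- The comparison `F' ⊗_F Hom_E(D, J) → Hom_{E'}(D', J')`: the torsion isomorphism `Hom_E(D, κ)`,
followed by the identification of homomorphisms from `D` with those from `D'`, becomes a
quasi-isomorphism after localization. -/
lemma quasiIso_bcDesc_homFunctorComplexMap [IsNoetherianRing E] {T : Submonoid (Subring.center F)}
    (φ : E →ₐ[K] E') {χ : F →ₐ[K] F'} (hχ : IsCentralLocalization T χ.toRingHom)
    {D : ModuleCat.{u} E} [IsNoetherian E D] {D' : ModuleCat.{u} E'}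
    (δ : D ⟶ (ModuleCat.restrictScalars.{u} φ.toRingHom).obj D')
    [hφ : IsFlatHom (Algebra.TensorProduct.map φ χ).toRingHom]
    {J : CochainComplex (ModuleCat.{u} (E ⊗[K] F)) ℤ}
    {J' : CochainComplex (ModuleCat.{u} (E' ⊗[K] F')) ℤ}
    [IsIso (homFunctorComplexRestrict φ χ δ J')]
    (κ : J ⟶ restrict (Algebra.TensorProduct.map φ χ).toRingHom J')
    (hκ : ∀ q, IsTorsionIso
      (centerImage T (Algebra.TensorProduct.includeRight : F →ₐ[K] E ⊗[K] F).toRingHom)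
      (HomologicalComplex.homologyMap κ q).hom)
    (a : ℤ) [J.IsStrictlyGE a] [J'.IsStrictlyGE a] (hJ : ∀ q, Injective (J.X q))
    (hJ' : ∀ q, Injective (J'.X q)) :
    QuasiIso (bcDesc χ.toRingHom (homFunctorComplexMap K D κ ≫
      inv (homFunctorComplexRestrict φ χ δ J'))) := by
  have h : (restrict (Algebra.TensorProduct.map φ χ).toRingHom J').IsStrictlyGE a :=
    (CochainComplex.isStrictlyGE_iff _ _).2 fun q hq =>
      (ModuleCat.restrictScalars.{u} _).map_isZero (J'.isZero_of_isStrictlyGE a q hq)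
  have h' : ∀ q, Injective ((restrict (Algebra.TensorProduct.map φ χ).toRingHom J').X q) :=
    fun q => by
      have := hJ' q
      exact restrictScalars_injective _ (J'.X q)
  refine hχ.quasiIso_bcDesc _ fun q => ?_
  rw [HomologicalComplex.homologyMap_comp]
  exact (isTorsionIso_homologyMap_homFunctorComplexMap D κ hκ a hJ h' q).comp_isIso _

end HomLocalization

/-! ### Bimodule homomorphisms from the diagonal bimodule -/

section Diagonal

variable (K : Type v) [Field K] {A A' : Type u} [Ring A] [Algebra K A] [Ring A'] [Algebra K A']

/-- The homomorphism of enveloping algebras induced by a homomorphism of algebras. -/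
abbrev envMap (φ : A →ₐ[K] A') : Env K A →ₐ[K] Env K A' :=
  Algebra.TensorProduct.map φ (AlgHom.op φ)

lemma tmul_one_smul_one (a : A) :
    (a ⊗ₜ[K] (1 : Aᵐᵒᵖ) : Env K A) • (show diagonal K A from (1 : A)) = a := by
  refine (tmul_smul_diagonal K a 1 1).trans ?_
  change a * 1 * (1 : A) = a
  rw [mul_one, mul_one]

lemma one_tmul_smul_one (a : A) : ((1 : A) ⊗ₜ[K] MulOpposite.op a : Env K A) •
    (show diagonal K A from (1 : A)) = a := by
  refine (tmul_smul_diagonal K 1 _ 1).trans ?_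
  change (1 : A) * 1 * a = a
  rw [mul_one, one_mul]

/-- The diagonal bimodule is cyclic, generated by `1`. -/
lemma isNoetherian_diagonal [IsNoetherianRing (Env K A)] : IsNoetherian (Env K A) (diagonal K A) := by
  refine isNoetherian_of_surjective
    (LinearMap.toSpanSingleton (Env K A) (diagonal K A) (show diagonal K A from (1 : A)))
    (LinearMap.range_eq_top.2 fun (a : A) => ⟨a ⊗ₜ 1, tmul_one_smul_one K a⟩)

lemma map_smul_of_map_tmul_smul {E F P Q : Type*} [Ring E] [Algebra K E] [Ring F] [Algebra K F]
    [AddCommGroup P] [Module (E ⊗[K] F) P] [AddCommGroup Q] [Module (E ⊗[K] F) Q] (f : P →+ Q)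
    (h : ∀ (x : E) (y : F) (p : P), f ((x ⊗ₜ[K] y) • p) = (x ⊗ₜ[K] y) • f p)
    (r : E ⊗[K] F) (p : P) : f (r • p) = r • f p := by
  induction r with
  | zero => rw [zero_smul, zero_smul, map_zero]
  | add x y hx hy => rw [add_smul, add_smul, map_add, hx, hy]
  | tmul x y => exact h x y p

/-- An algebra homomorphism, as a homomorphism of bimodules. -/
def diagonalMap (φ : A →ₐ[K] A') : diagonal K A ⟶
    (ModuleCat.restrictScalars.{u} (envMap K φ).toRingHom).obj (diagonal K A') :=
  ModuleCat.ofHom (X := diagonal K A)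
    (Y := (ModuleCat.restrictScalars.{u} (envMap K φ).toRingHom).obj (diagonal K A'))
    { toFun := fun a => (φ (show A from a) : A')
      map_add' := fun a b => map_add φ (show A from a) (show A from b)
      map_smul' := map_smul_of_map_tmul_smul K (P := diagonal K A)
        (Q := (ModuleCat.restrictScalars.{u} (envMap K φ).toRingHom).obj (diagonal K A'))
        (AddMonoidHom.mk' (fun a => (φ (show A from a) : A'))
          fun a b => map_add φ (show A from a) (show A from b)) fun x y a => by
        refine (congrArg φ (tmul_smul_diagonal K x y a)).trans ?_
        refine Eq.trans ?_ (tmul_smul_diagonal K (φ x) (AlgHom.op φ y) (φ (show A from a))).symm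
        exact (map_mul φ _ _).trans (congrArg (· * φ y.unop) (map_mul φ _ _)) }

variable {K}

lemma tmul_smul_eq_of_diagonal {N : ModuleCat.{u} (Env K A)} (g : diagonal K A ⟶ N) (a : A) :
    (a ⊗ₜ[K] (1 : Aᵐᵒᵖ) : Env K A) • g.hom (1 : A) = g.hom a := by
  refine (g.hom.map_smul _ _).symm.trans (congrArg g.hom (tmul_one_smul_one K a))

lemma tmul_op_smul_eq_of_diagonal {N : ModuleCat.{u} (Env K A)} (g : diagonal K A ⟶ N) (a : A) :
    ((1 : A) ⊗ₜ[K] MulOpposite.op a : Env K A) • g.hom (1 : A) = g.hom a := by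
  refine (g.hom.map_smul _ _).symm.trans (congrArg g.hom (one_tmul_smul_one K a))

lemma smul_tmul_smul_of_central {N : Type*} [AddCommGroup N] [Module (Env K A) N] {n : N}
    (hn : ∀ a : A,
      ((1 : A) ⊗ₜ[K] MulOpposite.op a : Env K A) • n = (a ⊗ₜ[K] (1 : Aᵐᵒᵖ) : Env K A) • n)
    (x : A) (y : Aᵐᵒᵖ) (a : A) : ((x * a * y.unop) ⊗ₜ[K] (1 : Aᵐᵒᵖ) : Env K A) • n =
      (x ⊗ₜ[K] y : Env K A) • (a ⊗ₜ[K] (1 : Aᵐᵒᵖ) : Env K A) • n := by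
  have h := hn y.unop
  rw [show ((x * a * y.unop) ⊗ₜ[K] (1 : Aᵐᵒᵖ) : Env K A) =
    ((x * a) ⊗ₜ 1) * (y.unop ⊗ₜ 1) by simp, mul_smul, ← h, ← mul_smul, ← mul_smul]
  simp

/-- The map `A → N`, `a ↦ a n`, for `n` a central element of the bimodule `N`. -/
def ofCentral {N : ModuleCat.{u} (Env K A)} (n : N) (hn : ∀ a : A,
    ((1 : A) ⊗ₜ[K] MulOpposite.op a : Env K A) • n = (a ⊗ₜ[K] (1 : Aᵐᵒᵖ) : Env K A) • n) :
    diagonal K A ⟶ N :=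
  have h (a b : A) : ((a + b) ⊗ₜ[K] (1 : Aᵐᵒᵖ) : Env K A) • n =
      (a ⊗ₜ[K] (1 : Aᵐᵒᵖ) : Env K A) • n + (b ⊗ₜ[K] (1 : Aᵐᵒᵖ) : Env K A) • n := by
    rw [TensorProduct.add_tmul, add_smul]
  ModuleCat.ofHom (X := diagonal K A)
    { toFun := fun a => ((show A from a) ⊗ₜ[K] (1 : Aᵐᵒᵖ) : Env K A) • n
      map_add' := h
      map_smul' := map_smul_of_map_tmul_smul K (P := diagonal K A)
        (AddMonoidHom.mk' (fun a => ((show A from a) ⊗ₜ[K] (1 : Aᵐᵒᵖ) : Env K A) • n) h)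
        fun x y a => (congrArg (fun b : A => (b ⊗ₜ[K] (1 : Aᵐᵒᵖ) : Env K A) • n)
          (tmul_smul_diagonal K x y a)).trans (smul_tmul_smul_of_central hn x y a) }

/-- Bimodule homomorphisms out of `A` are central elements of the target. In a bimodule over the
localization, an element commuting with the image of `A` also commutes with fractions, so it is
central over `A'`. -/
lemma existsUnique_diagonal_hom {S : Submonoid (Subring.center A)} {φ : A →ₐ[K] A'}
    (hφ : IsCentralLocalization S φ.toRingHom) (N : ModuleCat.{u} (Env K A'))
    (g : diagonal K A ⟶ (ModuleCat.restrictScalars.{u} (envMap K φ).toRingHom).obj N) :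
    ∃! g' : diagonal K A' ⟶ N,
      diagonalMap K φ ≫ (ModuleCat.restrictScalars.{u} (envMap K φ).toRingHom).map g' = g := by
  let n : N := g.hom (1 : A)
  have h₁ : ∀ a : A, (φ a ⊗ₜ[K] (1 : A'ᵐᵒᵖ) : Env K A') • n = g.hom a := fun a => by
    refine Eq.trans ?_ (tmul_smul_eq_of_diagonal g a)
    refine congrArg (fun r : Env K A' => r • n) ?_
    exact ((Algebra.TensorProduct.map_tmul _ _ a 1).trans
      (congrArg (φ a ⊗ₜ[K] ·) (map_one (AlgHom.op φ)))).symm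
  have h₂ : ∀ a : A, ((1 : A') ⊗ₜ[K] MulOpposite.op (φ a) : Env K A') • n = g.hom a := fun a => by
    refine Eq.trans ?_ (tmul_op_smul_eq_of_diagonal g a)
    refine congrArg (fun r : Env K A' => r • n) ?_
    exact ((Algebra.TensorProduct.map_tmul _ _ 1 (MulOpposite.op a)).trans
      (congrArg (· ⊗ₜ[K] MulOpposite.op (φ a)) (map_one φ))).symm
  have h₃ : ∀ a : A', ((1 : A') ⊗ₜ[K] MulOpposite.op a : Env K A') • n =
      (a ⊗ₜ[K] (1 : A'ᵐᵒᵖ) : Env K A') • n := fun y => by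
    obtain ⟨s, hs, a, ha⟩ := hφ.surj y
    obtain ⟨v, hv⟩ := hφ.isUnit s hs
    -- With `φ(s) y = φ(a)`, multiplication by `φ(s)` turns both actions of `y` on `n` into those of
    -- `φ(a)`, which agree; then `φ(s)` is cancelled.
    have e₁ : (φ (s : A) ⊗ₜ[K] (1 : A'ᵐᵒᵖ) : Env K A') • ((1 : A') ⊗ₜ[K] MulOpposite.op y : Env K A') • n =
        (φ (s : A) ⊗ₜ[K] (1 : A'ᵐᵒᵖ) : Env K A') • (y ⊗ₜ[K] (1 : A'ᵐᵒᵖ) : Env K A') • n := by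
      have e₂ : φ (s : A) * y = φ a := ha
      have e₃ := (h₂ a).trans (h₁ a).symm
      have e₄ := (h₂ s).trans (h₁ s).symm
      rw [← e₂] at e₃
      rw [smul_smul, smul_smul, Algebra.TensorProduct.tmul_mul_tmul,
        Algebra.TensorProduct.tmul_mul_tmul, one_mul, one_mul, ← e₃, MulOpposite.op_mul,
        show ((1 : A') ⊗ₜ[K] (MulOpposite.op y * MulOpposite.op (φ (s : A))) : Env K A') =
          (1 ⊗ₜ MulOpposite.op y) * (1 ⊗ₜ MulOpposite.op (φ (s : A))) by simp, mul_smul, e₄, smul_smul]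
      simp
    have e₂ := congrArg (fun m => (((v⁻¹ : A'ˣ) : A') ⊗ₜ[K] (1 : A'ᵐᵒᵖ) : Env K A') • m) e₁
    have e₃ : (((v⁻¹ : A'ˣ) : A') ⊗ₜ[K] (1 : A'ᵐᵒᵖ) : Env K A') * (φ (s : A) ⊗ₜ[K] (1 : A'ᵐᵒᵖ)) = 1 := by
      rw [Algebra.TensorProduct.tmul_mul_tmul, show φ (s : A) = v from hv.symm, Units.inv_mul, one_mul]
      rfl
    simpa only [← mul_smul _ (φ (s : A) ⊗ₜ[K] (1 : A'ᵐᵒᵖ) : Env K A'), e₃, one_smul] using e₂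
  refine ⟨ofCentral n h₃, ?_, fun g' hg' => ?_⟩
  · exact ModuleCat.hom_ext (LinearMap.ext fun a => h₁ a)
  · refine ModuleCat.hom_ext (LinearMap.ext fun (a : A') => ?_)
    have h : g'.hom (1 : A') = n := by
      refine Eq.trans ?_ (congrArg (fun k => k.hom (1 : A)) hg')
      exact congrArg g'.hom (map_one φ).symm
    refine (tmul_smul_eq_of_diagonal g' a).symm.trans ?_
    rw [h]
    rfl

end Diagonal

lemma IsTorsionIso.mono {E : Type u} [Ring E] {S T : Submonoid (Subring.center E)} {M N : Type*}
    [AddCommGroup M] [Module E M] [AddCommGroup N] [Module E N] {f : M →ₗ[E] N}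
    (hf : IsTorsionIso S f) (hST : S ≤ T) : IsTorsionIso T f where
  ker m hm := (hf.ker m hm).imp fun _ h => ⟨hST h.1, h.2⟩
  coker n := (hf.coker n).imp fun _ h => ⟨hST h.1, h.2⟩

/-! ### Localization of `RHom_E(D, -)` in the derived category -/

section HomLocalizationDerived

variable {K : Type v} [Field K] {E F E' F' : Type u} [Ring E] [Algebra K E] [Ring F] [Algebra K F]
  [Ring E'] [Algebra K E'] [Ring F'] [Algebra K F']

/-- Base change along a flat homomorphism preserves isomorphisms in the derived category. -/
lemma nonempty_Q_obj_bcComplex_iso {G H : Type u} [Ring G] [Ring H] (ψ : G →+* H) [IsFlatHom ψ]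
    {M N : CochainComplex (ModuleCat.{u} G) ℤ}
    (e : DerivedCategory.Q.obj M ≅ DerivedCategory.Q.obj N) :
    Nonempty (DerivedCategory.Q.obj (bcComplex ψ M) ≅ DerivedCategory.Q.obj (bcComplex ψ N)) :=
  ⟨((baseChange ψ).mapDerivedCategoryFactors.app M).symm ≪≫
    (baseChange ψ).mapDerivedCategory.mapIso e ≪≫ (baseChange ψ).mapDerivedCategoryFactors.app N⟩

/-- Localization of `RHom_E(D, X)`, where the localization of `X` with respect to the action of the
center of `F` is also a module over a localization of `E`. -/
lemma nonempty_Q_obj_bcComplex_iso_homFunctorComplex [IsNoetherianRing E]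
    {T : Submonoid (Subring.center F)} {φ : E →ₐ[K] E'} {χ : F →ₐ[K] F'}
    (hχ : IsCentralLocalization T χ.toRingHom)
    (hφχ : IsFlatHom (Algebra.TensorProduct.map φ χ).toRingHom)
    {D : ModuleCat.{u} E} [IsNoetherian E D] {D' : ModuleCat.{u} E'}
    (δ : D ⟶ (ModuleCat.restrictScalars.{u} φ.toRingHom).obj D')
    (hδ : ∀ (N : ModuleCat.{u} E') (g : D ⟶ (ModuleCat.restrictScalars.{u} φ.toRingHom).obj N),
      ∃! g' : D' ⟶ N, δ ≫ (ModuleCat.restrictScalars.{u} φ.toRingHom).map g' = g)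
    {X J : CochainComplex (ModuleCat.{u} (E ⊗[K] F)) ℤ} {ι : X ⟶ J} (hι : IsInjectiveResolution ι)
    {X' J' : CochainComplex (ModuleCat.{u} (E' ⊗[K] F')) ℤ} {ι' : X' ⟶ J'}
    (hι' : IsInjectiveResolution ι')
    (t : X ⟶ restrict (Algebra.TensorProduct.map φ χ).toRingHom X')
    (ht : ∀ q, IsTorsionIso
      (centerImage T (Algebra.TensorProduct.includeRight : F →ₐ[K] E ⊗[K] F).toRingHom)
      (HomologicalComplex.homologyMap t q).hom)
    {R : CochainComplex (ModuleCat.{u} F) ℤ}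
    (e : DerivedCategory.Q.obj R ≅ DerivedCategory.Q.obj (homFunctorComplex K D J)) :
    Nonempty (DerivedCategory.Q.obj (bcComplex χ.toRingHom R) ≅
      DerivedCategory.Q.obj (homFunctorComplex K D' J')) := by
  let Φ : E ⊗[K] F →+* E' ⊗[K] F' := (Algebra.TensorProduct.map φ χ).toRingHom
  obtain ⟨a₁, ha₁⟩ := hι.boundedBelow
  obtain ⟨a₂, ha₂⟩ := hι'.boundedBelow
  have hJ'Φ : ∀ q, Injective ((restrict Φ J').X q) := fun q => by
    have := hι'.injective q
    exact restrictScalars_injective Φ (J'.X q)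
  have hK : (restrict Φ J').IsKInjective := by
    have : (restrict Φ J').IsStrictlyGE a₂ := (CochainComplex.isStrictlyGE_iff _ _).2 fun q hq =>
      (ModuleCat.restrictScalars.{u} Φ).map_isZero (ha₂ q hq)
    exact CochainComplex.isKInjective_of_injective _ a₂
  have := hι.quasiIso
  have := hι'.quasiIso
  -- Since `J'` stays K-injective over `E ⊗ F` by flatness, `t` lifts to the resolutions. The lift
  -- inherits the torsion property on cohomology.
  obtain ⟨κ, ⟨hκ⟩⟩ := exists_lift_of_quasiIso ι (t ≫ restrictMap Φ ι')
  have hκtors : ∀ q, IsTorsionIso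
      (centerImage T (Algebra.TensorProduct.includeRight : F →ₐ[K] E ⊗[K] F).toRingHom)
      (HomologicalComplex.homologyMap κ q).hom := fun q => by
    refine IsTorsionIso.of_iso (HomologicalComplex.homologyMap ι q)
      (HomologicalComplex.homologyMap (restrictMap Φ ι') q) ?_ (ht q)
    rw [← HomologicalComplex.homologyMap_comp, ← HomologicalComplex.homologyMap_comp]
    exact (hκ.homologyMap_eq q).symm
  have h₁ : J.IsStrictlyGE (min a₁ a₂) := (CochainComplex.isStrictlyGE_iff _ _).2 fun q hq =>
    ha₁ q (by lia)
  have h₂ : J'.IsStrictlyGE (min a₁ a₂) := (CochainComplex.isStrictlyGE_iff _ _).2 fun q hq =>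
    ha₂ q (by lia)
  have := isIso_homFunctorComplexRestrict φ χ δ hδ J'
  have := quasiIso_bcDesc_homFunctorComplexMap φ hχ δ κ hκtors (min a₁ a₂) hι.injective hι'.injective
  have := hχ.isFlatHom
  obtain ⟨e'⟩ := nonempty_Q_obj_bcComplex_iso χ.toRingHom e
  exact ⟨e' ≪≫ asIso (DerivedCategory.Q.map (bcDesc χ.toRingHom (homFunctorComplexMap K D κ ≫
    inv (homFunctorComplexRestrict φ χ δ J'))))⟩

end HomLocalizationDerived

/-! ### Localization of `RHom_E(D, M ⊗ N)` -/

section TensorHomLocalization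

variable {K : Type v} [Field K] {E F E' F' P Q P' Q' : Type u} [Ring E] [Algebra K E] [Ring F]
  [Algebra K F] [Ring E'] [Algebra K E'] [Ring F'] [Algebra K F'] [Ring P] [Algebra K P] [Ring Q]
  [Algebra K Q] [Ring P'] [Algebra K P'] [Ring Q'] [Algebra K Q']

/-- Localization of `M ⊗ N`, considered as a complex of modules over `E ⊗ F` via a homomorphism to
`P ⊗ Q`, if the action of the multiplicative subset of the center of `E` can be expressed by that
of the center of `F`. -/
lemma isTorsionIso_homologyMap_restrict_tensorRestrict
    {U : Submonoid (Subring.center E)} {T : Submonoid (Subring.center F)}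
    {V : Submonoid (Subring.center P)} {W : Submonoid (Subring.center Q)}
    {φ : E →ₐ[K] E'} {χ : F →ₐ[K] F'} {α : P →ₐ[K] P'} {β : Q →ₐ[K] Q'}
    (hφ : IsCentralLocalization U φ.toRingHom) (hχ : IsCentralLocalization T χ.toRingHom)
    (hα : IsCentralLocalization V α.toRingHom) (hβ : IsCentralLocalization W β.toRingHom)
    (τ : E ⊗[K] F →+* P ⊗[K] Q) (τ' : E' ⊗[K] F' →+* P' ⊗[K] Q')
    (hτ : (Algebra.TensorProduct.map α β).toRingHom.comp τ =
      τ'.comp (Algebra.TensorProduct.map φ χ).toRingHom)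
    {M : CochainComplex (ModuleCat.{u} P) ℤ} {N : CochainComplex (ModuleCat.{u} Q) ℤ}
    (hM : HasBoundedCohomology M) (hN : HasBoundedCohomology N)
    (h₁ : ∀ v ∈ V, ∀ w ∈ W, ∃ s ∈ U, ∃ t ∈ T, τ ((s : E) ⊗ₜ (t : F)) = (v : P) ⊗ₜ (w : Q))
    (h₂ : ∀ s ∈ U, ∀ t ∈ T, ∃ t' ∈ T, ∃ (v v' : Subring.center P) (w w' : Subring.center Q),
      τ ((s : E) ⊗ₜ (t : F)) = (v : P) ⊗ₜ (w : Q) ∧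
      τ (1 ⊗ₜ (t' : F)) = (v' : P) ⊗ₜ (w' : Q) ∧
      DerivedCategory.Q.map (centralAction M v) = DerivedCategory.Q.map (centralAction M v') ∧
      DerivedCategory.Q.map (centralAction N w) = DerivedCategory.Q.map (centralAction N w'))
    (q : ℤ) :
    IsTorsionIso (centerImage T (Algebra.TensorProduct.includeRight : F →ₐ[K] E ⊗[K] F).toRingHom)
      (HomologicalComplex.homologyMap (restrictMap τ (tensorRestrict α β
        (bcUnitComplex α.toRingHom M) (bcUnitComplex β.toRingHom N)) ≫ restrictSquare hτ _) q).hom := by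
  have h := isTorsionIso_homologyMap_of_forall (isTorsionIso_tensorRestrict α β
    (f := bcUnitComplex α.toRingHom M) (g := bcUnitComplex β.toRingHom N)
    (fun p => hα.isTorsionIso_bcUnit (M.X p)) (fun p => hβ.isTorsionIso_bcUnit (N.X p))) q
  have hle : centerTensor K V W ≤ centerImage (centerTensor K U T) τ := fun z hz => by
    obtain ⟨v, hv, w, hw, hz⟩ := exists_eq_tmul_of_mem_centerTensor hz
    obtain ⟨s, hs, t, ht, h⟩ := h₁ v hv w hw
    exact ⟨_, tmul_mem_centerTensor hs ht, hz.trans h.symm⟩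
  have := isIso_restrictSquare hτ
    (tensorComplex K (bcComplex α.toRingHom M) (bcComplex β.toRingHom N))
  -- The map is a torsion isomorphism for `U` and `T` together. The exchange replaces each such
  -- element by one of `T` acting in the same way on cohomology.
  refine (IsCentralLocalization.tensor K hφ hχ).isTorsionIso_homologyMap_of_exchange _ q ?_ ?_
  · rw [HomologicalComplex.homologyMap_comp]
    exact (isTorsionIso_homologyMap_restrict _ q (h.mono hle)).comp_isIso _
  · intro z hz
    obtain ⟨s, hs, t, ht, hz⟩ := exists_eq_tmul_of_mem_centerTensor hz
    obtain ⟨t', ht', v, v', w, w', e₁, e₂, e₃, e₄⟩ := h₂ s hs t ht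
    refine ⟨⟨_, tmul_mem_center K 1 t'⟩, ⟨t', ht', rfl⟩, fun m => ?_⟩
    rw [← homologyMap_centralAction, ← homologyMap_centralAction]
    have key := homologyMap_eq_of_Q_map_eq (Q_map_centralAction_restrict_tensorComplex_eq K τ
      ((congrArg τ hz).trans e₁) (z' := ⟨_, tmul_mem_center K 1 t'⟩) e₂ hM hN e₃ e₄) q
    exact congrArg (fun f => f.hom m) key

/-- Localization of `RHom_E(D, M ⊗ N)`. -/
lemma exists_isInjectiveResolution_bcComplex_iso [IsNoetherianRing E]
    {U : Submonoid (Subring.center E)} {T : Submonoid (Subring.center F)}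
    {V : Submonoid (Subring.center P)} {W : Submonoid (Subring.center Q)}
    {φ : E →ₐ[K] E'} {χ : F →ₐ[K] F'} {α : P →ₐ[K] P'} {β : Q →ₐ[K] Q'}
    (hφ : IsCentralLocalization U φ.toRingHom) (hχ : IsCentralLocalization T χ.toRingHom)
    (hα : IsCentralLocalization V α.toRingHom) (hβ : IsCentralLocalization W β.toRingHom)
    (τ : E ⊗[K] F →+* P ⊗[K] Q) (τ' : E' ⊗[K] F' →+* P' ⊗[K] Q')
    (hτ : (Algebra.TensorProduct.map α β).toRingHom.comp τ =
      τ'.comp (Algebra.TensorProduct.map φ χ).toRingHom)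
    {M : CochainComplex (ModuleCat.{u} P) ℤ} {N : CochainComplex (ModuleCat.{u} Q) ℤ}
    (hM : HasBoundedCohomology M) (hN : HasBoundedCohomology N)
    (h₁ : ∀ v ∈ V, ∀ w ∈ W, ∃ s ∈ U, ∃ t ∈ T, τ ((s : E) ⊗ₜ (t : F)) = (v : P) ⊗ₜ (w : Q))
    (h₂ : ∀ s ∈ U, ∀ t ∈ T, ∃ t' ∈ T, ∃ (v v' : Subring.center P) (w w' : Subring.center Q),
      τ ((s : E) ⊗ₜ (t : F)) = (v : P) ⊗ₜ (w : Q) ∧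
      τ (1 ⊗ₜ (t' : F)) = (v' : P) ⊗ₜ (w' : Q) ∧
      DerivedCategory.Q.map (centralAction M v) = DerivedCategory.Q.map (centralAction M v') ∧
      DerivedCategory.Q.map (centralAction N w) = DerivedCategory.Q.map (centralAction N w'))
    {D : ModuleCat.{u} E} [IsNoetherian E D] {D' : ModuleCat.{u} E'}
    (δ : D ⟶ (ModuleCat.restrictScalars.{u} φ.toRingHom).obj D')
    (hδ : ∀ (N : ModuleCat.{u} E') (g : D ⟶ (ModuleCat.restrictScalars.{u} φ.toRingHom).obj N),
      ∃! g' : D' ⟶ N, δ ≫ (ModuleCat.restrictScalars.{u} φ.toRingHom).map g' = g)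
    {R : CochainComplex (ModuleCat.{u} F) ℤ}
    (h : ∃ (J : CochainComplex (ModuleCat.{u} (E ⊗[K] F)) ℤ)
      (ι : restrict τ (tensorComplex K M N) ⟶ J), IsInjectiveResolution ι ∧
      Nonempty (DerivedCategory.Q.obj R ≅ DerivedCategory.Q.obj (homFunctorComplex K D J))) :
    ∃ (J : CochainComplex (ModuleCat.{u} (E' ⊗[K] F')) ℤ)
      (ι : restrict τ' (tensorComplex K (bcComplex α.toRingHom M) (bcComplex β.toRingHom N)) ⟶ J),
      IsInjectiveResolution ι ∧ Nonempty (DerivedCategory.Q.obj (bcComplex χ.toRingHom R) ≅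
        DerivedCategory.Q.obj (homFunctorComplex K D' J)) := by
  obtain ⟨J, ι, hι, ⟨e⟩⟩ := h
  have := hα.isFlatHom
  have := hβ.isFlatHom
  obtain ⟨a, _, ha⟩ := hM.bcComplex α.toRingHom
  obtain ⟨b, _, hb⟩ := hN.bcComplex β.toRingHom
  obtain ⟨J', ι', hι'⟩ := exists_isInjectiveResolution (restrict τ' (tensorComplex K
    (bcComplex α.toRingHom M) (bcComplex β.toRingHom N))) (a + b) fun q hq => by
    rw [← HomologicalComplex.exactAt_iff_isZero_homology]
    exact ((HomologicalComplex.exactAt_iff_isZero_homology _ _).2 (isZero_homology_tensorComplex K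
      (fun q hq => ha q (Or.inl hq)) (fun q hq => hb q (Or.inl hq)) q hq)).map
        (ModuleCat.restrictScalars.{u} τ')
  exact ⟨J', ι', hι', nonempty_Q_obj_bcComplex_iso_homFunctorComplex hχ
    (IsCentralLocalization.tensor K hφ hχ).isFlatHom δ hδ hι hι' _
    (isTorsionIso_homologyMap_restrict_tensorRestrict hφ hχ hα hβ τ τ' hτ hM hN h₁ h₂) e⟩

end TensorHomLocalization

/-! ### Localization of rigid dualizing complexes -/

section RigidLocalization

variable {K : Type v} [Field K] {A A' : Type u} [Ring A] [Algebra K A] [Ring A'] [Algebra K A']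

lemma map_envMap_comp_outsideInside (φ : A →ₐ[K] A') :
    (Algebra.TensorProduct.map (envMap K φ) (envMap K φ)).toRingHom.comp
        (outsideInside K A).toRingHom =
      (outsideInside K A').toRingHom.comp
        (Algebra.TensorProduct.map (envMap K φ) (envMap K φ)).toRingHom := by
  refine RingHom.ext fun z => ?_
  change Algebra.TensorProduct.map (envMap K φ) (envMap K φ) (outsideInside K A z) =
    outsideInside K A' (Algebra.TensorProduct.map (envMap K φ) (envMap K φ) z)
  induction z with
  | zero => simp only [map_zero]
  | add x y hx hy => simp only [map_add, hx, hy]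
  | tmul x y =>
    induction x using TensorProduct.induction_on with
    | zero => simp only [TensorProduct.zero_tmul, map_zero]
    | add x x' hx hx' => simp only [TensorProduct.add_tmul, map_add, hx, hx']
    | tmul a b =>
      induction y using TensorProduct.induction_on with
      | zero => simp only [TensorProduct.tmul_zero, map_zero]
      | add y y' hy hy' => simp only [TensorProduct.tmul_add, map_add, hy, hy']
      | tmul c d => simp only [outsideInside_tmul, Algebra.TensorProduct.map_tmul]

lemma Q_map_centralAction_tmul (R : BimodComplex K A A) (s t : Subalgebra.center K A) :
    DerivedCategory.Q.map (centralAction R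
      ⟨_, tmul_mem_center K (toCenter K A s) (toCenterOp K A t)⟩) =
        leftCenter K R s * rightCenter K R t := by
  have h : (⟨_, tmul_mem_center K (toCenter K A s) (toCenterOp K A t)⟩ :
      Subring.center (Env K A)) = centerInl K A A s * centerInr K A A t :=
    Subtype.ext (by
      change (s : A) ⊗ₜ[K] MulOpposite.op (t : A) =
        ((s : A) ⊗ₜ 1) * ((1 : A) ⊗ₜ[K] MulOpposite.op (t : A))
      simp)
  exact (congrArg (fun z => DerivedCategory.Q.map (centralAction R z)) h).trans
    (map_mul ((Functor.mapEnd R DerivedCategory.Q).comp (centralAction R)) _ _)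

/-- The localization of a rigid complex with respect to a multiplicative subset of the center, whose
left and right actions agree. -/
lemma rigid_bcComplex [IsNoetherianRing (Env K A)] {R : BimodComplex K A A}
    (hb : HasBoundedCohomology R) {S : Submonoid (Subalgebra.center K A)}
    (hS : ∀ s ∈ S, leftCenter K R s = rightCenter K R s)
    (hR : ∃ (J : CochainComplex (ModuleCat.{u} (Env K A ⊗[K] Env K A)) ℤ)
      (ι : selfTensor K R ⟶ J), IsInjectiveResolution ι ∧
      Nonempty (DerivedCategory.Q.obj R ≅ DerivedCategory.Q.obj
        (homFunctorComplex (F := Env K A) K (diagonal K A) J)))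
    {φ : A →ₐ[K] A'} (hφ : IsCentralLocalization (S.map (toCenter K A)) φ.toRingHom)
    (hφop : IsCentralLocalization (S.map (toCenterOp K A)) (AlgHom.op φ).toRingHom) :
    ∃ (J : CochainComplex (ModuleCat.{u} (Env K A' ⊗[K] Env K A')) ℤ)
      (ι : selfTensor K (A := A') (bcComplex (envMap K φ).toRingHom R) ⟶ J),
      IsInjectiveResolution ι ∧ Nonempty
        (DerivedCategory.Q.obj (bcComplex (envMap K φ).toRingHom R) ≅ DerivedCategory.Q.obj
          (homFunctorComplex (F := Env K A') K (diagonal K A') J)) := by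
  have hψ := IsCentralLocalization.tensor K hφ hφop
  have := isNoetherian_diagonal K (A := A)
  refine exists_isInjectiveResolution_bcComplex_iso (E := Env K A) (F := Env K A) (P := Env K A)
    (Q := Env K A) (E' := Env K A') (F' := Env K A') (P' := Env K A') (Q' := Env K A')
    (D := diagonal K A) (D' := diagonal K A')
    hψ hψ hψ hψ (outsideInside K A).toRingHom (outsideInside K A').toRingHom
    (map_envMap_comp_outsideInside φ) hb hb ?_ ?_ (diagonalMap K φ)
    (existsUnique_diagonal_hom hφ) hR
  -- Denominators on the two factors of `R ⊗ R` are regrouped into an outside and an inside element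
  -- by exchanging the two right-hand entries.
  · intro v hv w hw
    obtain ⟨_, ⟨s, hs, rfl⟩, _, ⟨t, ht, rfl⟩, hv⟩ := exists_eq_tmul_of_mem_centerTensor hv
    obtain ⟨_, ⟨s', hs', rfl⟩, _, ⟨t', ht', rfl⟩, hw⟩ := exists_eq_tmul_of_mem_centerTensor hw
    refine ⟨_, tmul_mem_centerTensor (Submonoid.mem_map_of_mem _ hs)
      (Submonoid.mem_map_of_mem _ ht'), _, tmul_mem_centerTensor (Submonoid.mem_map_of_mem _ hs')
      (Submonoid.mem_map_of_mem _ ht), ?_⟩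
    rw [hv, hw]
    exact outsideInside_tmul K (s : A) (s' : A) (MulOpposite.op (t' : A)) (MulOpposite.op (t : A))
  · intro v hv w hw
    obtain ⟨_, ⟨s, hs, rfl⟩, _, ⟨t, ht, rfl⟩, hv⟩ := exists_eq_tmul_of_mem_centerTensor hv
    obtain ⟨_, ⟨s', hs', rfl⟩, _, ⟨t', ht', rfl⟩, hw⟩ := exists_eq_tmul_of_mem_centerTensor hw
    -- The element acts by `x ⊗ y ↦ s x t' ⊗ s' y t`. Moving `s` to the right on the first factor
    -- and `t` to the left on the second gives the purely inside action of `(s' t) ⊗ (s t')`.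
    refine ⟨_, tmul_mem_centerTensor (Submonoid.mem_map_of_mem _ (mul_mem hs' ht))
      (Submonoid.mem_map_of_mem _ (mul_mem hs ht')),
      ⟨_, tmul_mem_center K (toCenter K A s) (toCenterOp K A t')⟩, centerInr K A A (s * t'),
      ⟨_, tmul_mem_center K (toCenter K A s') (toCenterOp K A t)⟩, centerInl K A A (s' * t),
      ?_, ?_, ?_, ?_⟩
    · rw [hv, hw]
      exact outsideInside_tmul K (s : A) (s' : A) (MulOpposite.op (t : A)) (MulOpposite.op (t' : A))
    · exact outsideInside_tmul K (1 : A) ((s' * t : Subalgebra.center K A) : A) 1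
        (MulOpposite.op ((s * t' : Subalgebra.center K A) : A))
    · refine (Q_map_centralAction_tmul R s t').trans ?_
      rw [hS s hs]
      exact (map_mul (rightCenter K R) s t').symm
    · refine (Q_map_centralAction_tmul R s' t).trans ?_
      rw [← hS t ht]
      exact (map_mul (leftCenter K R) s' t).symm

/-- The localization of a rigid dualizing complex is a rigid dualizing complex. -/
theorem IsRigidDualizingComplex.localize [IsNoetherianRing (Env K A)] {R : BimodComplex K A A}
    (hR : IsRigidDualizingComplex K R) (S : Submonoid (DerivedEnd K R)) :
    IsRigidDualizingComplex K (localize K (leftSubset K S) (leftSubset K S) R) where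
  toIsDualizingComplex := hR.isDualizingComplex_bcComplex S
    (isCentralLocalization_toCentralLoc K _) (by
      rw [← hR.leftSubset_eq_rightSubset]
      exact isCentralLocalization_op_toCentralLoc K _)
  rigid := rigid_bcComplex hR.bounded (fun s _ => hR.leftCenter_eq_rightCenter s) hR.rigid
    (isCentralLocalization_toCentralLoc K _) (isCentralLocalization_op_toCentralLoc K _)

end RigidLocalization

end YekutieliZhang

end

theorem theorem3p1 (K : Type v) [Field K] :
    (∀ (A B : Type u) [Ring A] [Algebra K A] [Ring B] [Algebra K B]
        (R : YekutieliZhang.BimodComplex K A B), YekutieliZhang.IsDualizingComplex K R →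
      ∀ S : Submonoid (YekutieliZhang.DerivedEnd K R),
        YekutieliZhang.IsDualizingComplex K
          (YekutieliZhang.localize K (YekutieliZhang.leftSubset K S)
            (YekutieliZhang.rightSubset K S) R)) ∧
    (∀ (A : Type u) [Ring A] [Algebra K A]
        (R : YekutieliZhang.BimodComplex K A A), YekutieliZhang.IsRigidDualizingComplex K R →
      IsNoetherianRing (YekutieliZhang.Env K A) →
      ∀ S : Submonoid (YekutieliZhang.DerivedEnd K R),
        YekutieliZhang.leftSubset K S = YekutieliZhang.rightSubset K S ∧
        YekutieliZhang.IsRigidDualizingComplex K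
          (YekutieliZhang.localize K (YekutieliZhang.leftSubset K S)
            (YekutieliZhang.leftSubset K S) R)) :=
  ⟨fun _ _ _ _ _ _ _ hR S => hR.localize S,
    fun _ _ _ _ hR _ S => ⟨hR.leftSubset_eq_rightSubset S, hR.localize S⟩⟩
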